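/- Let $n\ge 0$ and let $\mathcal H=\mathcal H_n$ be the Iwahori–Hecke algebra of $S_n$ over $\mathbb Z[\xi]$, generated by $\tilde T_{s_1},\dots,\tilde T_{s_{n-1}}$ (with $s_i=(i\ \,i+1)$) subject to $\tilde T_{s_i}\tilde T_{s_j}=\tilde T_{s_j}\tilde T_{s_i}$ for $|i-j|\ge 2$, the braid relations $\tilde T_{s_i}\tilde T_{s_{i+1}}\tilde T_{s_i}=\tilde T_{s_{i+1}}\tilde T_{s_i}\tilde T_{s_{i+1}}$, and $\tilde T_{s_i}^2=1+\xi\tilde T_{s_i}$; let $\{\tilde T_w\mid w\in S_n\}$ be its standard basis. Put $\mathcal H^+=\sum_w\mathbb N[\xi]\tilde T_w$; for $a,b\in\mathcal H^+$ write $a\le b$ if $b-a\in\mathcal H^+$, and $a<b$ if moreover $a\ne b$. Likewise for $a,b\in\mathbb N[\xi]$ write $a\le b$ if $b-a\in\mathbb N[\xi]$. For compositions $\lambda,\mu$ of $n$ write $\lambda\le\mu$ ($\lambda$ refines $\mu$) if $\lambda=\mu$ or $\mu$ is obtained from $\lambda$ by adding together adjacent components. For a composition $\lambda$ of $n$ let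 $S_\lambda\le S_n$ be the parabolic subgroup, $w_\lambda$ the product in increasing order of the simple reflections $s_i\in S_\lambda$, $l_\lambda=\ell(w_\lambda)$, and $\lambda-1$ the composition obtained by replacing each component $\lambda_i>1$ by the two components $\lambda_i-1,\,1$. For parabolic subgroups $U\le K$ put $\mathcal N_{K,U}(h)=\sum_d\tilde T_{d^{-1}}h\tilde T_d$, the sum over the elements $d\in K$ of minimal length in their coset $Ud$, and let $$\eta_\lambda=\mathcal N_{S_{\lambda-1},1}(\tilde T_{w_\lambda}),\qquad b_\lambda=\mathcal N_{S_n,S_\lambda}(\eta_\lambda).$$ **Theorem.** If $\lambda,\mu$ are compositions of $n$ with $\lambda<\mu$ in the refinement order, then $\xi^{l_\mu-l_\lambda}b_\mu<b_\lambda$ (both sides lying in $\mathcal H^+$). **Corollary.** There is exactly one family $(\Gamma_\nu)_{\nu\vdash n}$ of central elements of $\mathcal H$ such that $\Gamma_\nu|_{\xi=0}=\sum_{w\in C_\nu}\tilde T_w$ and $\Gamma_\nu-\sum_{w\in C_\nu}\tilde T_w$ contains no $\tilde T_w$ with $w$ a shortest element of a conjugacy class, where $C_\nu$ is the class of cycle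 type $\nu$. For every composition $\alpha$ of $n$ there is a unique expression $b_\alpha=\sum_{\nu\vdash n}r_{\alpha,\nu}\Gamma_\nu$ with $r_{\alpha,\nu}\in\mathbb Z[\xi]$. If $\alpha<\beta$ in the refinement order, then $\xi^{l_\beta-l_\alpha}r_{\beta,\nu}\le r_{\alpha,\nu}$ in $\mathbb N[\xi]$ for all $\nu\vdash n$. -/

import Mathlib

open Polynomial

namespace HeckeNorm

/-! ### The symmetric group -/

/-- The simple reflection interchanging the adjacent letters `i` and `i + 1`. The letters are
`0, …, n - 1`, so this is the transposition usually written `s_{i+1} = (i+1  i+2)`. -/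
def simpleRefl {n : ℕ} (i : Fin (n - 1)) : Equiv.Perm (Fin n) :=
  Equiv.swap ⟨i, by omega⟩ ⟨i + 1, by omega⟩

/-- The permutation spelled by a word in the simple reflections. -/
def wordProd {n : ℕ} (l : List (Fin (n - 1))) : Equiv.Perm (Fin n) :=
  (l.map simpleRefl).prod

theorem exists_word {n : ℕ} (w : Equiv.Perm (Fin n)) :
    ∃ l : List (Fin (n - 1)), wordProd l = w := by
  rcases n with _ | n
  · exact ⟨[], Subsingleton.elim _ _⟩
  · have h : w ∈ Submonoid.closure
        (Set.range fun i : Fin n => Equiv.swap i.castSucc i.succ) := by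
      rw [Equiv.Perm.mclosure_swap_castSucc_succ]
      trivial
    induction h using Submonoid.closure_induction with
    | mem x hx =>
      obtain ⟨i, rfl⟩ := hx
      exact ⟨[i], by simp [wordProd, simpleRefl]; rfl⟩
    | one => exact ⟨[], rfl⟩
    | mul x y _ _ hx hy =>
      obtain ⟨a, rfl⟩ := hx
      obtain ⟨b, rfl⟩ := hy
      exact ⟨a ++ b, by simp [wordProd]⟩

/-- The length `ℓ(w)`: the least number of simple reflections in a word for `w`. -/
noncomputable def len {n : ℕ} (w : Equiv.Perm (Fin n)) : ℕ :=
  sInf {k | ∃ l : List (Fin (n - 1)), wordProd l = w ∧ l.length = k}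

theorem exists_reducedWord {n : ℕ} (w : Equiv.Perm (Fin n)) :
    ∃ l : List (Fin (n - 1)), wordProd l = w ∧ l.length = len w := by
  obtain ⟨l, hl⟩ := exists_word w
  have hne : {k | ∃ l : List (Fin (n - 1)), wordProd l = w ∧ l.length = k}.Nonempty :=
    ⟨_, l, hl, rfl⟩
  exact Nat.sInf_mem hne

/-- A reduced expression of `w`. -/
noncomputable def reducedWord {n : ℕ} (w : Equiv.Perm (Fin n)) : List (Fin (n - 1)) :=
  (exists_reducedWord w).choose

/-- `w` has minimal length in its conjugacy class. -/
def IsShortest {n : ℕ} (w : Equiv.Perm (Fin n)) : Prop :=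
  ∀ v : Equiv.Perm (Fin n), IsConj v w → len w ≤ len v

/-- `w` lies in the conjugacy class `C_ν` of permutations of cycle type `ν` (fixed points count as
cycles of length one). -/
def InClass {n : ℕ} (ν : n.Partition) (w : Equiv.Perm (Fin n)) : Prop :=
  w.partition.parts = ν.parts

/-! ### Compositions -/

/-- `μ ≤ ν` in the refinement order: `ν` is obtained from `μ` by adding together adjacent
components, i.e. by cutting `μ` into consecutive lists and summing each of them. -/
def Refines {n : ℕ} (μ ν : Composition n) : Prop :=
  ∃ L : List (List ℕ), L.flatten = μ.blocks ∧ L.map List.sum = ν.blocks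

/-- `μ < ν` in the refinement order. -/
def StrictRefines {n : ℕ} (μ ν : Composition n) : Prop :=
  Refines μ ν ∧ μ ≠ ν

/-- The composition `ν - 1`: every component `k > 1` is replaced by the two components
`k - 1, 1`. -/
def subOne {n : ℕ} (ν : Composition n) : Composition n where
  blocks := ν.blocks.flatMap fun k => if 1 < k then [k - 1, 1] else [k]
  blocks_pos := by
    intro i hi
    obtain ⟨k, hk, hik⟩ := List.mem_flatMap.1 hi
    have := ν.blocks_pos hk
    split_ifs at hik <;> simp at hik <;> omega
  blocks_sum := by
    have key : ∀ l : List ℕ,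
        (l.flatMap fun k => if 1 < k then [k - 1, 1] else [k]).sum = l.sum := by
      intro l
      induction l with
      | nil => rfl
      | cons a l ih =>
        rw [List.flatMap_cons, List.sum_append, ih, List.sum_cons]
        split_ifs <;> simp
        omega
    rw [key, ν.blocks_sum]

/-- The simple reflection `simpleRefl i` is one of the generators of `S_ν`: the number `i + 1`
satisfies `ν_1 + … + ν_k < i + 1 < ν_1 + … + ν_{k+1}` for some `k`. -/
def IsInner {n : ℕ} (ν : Composition n) (i : Fin (n - 1)) : Prop :=
  ∃ k : ℕ, ν.sizeUpTo k < i + 1 ∧ i + 1 < ν.sizeUpTo (k + 1)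

/-- The parabolic subgroup `S_ν`. -/
def parabolic {n : ℕ} (ν : Composition n) : Subgroup (Equiv.Perm (Fin n)) :=
  Subgroup.closure {s | ∃ i : Fin (n - 1), IsInner ν i ∧ s = simpleRefl i}

open Classical in
/-- The Coxeter element `w_ν`: the product of the generators of `S_ν`, in increasing order. -/
noncomputable def coxeterElt {n : ℕ} (ν : Composition n) : Equiv.Perm (Fin n) :=
  wordProd ((List.finRange (n - 1)).filter fun i => IsInner ν i)

/-- The number `l_ν = ℓ(w_ν)`. -/
noncomputable def minLen {n : ℕ} (ν : Composition n) : ℕ :=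
  len (coxeterElt ν)

/-! ### The Hecke algebra -/

/-- The defining relations of the Hecke algebra over `ℤ[ξ]`, where `ξ` is `Polynomial.X`. -/
inductive HeckeRel (n : ℕ) :
    FreeAlgebra ℤ[X] (Fin (n - 1)) → FreeAlgebra ℤ[X] (Fin (n - 1)) → Prop
  | comm (i j : Fin (n - 1)) (h : (i : ℕ) + 2 ≤ j ∨ (j : ℕ) + 2 ≤ i) :
      HeckeRel n (FreeAlgebra.ι ℤ[X] i * FreeAlgebra.ι ℤ[X] j)
        (FreeAlgebra.ι ℤ[X] j * FreeAlgebra.ι ℤ[X] i)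
  | braid (i j : Fin (n - 1)) (h : (j : ℕ) = i + 1) :
      HeckeRel n (FreeAlgebra.ι ℤ[X] i * FreeAlgebra.ι ℤ[X] j * FreeAlgebra.ι ℤ[X] i)
        (FreeAlgebra.ι ℤ[X] j * FreeAlgebra.ι ℤ[X] i * FreeAlgebra.ι ℤ[X] j)
  | quad (i : Fin (n - 1)) :
      HeckeRel n (FreeAlgebra.ι ℤ[X] i * FreeAlgebra.ι ℤ[X] i)
        (1 + (X : ℤ[X]) • FreeAlgebra.ι ℤ[X] i)

/-- The Iwahori–Hecke algebra of `S_n` over `ℤ[ξ]`. -/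
abbrev Hecke (n : ℕ) : Type := RingQuot (HeckeRel n)

/-- The generator attached to a simple reflection. -/
noncomputable def gen {n : ℕ} (i : Fin (n - 1)) : Hecke n :=
  RingQuot.mkAlgHom ℤ[X] (HeckeRel n) (FreeAlgebra.ι ℤ[X] i)

/-- The element `T_w`: the product of the generators along a reduced expression of `w`. By
Matsumoto's theorem it does not depend on the reduced expression. -/
noncomputable def T {n : ℕ} (w : Equiv.Perm (Fin n)) : Hecke n :=
  ((reducedWord w).map gen).prod

/-- The polynomial `p` lies in `ℕ[ξ]`. -/
def PolyPos (p : ℤ[X]) : Prop := ∀ i, 0 ≤ p.coeff i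

/-- The order `p ≤ q` on `ℕ[ξ]`. -/
def PolyLE (p q : ℤ[X]) : Prop := PolyPos p ∧ PolyPos q ∧ PolyPos (q - p)

/-- The positive cone `H⁺ = ∑_w ℕ[ξ] T_w`. -/
def posCone (n : ℕ) : Set (Hecke n) :=
  {h | ∃ f : Equiv.Perm (Fin n) → ℤ[X], (∀ w, PolyPos (f w)) ∧ h = ∑ w, f w • T w}

/-- The strict order `a < b` on the positive cone. -/
def HeckeLT {n : ℕ} (a b : Hecke n) : Prop :=
  a ∈ posCone n ∧ b ∈ posCone n ∧ b - a ∈ posCone n ∧ b - a ≠ 0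

/-! ### Norms -/

/-- `d` is a distinguished right coset representative of `U` in `K`: it lies in `K` and has minimal
length in the coset `U d`. -/
def IsDistinguished {n : ℕ} (K U : Subgroup (Equiv.Perm (Fin n))) (d : Equiv.Perm (Fin n)) :
    Prop :=
  d ∈ K ∧ ∀ u ∈ U, len d ≤ len (u * d)

open Classical in
/-- The relative norm of `h` from `U` to `K`. -/
noncomputable def relNorm {n : ℕ} (K U : Subgroup (Equiv.Perm (Fin n))) (h : Hecke n) : Hecke n :=
  ∑ d with IsDistinguished K U d, T d⁻¹ * h * T d

/-- `η_ν`, the norm of `T_{w_ν}` from the trivial group to `S_{ν-1}`. -/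
noncomputable def eta {n : ℕ} (ν : Composition n) : Hecke n :=
  relNorm (parabolic (subOne ν)) ⊥ (T (coxeterElt ν))

/-- `b_ν`, the norm of `η_ν` from `S_ν` to `S_n`. -/
noncomputable def normElt {n : ℕ} (ν : Composition n) : Hecke n :=
  relNorm ⊤ (parabolic ν) (eta ν)

/-! ### Class elements -/

/-- `Γ` is the family of class elements: every `Γ_ν` is central, specializes at `ξ = 0` (where
`T_w` becomes `w` in the group ring `ℤ S_n`) to the sum of the conjugacy class `C_ν`, and
`Γ_ν - ∑_{w ∈ C_ν} T_w` contains no `T_w` with `w` a shortest element of a conjugacy class. Here `f`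
is the family of coefficients of `Γ_ν` with respect to the basis of the `T_w`. -/
def IsClassElements {n : ℕ} (Γ : n.Partition → Hecke n) : Prop :=
  ∀ ν : n.Partition, Γ ν ∈ Subalgebra.center ℤ[X] (Hecke n) ∧
    ∃ f : Equiv.Perm (Fin n) → ℤ[X], Γ ν = ∑ w, f w • T w ∧
      (∀ w, InClass ν w → (f w).eval 0 = 1) ∧
      (∀ w, ¬ InClass ν w → (f w).eval 0 = 0) ∧
      (∀ w, IsShortest w → InClass ν w → f w = 1) ∧
      (∀ w, IsShortest w → ¬ InClass ν w → f w = 0)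

end HeckeNorm

/-
Let `J` be a set of simple reflections. The norm of `T_{w_J}` that defines `η` is the product over
`k ∈ J` of the Jucys–Murphy elements of the parabolic subalgebra `H_J`. This product has nonnegative
coefficients and commutes with the generators of `H_J`; hence its norm `b_J` to `H` is central.

An element commuting with the generators of `H_K` is governed by its coefficients at the Coxeter
elements `w_J`, `J ⊆ K`: any `w` can be brought to such a `w_J` by cyclic shifts
`w ↦ s w s` that do not increase the length, and along a shift the coefficients change by a
recursion over `ℕ[ξ]`. Comparing these coefficients for `k ∈ K`, where the product of the
Jucys–Murphy elements of `H_K` contributes only at `w_K` itself, the norm from `H_{K \ k}` to `H_K`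
of the product for `K \ k` dominates `ξ` times the product for `K`. Taking norms to `H` and removing
reflections one by one gives `ξ ^ (l_μ - l_λ) b_μ ≤ b_λ`, and the inequality is strict because the
left-hand side vanishes at `ξ = 0`.

By the same recursion the coefficients of a central element at all `w` are combinations, with the
class polynomials as coefficients, of those at one `w_J` in each conjugacy class. Conversely, at
`ξ = 0` the matrix of the coefficients of the `b_J` at these `w_J` is diagonal with positive
diagonal entries, so there are enough central elements for the class polynomials themselves to
define central elements `Γ_ν`. The `Γ_ν` are dual to the coefficients at the `w_J`, so
`r_{α,ν}` is the coefficient of `b_α` at the representative of the class `ν`, and the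
inequality between the `r_{α,ν}` is read off that between the `b_α`.
-/

namespace HeckeNorm

open Equiv (Perm)

variable {n : ℕ} {u v w d : Perm (Fin n)} {i j k m : ℕ} {J K U : Set ℕ} {a z : Hecke n}

/-! ### Adjacent transpositions -/

/-- The adjacent transposition `(i i+1)`, indexed by all natural numbers: it is `1` when
`i + 1 ≥ n`, so that sets of simple reflections can be encoded by subsets of `ℕ`. -/
def swapSucc (i : ℕ) : Perm (Fin n) :=
  if h : i + 1 < n then Equiv.swap ⟨i, by omega⟩ ⟨i + 1, h⟩ else 1

theorem swapSucc_of_le (h : n ≤ i + 1) : (swapSucc i : Perm (Fin n)) = 1 :=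
  dif_neg (by omega)

theorem simpleRefl_eq_swapSucc (i : Fin (n - 1)) : simpleRefl i = swapSucc (n := n) i := by
  rw [swapSucc, dif_pos (by omega)]; rfl

theorem swapSucc_apply_val (h : i + 1 < n) (x : Fin n) :
    ((swapSucc i x : Fin n) : ℕ) =
      if (x : ℕ) = i then i + 1 else if (x : ℕ) = i + 1 then i else x := by
  rw [swapSucc, dif_pos h, Equiv.swap_apply_def]
  simp only [Fin.ext_iff]
  split_ifs <;> rfl

theorem swapSucc_apply_left (h : i + 1 < n) :
    swapSucc i (⟨i, by omega⟩ : Fin n) = ⟨i + 1, h⟩ := by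
  ext; simp [swapSucc_apply_val h]

theorem swapSucc_apply_right (h : i + 1 < n) :
    swapSucc i (⟨i + 1, h⟩ : Fin n) = ⟨i, by omega⟩ := by
  ext; simp [swapSucc_apply_val h]

theorem swapSucc_apply_of_ne (h : i + 1 < n) {x : Fin n} (hx : (x : ℕ) ≠ i)
    (hx' : (x : ℕ) ≠ i + 1) : swapSucc i x = x := by
  ext; simp [swapSucc_apply_val h, hx, hx']

theorem swapSucc_lt_swapSucc (h : i + 1 < n) {x y : Fin n} (hxy : ¬((x : ℕ) = i ∧ (y : ℕ) = i + 1))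
    (hyx : ¬((x : ℕ) = i + 1 ∧ (y : ℕ) = i)) : swapSucc i x < swapSucc i y ↔ x < y := by
  rw [Fin.lt_def, Fin.lt_def, swapSucc_apply_val h, swapSucc_apply_val h]
  split_ifs <;> omega

@[simp] theorem swapSucc_mul_self (i : ℕ) : swapSucc i * swapSucc i = (1 : Perm (Fin n)) := by
  rw [swapSucc]; split_ifs <;> simp

@[simp] theorem swapSucc_apply_swapSucc (i : ℕ) (x : Fin n) : swapSucc i (swapSucc i x) = x := by
  rw [← Equiv.Perm.mul_apply, swapSucc_mul_self, Equiv.Perm.one_apply]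

@[simp] theorem swapSucc_inv (i : ℕ) : (swapSucc i : Perm (Fin n))⁻¹ = swapSucc i :=
  inv_eq_of_mul_eq_one_left (swapSucc_mul_self i)

@[simp] theorem mul_swapSucc_mul_swapSucc (w : Perm (Fin n)) (i : ℕ) :
    w * swapSucc i * swapSucc i = w := by
  rw [mul_assoc, swapSucc_mul_self, mul_one]

@[simp] theorem swapSucc_mul_swapSucc_mul (w : Perm (Fin n)) (i : ℕ) :
    swapSucc i * (swapSucc i * w) = w := by
  rw [← mul_assoc, swapSucc_mul_self, one_mul]

theorem swapSucc_ne_one (h : i + 1 < n) : (swapSucc i : Perm (Fin n)) ≠ 1 := fun h1 => by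
  simpa [h1, Fin.ext_iff] using swapSucc_apply_left h

theorem commute_swapSucc (h : i + 2 ≤ j ∨ j + 2 ≤ i) :
    Commute (swapSucc i : Perm (Fin n)) (swapSucc j) := by
  by_cases hi : i + 1 < n
  · by_cases hj : j + 1 < n
    · ext x
      simp only [Equiv.Perm.mul_apply, swapSucc_apply_val hi, swapSucc_apply_val hj]
      split_ifs <;> omega
    · rw [swapSucc_of_le (i := j) (by omega)]
      exact Commute.one_right _
  · rw [swapSucc_of_le (i := i) (by omega)]
    exact Commute.one_left _

theorem swapSucc_braid (h : i + 2 < n) : (swapSucc i : Perm (Fin n)) * swapSucc (i + 1) * swapSucc i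
    = swapSucc (i + 1) * swapSucc i * swapSucc (i + 1) := by
  have hi : i + 1 < n := by omega
  ext x
  simp only [Equiv.Perm.mul_apply, swapSucc_apply_val hi, swapSucc_apply_val (i := i + 1) h]
  split_ifs <;> omega

/-! ### Ascents, descents and inversions -/

/-- `w` has a (right) ascent at `i`. Left ascents of `w` are ascents of `w⁻¹`. -/
def IsAscent (w : Perm (Fin n)) (i : ℕ) : Prop :=
  ∃ h : i + 1 < n, w ⟨i, by omega⟩ < w ⟨i + 1, h⟩

/-- `w` has a (right) descent at `i`. Left descents of `w` are descents of `w⁻¹`. -/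
def IsDescent (w : Perm (Fin n)) (i : ℕ) : Prop :=
  ∃ h : i + 1 < n, w ⟨i + 1, h⟩ < w ⟨i, by omega⟩

theorem IsAscent.lt (h : IsAscent w i) : i + 1 < n := h.1

theorem IsDescent.lt (h : IsDescent w i) : i + 1 < n := h.1

theorem isAscent_or_isDescent (w : Perm (Fin n)) (h : i + 1 < n) :
    IsAscent w i ∨ IsDescent w i := by
  have hne : w ⟨i, by omega⟩ ≠ w ⟨i + 1, h⟩ := w.injective.ne (by simp [Fin.ext_iff])
  exact hne.lt_or_gt.imp (⟨h, ·⟩) (⟨h, ·⟩)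

theorem isDescent_iff (h : i + 1 < n) : IsDescent w i ↔ w ⟨i + 1, h⟩ < w ⟨i, by omega⟩ :=
  exists_prop_of_true h

theorem IsAscent.not_isDescent (h : IsAscent w i) : ¬IsDescent w i :=
  fun h' => lt_asymm h.2 h'.2

theorem isAscent_mul_swapSucc : IsAscent (w * swapSucc i) i ↔ IsDescent w i := by
  refine exists_congr fun h => ?_
  rw [Equiv.Perm.mul_apply, Equiv.Perm.mul_apply, swapSucc_apply_left h, swapSucc_apply_right h]

theorem isDescent_mul_swapSucc : IsDescent (w * swapSucc i) i ↔ IsAscent w i := by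
  rw [← isAscent_mul_swapSucc, mul_swapSucc_mul_swapSucc]

theorem isAscent_inv_swapSucc_mul : IsAscent (swapSucc i * w)⁻¹ i ↔ IsDescent w⁻¹ i := by
  rw [mul_inv_rev, swapSucc_inv, isAscent_mul_swapSucc]

theorem isDescent_inv_swapSucc_mul : IsDescent (swapSucc i * w)⁻¹ i ↔ IsAscent w⁻¹ i := by
  rw [mul_inv_rev, swapSucc_inv, isDescent_mul_swapSucc]

theorem eq_one_of_isAscent (h : ∀ i, i + 1 < n → IsAscent w i) : w = 1 := by
  have hmono : StrictMono w := by
    rcases n with _ | n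
    · exact fun x => x.elim0
    · exact Fin.strictMono_iff_lt_succ.2 fun x => (h x (by omega)).2
  exact Equiv.coe_fn_injective ((hmono.range_inj strictMono_id).1 <| by
    rw [w.surjective.range_eq, Set.range_id])

theorem exists_isDescent (h : w ≠ 1) : ∃ i, IsDescent w i := by
  by_contra! hc
  exact h (eq_one_of_isAscent fun i hi => (isAscent_or_isDescent w hi).resolve_right (hc i))

/-- The pairs of positions `x < y` with `w y < w x`. -/
def inversions (w : Perm (Fin n)) : Finset (Fin n × Fin n) :=
  {p | p.1 < p.2 ∧ w p.2 < w p.1}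

theorem mem_inversions {x y : Fin n} : (x, y) ∈ inversions w ↔ x < y ∧ w y < w x := by
  simp [inversions]

theorem inversions_one : inversions (1 : Perm (Fin n)) = ∅ :=
  Finset.filter_eq_empty_iff.2 fun _ _ h => lt_asymm h.1 h.2

theorem mem_map_inversions {x y : Fin n} :
    (x, y) ∈ (inversions w).map ((swapSucc i).prodCongr (swapSucc i)).toEmbedding ↔
      swapSucc i x < swapSucc i y ∧ w (swapSucc i y) < w (swapSucc i x) := by
  rw [Finset.mem_map_equiv, ← mem_inversions, Equiv.prodCongr_symm, ← Equiv.Perm.inv_def,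
    swapSucc_inv]
  rfl

theorem inversions_mul_swapSucc {w : Perm (Fin n)} (h : i + 1 < n)
    (hlt : w ⟨i, by omega⟩ < w ⟨i + 1, h⟩) :
    inversions (w * swapSucc i) = insert (⟨i, by omega⟩, ⟨i + 1, h⟩)
      ((inversions w).map ((swapSucc i).prodCongr (swapSucc i)).toEmbedding) := by
  ext ⟨x, y⟩
  rw [Finset.mem_insert, mem_map_inversions, mem_inversions, Equiv.Perm.mul_apply,
    Equiv.Perm.mul_apply, Prod.mk.injEq]
  by_cases hxy : (x : ℕ) = i ∧ (y : ℕ) = i + 1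
  · have hx : x = ⟨i, by omega⟩ := Fin.ext hxy.1
    have hy : y = ⟨i + 1, h⟩ := Fin.ext hxy.2
    simp [hx, hy, swapSucc_apply_left h, swapSucc_apply_right h, hlt]
  · by_cases hyx : (x : ℕ) = i + 1 ∧ (y : ℕ) = i
    · have hx : x = ⟨i + 1, h⟩ := Fin.ext hyx.1
      have hy : y = ⟨i, by omega⟩ := Fin.ext hyx.2
      simp [hx, hy, swapSucc_apply_left h, swapSucc_apply_right h, hlt.le]
    · rw [swapSucc_lt_swapSucc h hxy hyx, or_iff_right]
      rintro ⟨rfl, rfl⟩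
      exact hxy ⟨rfl, rfl⟩

theorem IsAscent.card_inversions_mul_swapSucc (h : IsAscent w i) :
    (inversions (w * swapSucc i)).card = (inversions w).card + 1 := by
  obtain ⟨hi, hlt⟩ := h
  rw [inversions_mul_swapSucc hi hlt, Finset.card_insert_of_notMem, Finset.card_map]
  rw [mem_map_inversions, swapSucc_apply_left hi, swapSucc_apply_right hi]
  exact fun h => (Nat.lt_succ_self i).not_gt (Fin.lt_def.1 h.1)

theorem IsDescent.card_inversions (h : IsDescent w i) :
    (inversions w).card = (inversions (w * swapSucc i)).card + 1 := by
  simpa using (isAscent_mul_swapSucc.2 h).card_inversions_mul_swapSucc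

theorem card_inversions_mul_swapSucc_le (w : Perm (Fin n)) (i : ℕ) :
    (inversions (w * swapSucc i)).card ≤ (inversions w).card + 1 := by
  by_cases hi : i + 1 < n
  · rcases isAscent_or_isDescent w hi with h | h
    · exact h.card_inversions_mul_swapSucc.le
    · exact (Nat.le_succ _).trans (h.card_inversions.symm.le.trans (Nat.le_succ _))
  · rw [swapSucc_of_le (by omega), mul_one]
    exact Nat.le_succ _

/-! ### Words and length -/

theorem wordProd_nil : wordProd ([] : List (Fin (n - 1))) = 1 := rfl

theorem wordProd_cons (i : Fin (n - 1)) (l : List (Fin (n - 1))) :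
    wordProd (i :: l) = swapSucc i * wordProd l := by
  rw [wordProd, List.map_cons, List.prod_cons, simpleRefl_eq_swapSucc]; rfl

theorem wordProd_append (l l' : List (Fin (n - 1))) :
    wordProd (l ++ l') = wordProd l * wordProd l' := by
  rw [wordProd, List.map_append, List.prod_append]; rfl

theorem wordProd_concat (l : List (Fin (n - 1))) (i : Fin (n - 1)) :
    wordProd (l ++ [i]) = wordProd l * swapSucc i := by
  rw [wordProd_append, wordProd_cons, wordProd_nil, mul_one]

theorem wordProd_reverse (l : List (Fin (n - 1))) : wordProd l.reverse = (wordProd l)⁻¹ := by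
  induction l with
  | nil => rfl
  | cons i l ih =>
    rw [List.reverse_cons, wordProd_concat, wordProd_cons, mul_inv_rev, swapSucc_inv, ih]

theorem card_inversions_wordProd_le (l : List (Fin (n - 1))) :
    (inversions (wordProd l)).card ≤ l.length := by
  induction l using List.reverseRecOn with
  | nil => rw [wordProd_nil, inversions_one]; rfl
  | append_singleton l i ih =>
    rw [wordProd_concat, List.length_append, List.length_singleton]
    exact (card_inversions_mul_swapSucc_le _ _).trans (by omega)

theorem exists_word_length_eq_card_inversions (w : Perm (Fin n)) :
    ∃ l : List (Fin (n - 1)), wordProd l = w ∧ l.length = (inversions w).card := by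
  induction hk : (inversions w).card using Nat.strong_induction_on generalizing w with
  | _ k ih =>
    by_cases hw : w = 1
    · subst hw
      exact ⟨[], rfl, by rw [← hk, inversions_one]; rfl⟩
    · obtain ⟨i, hi⟩ := exists_isDescent hw
      have hcard := hi.card_inversions
      obtain ⟨l, hl, hlen⟩ := ih _ (by omega) (w * swapSucc i) rfl
      refine ⟨l ++ [⟨i, by have := hi.lt; omega⟩], ?_, ?_⟩
      · rw [wordProd_concat, hl, mul_swapSucc_mul_swapSucc]
      · rw [List.length_append, hlen, List.length_singleton]
        omega

theorem len_wordProd_le (l : List (Fin (n - 1))) : len (wordProd l) ≤ l.length :=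
  Nat.sInf_le ⟨l, rfl, rfl⟩

theorem len_eq_card_inversions (w : Perm (Fin n)) : len w = (inversions w).card := by
  apply le_antisymm
  · obtain ⟨l, rfl, hl⟩ := exists_word_length_eq_card_inversions w
    exact (len_wordProd_le l).trans hl.le
  · obtain ⟨l, rfl, hl⟩ := exists_reducedWord w
    exact (card_inversions_wordProd_le l).trans hl.le

theorem len_one : len (1 : Perm (Fin n)) = 0 := by
  rw [len_eq_card_inversions, inversions_one, Finset.card_empty]

theorem eq_one_of_len_eq_zero (h : len w = 0) : w = 1 := by
  obtain ⟨l, rfl, hl⟩ := exists_reducedWord w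
  rw [List.eq_nil_of_length_eq_zero (hl.trans h), wordProd_nil]

theorem len_inv_le (w : Perm (Fin n)) : len w⁻¹ ≤ len w := by
  obtain ⟨l, rfl, hl⟩ := exists_reducedWord w
  rw [← wordProd_reverse, ← hl, ← List.length_reverse]
  exact len_wordProd_le _

theorem len_inv (w : Perm (Fin n)) : len w⁻¹ = len w :=
  (len_inv_le w).antisymm (by simpa using len_inv_le w⁻¹)

theorem IsAscent.len_mul_swapSucc (h : IsAscent w i) : len (w * swapSucc i) = len w + 1 := by
  simp only [len_eq_card_inversions, h.card_inversions_mul_swapSucc]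

theorem IsDescent.len_eq (h : IsDescent w i) : len w = len (w * swapSucc i) + 1 := by
  simpa using (isAscent_mul_swapSucc.2 h).len_mul_swapSucc

theorem IsAscent.len_swapSucc_mul (h : IsAscent w⁻¹ i) : len (swapSucc i * w) = len w + 1 := by
  rw [← len_inv, mul_inv_rev, swapSucc_inv, h.len_mul_swapSucc, len_inv]

theorem IsDescent.len_eq_left (h : IsDescent w⁻¹ i) : len w = len (swapSucc i * w) + 1 := by
  simpa using (isAscent_inv_swapSucc_mul.2 h).len_swapSucc_mul

theorem isAscent_iff_len_lt (hi : i + 1 < n) : IsAscent w i ↔ len w < len (w * swapSucc i) := by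
  refine ⟨fun h => by rw [h.len_mul_swapSucc]; omega, fun h => ?_⟩
  refine (isAscent_or_isDescent w hi).resolve_right fun hd => ?_
  have := hd.len_eq
  omega

theorem isAscent_inv_iff_len_lt (hi : i + 1 < n) :
    IsAscent w⁻¹ i ↔ len w < len (swapSucc i * w) := by
  rw [isAscent_iff_len_lt hi, len_inv, ← len_inv (swapSucc i * w), mul_inv_rev, swapSucc_inv]

/-! ### Matsumoto's theorem -/

/-- `f` satisfies the commutation and braid relations of the simple reflections. -/
structure IsBraided {M : Type*} [Monoid M] (f : Fin (n - 1) → M) : Prop where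
  commute : ∀ i j : Fin (n - 1), (i : ℕ) + 2 ≤ j → Commute (f i) (f j)
  braid : ∀ i j : Fin (n - 1), (j : ℕ) = i + 1 → f i * f j * f i = f j * f i * f j

/-- `l` is a reduced word for `w`. -/
def IsReducedWord (w : Perm (Fin n)) (l : List (Fin (n - 1))) : Prop :=
  wordProd l = w ∧ l.length = len w

theorem IsReducedWord.of_cons {i : Fin (n - 1)} {l : List (Fin (n - 1))}
    (h : IsReducedWord w (i :: l)) : IsDescent w⁻¹ i ∧ IsReducedWord (swapSucc i * w) l := by
  obtain ⟨rfl, hlen⟩ := h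
  rw [wordProd_cons, List.length_cons] at hlen
  have hle := len_wordProd_le l
  have hasc : IsAscent (wordProd l)⁻¹ i := (isAscent_inv_iff_len_lt (by omega)).2 (by omega)
  have hsucc := hasc.len_swapSucc_mul
  rw [wordProd_cons, isDescent_inv_swapSucc_mul, swapSucc_mul_swapSucc_mul]
  exact ⟨hasc, rfl, by omega⟩

theorem IsReducedWord.cons {i : Fin (n - 1)} {l : List (Fin (n - 1))}
    (h : IsReducedWord (swapSucc i * w) l) (hi : IsDescent w⁻¹ i) : IsReducedWord w (i :: l) := by
  refine ⟨?_, ?_⟩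
  · rw [wordProd_cons, h.1, swapSucc_mul_swapSucc_mul]
  · rw [List.length_cons, h.2, hi.len_eq_left]

theorem isDescent_inv_swapSucc_mul_iff (hi : i + 1 < n) (hj : j + 1 < n)
    (h : i + 2 ≤ j ∨ j + 2 ≤ i) (w : Perm (Fin n)) :
    IsDescent (swapSucc j * w)⁻¹ i ↔ IsDescent w⁻¹ i := by
  have hleft : swapSucc j (⟨i, by omega⟩ : Fin n) = ⟨i, by omega⟩ :=
    swapSucc_apply_of_ne hj (by simp; omega) (by simp; omega)
  have hright : swapSucc j (⟨i + 1, hi⟩ : Fin n) = ⟨i + 1, hi⟩ :=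
    swapSucc_apply_of_ne hj (by simp; omega) (by simp; omega)
  simp only [IsDescent, mul_inv_rev, swapSucc_inv, Equiv.Perm.mul_apply, hleft, hright]

theorem swapSucc_succ_apply (h : i + 2 < n) :
    swapSucc (i + 1) (⟨i, by omega⟩ : Fin n) = ⟨i, by omega⟩ :=
  swapSucc_apply_of_ne h (by simp) (by simp; omega)

theorem swapSucc_apply_add_two (h : i + 2 < n) :
    swapSucc i (⟨i + 1 + 1, h⟩ : Fin n) = ⟨i + 1 + 1, h⟩ :=
  swapSucc_apply_of_ne (by omega) (by simp; omega) (by simp)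

theorem exists_isReducedWord_of_isDescent_commute {i j : Fin (n - 1)} (hij : (i : ℕ) + 2 ≤ j)
    (hi : IsDescent w⁻¹ i) (hj : IsDescent w⁻¹ j) :
    ∃ l, IsReducedWord w (i :: j :: l) ∧ IsReducedWord w (j :: i :: l) := by
  obtain ⟨l, hl⟩ := exists_reducedWord (swapSucc j * (swapSucc i * w))
  have hij' : IsReducedWord w (i :: j :: l) := IsReducedWord.cons
    (IsReducedWord.cons hl ((isDescent_inv_swapSucc_mul_iff hj.lt hi.lt (.inr hij) w).2 hj)) hi
  refine ⟨l, hij', ?_, hij'.2⟩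
  rw [← hij'.1]
  simp only [wordProd_cons, ← mul_assoc, (commute_swapSucc (.inl hij)).eq]

theorem exists_isReducedWord_of_isDescent_braid {i j : Fin (n - 1)} (hij : (j : ℕ) = i + 1)
    (hi : IsDescent w⁻¹ i) (hj : IsDescent w⁻¹ j) :
    ∃ l, IsReducedWord w (i :: j :: i :: l) ∧ IsReducedWord w (j :: i :: j :: l) := by
  have hn : (i : ℕ) + 2 < n := by omega
  obtain ⟨l, hl⟩ := exists_reducedWord (swapSucc i * (swapSucc j * (swapSucc i * w)))
  rw [hij] at hj
  have hj' : IsDescent (swapSucc i * w)⁻¹ j := by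
    rw [hij, isDescent_iff hn, mul_inv_rev, swapSucc_inv, Equiv.Perm.mul_apply,
      Equiv.Perm.mul_apply, swapSucc_apply_right hi.lt, swapSucc_apply_add_two hn]
    exact hj.2.trans hi.2
  have hi' : IsDescent (swapSucc j * (swapSucc i * w))⁻¹ i := by
    simp only [hij, isDescent_iff hi.lt, mul_inv_rev, swapSucc_inv, Equiv.Perm.mul_apply]
    rw [swapSucc_succ_apply hn, swapSucc_apply_left hi.lt, swapSucc_apply_left hj.lt,
      swapSucc_apply_add_two hn]
    exact hj.2
  have hiji : IsReducedWord w (i :: j :: i :: l) :=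
    IsReducedWord.cons (IsReducedWord.cons (IsReducedWord.cons hl hi') hj') hi
  refine ⟨l, hiji, ?_, hiji.2⟩
  rw [← hiji.1]
  simp only [wordProd_cons, ← mul_assoc, hij, swapSucc_braid hn]

section Matsumoto

variable {M : Type*} [Monoid M] {f : Fin (n - 1) → M}

theorem IsBraided.exists_isReducedWord_cons (hf : IsBraided f) {i j : Fin (n - 1)}
    (hij : i < j) (hi : IsDescent w⁻¹ i) (hj : IsDescent w⁻¹ j) :
    ∃ l l', IsReducedWord w (i :: l) ∧ IsReducedWord w (j :: l') ∧
      ((i :: l).map f).prod = ((j :: l').map f).prod := by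
  rcases (Nat.succ_le_of_lt hij).eq_or_lt with h | h
  · obtain ⟨l, hl, hl'⟩ := exists_isReducedWord_of_isDescent_braid h.symm hi hj
    refine ⟨_, _, hl, hl', ?_⟩
    simp only [List.map_cons, List.prod_cons, ← mul_assoc, hf.braid i j h.symm]
  · obtain ⟨l, hl, hl'⟩ := exists_isReducedWord_of_isDescent_commute h hi hj
    refine ⟨_, _, hl, hl', ?_⟩
    simp only [List.map_cons, List.prod_cons, ← mul_assoc, (hf.commute i j h).eq]

theorem IsBraided.prod_map_eq (hf : IsBraided f) {l l' : List (Fin (n - 1))}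
    (hl : IsReducedWord w l) (hl' : IsReducedWord w l') : (l.map f).prod = (l'.map f).prod := by
  induction hk : len w generalizing w l l' with
  | zero =>
    rw [List.eq_nil_of_length_eq_zero (hl.2.trans hk),
      List.eq_nil_of_length_eq_zero (hl'.2.trans hk)]
  | succ k ih =>
    have head_eq : ∀ {i m m'}, IsReducedWord w (i :: m) → IsReducedWord w (i :: m') →
        ((i :: m).map f).prod = ((i :: m').map f).prod := fun hm hm' => by
      have hlen := hm.of_cons.1.len_eq_left
      rw [List.map_cons, List.map_cons, List.prod_cons, List.prod_cons,
        ih hm.of_cons.2 hm'.of_cons.2 (by omega)]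
    have head_lt : ∀ {i j m m'}, i < j → IsReducedWord w (i :: m) → IsReducedWord w (j :: m') →
        ((i :: m).map f).prod = ((j :: m').map f).prod := fun hij hm hm' => by
      obtain ⟨_, _, hx, hy, hxy⟩ := hf.exists_isReducedWord_cons hij hm.of_cons.1 hm'.of_cons.1
      exact (head_eq hm hx).trans (hxy.trans (head_eq hy hm'))
    obtain ⟨i, m, rfl⟩ := List.exists_cons_of_length_eq_add_one (hl.2.trans hk)
    obtain ⟨j, m', rfl⟩ := List.exists_cons_of_length_eq_add_one (hl'.2.trans hk)
    rcases lt_trichotomy i j with hij | rfl | hij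
    · exact head_lt hij hl hl'
    · exact head_eq hl hl'
    · exact (head_lt hij hl' hl).symm

end Matsumoto

/-! ### Generators and relations -/

/-- The generator `T_{s_i}`, indexed by all natural numbers: it is `1` when `i + 1 ≥ n`. -/
noncomputable def Ts (i : ℕ) : Hecke n :=
  if h : i + 1 < n then gen ⟨i, by omega⟩ else 1

theorem gen_eq_Ts (i : Fin (n - 1)) : gen i = Ts (n := n) i := by
  rw [Ts, dif_pos (by omega)]

theorem Ts_of_le (h : n ≤ i + 1) : (Ts i : Hecke n) = 1 :=
  dif_neg (by omega)

theorem isBraided_gen (n : ℕ) : IsBraided (gen (n := n)) where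
  commute i j h := by
    rw [Commute, SemiconjBy, gen, gen, ← map_mul, ← map_mul]
    exact RingQuot.mkAlgHom_rel _ (HeckeRel.comm _ _ (.inl h))
  braid i j h := by
    simp only [gen, ← map_mul]
    exact RingQuot.mkAlgHom_rel _ (HeckeRel.braid _ _ h)

theorem commute_Ts (h : i + 2 ≤ j ∨ j + 2 ≤ i) : Commute (Ts i : Hecke n) (Ts j) := by
  by_cases hi : i + 1 < n
  · by_cases hj : j + 1 < n
    · rw [Ts, dif_pos hi, Ts, dif_pos hj]
      exact h.elim (fun h => (isBraided_gen n).commute _ _ h) fun h =>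
        ((isBraided_gen n).commute _ _ h).symm
    · rw [Ts_of_le (i := j) (by omega)]
      exact Commute.one_right _
  · rw [Ts_of_le (i := i) (by omega)]
    exact Commute.one_left _

theorem Ts_braid (h : i + 2 < n) :
    (Ts i : Hecke n) * Ts (i + 1) * Ts i = Ts (i + 1) * Ts i * Ts (i + 1) := by
  rw [Ts, dif_pos (by omega), Ts, dif_pos (by omega)]
  exact (isBraided_gen n).braid _ _ rfl

theorem Ts_mul_self (h : i + 1 < n) : (Ts i : Hecke n) * Ts i = 1 + (X : ℤ[X]) • Ts i := by
  rw [Ts, dif_pos h, gen, ← map_mul, RingQuot.mkAlgHom_rel _ (HeckeRel.quad _), map_add, map_one,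
    map_smul]

/-- The homomorphism from the Hecke algebra defined by images `f i` of the generators that satisfy
the defining relations. -/
noncomputable def heckeLift {A : Type*} [Semiring A] [Algebra ℤ[X] A] (f : Fin (n - 1) → A)
    (hf : IsBraided f) (hquad : ∀ i, f i * f i = 1 + (X : ℤ[X]) • f i) : Hecke n →ₐ[ℤ[X]] A :=
  RingQuot.liftAlgHom ℤ[X] ⟨FreeAlgebra.lift ℤ[X] f, fun _ _ h => by
    cases h with
    | comm i j h =>
      simpa using h.elim (fun h => (hf.commute i j h).eq) fun h => (hf.commute j i h).symm.eq
    | braid i j h => simpa using hf.braid i j h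
    | quad i => simpa using hquad i⟩

theorem heckeLift_Ts {A : Type*} [Semiring A] [Algebra ℤ[X] A] {f : Fin (n - 1) → A}
    (hf : IsBraided f) (hquad : ∀ i, f i * f i = 1 + (X : ℤ[X]) • f i) (h : i + 1 < n) :
    heckeLift f hf hquad (Ts i) = f ⟨i, by omega⟩ := by
  rw [Ts, dif_pos h, gen, heckeLift, RingQuot.liftAlgHom_mkAlgHom_apply, FreeAlgebra.lift_ι_apply]

theorem adjoin_range_gen (n : ℕ) : Algebra.adjoin ℤ[X] (Set.range (gen (n := n))) = ⊤ := by
  have h := congrArg (Subalgebra.map (RingQuot.mkAlgHom ℤ[X] (HeckeRel n)))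
    (FreeAlgebra.adjoin_range_ι ℤ[X] (Fin (n - 1)))
  rwa [AlgHom.map_adjoin, ← Set.range_comp, Algebra.map_top,
    (AlgHom.range_eq_top _).2 (RingQuot.mkAlgHom_surjective _ _)] at h

theorem IsReducedWord.T_eq {l : List (Fin (n - 1))} (h : IsReducedWord w l) :
    T w = (l.map gen).prod :=
  (isBraided_gen n).prod_map_eq (exists_reducedWord w).choose_spec h

theorem T_mul (h : len (u * v) = len u + len v) : T (u * v) = T u * T v := by
  obtain ⟨l, hl⟩ := exists_reducedWord u
  obtain ⟨m, hm⟩ := exists_reducedWord v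
  have hlm : IsReducedWord (u * v) (l ++ m) :=
    ⟨by rw [wordProd_append, hl.1, hm.1], by rw [List.length_append, hl.2, hm.2, h]⟩
  rw [hlm.T_eq, IsReducedWord.T_eq hl, IsReducedWord.T_eq hm, List.map_append, List.prod_append]

theorem T_one : T (1 : Perm (Fin n)) = 1 :=
  IsReducedWord.T_eq (l := []) ⟨rfl, len_one.symm⟩

theorem len_swapSucc (h : i + 1 < n) : len (swapSucc i : Perm (Fin n)) = 1 := by
  have hasc : IsAscent (1 : Perm (Fin n)) i := ⟨h, by simp [Fin.lt_def]⟩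
  simpa [len_one] using hasc.len_mul_swapSucc

theorem T_swapSucc (i : ℕ) : T (swapSucc i : Perm (Fin n)) = Ts i := by
  by_cases h : i + 1 < n
  · have hred : IsReducedWord (swapSucc i : Perm (Fin n)) [⟨i, by omega⟩] :=
      ⟨by rw [wordProd_cons, wordProd_nil, mul_one], (len_swapSucc h).symm⟩
    rw [hred.T_eq, List.map_singleton, List.prod_singleton, gen_eq_Ts]
  · rw [swapSucc_of_le (by omega), Ts_of_le (by omega), T_one]

theorem IsAscent.T_swapSucc_mul (h : IsAscent w⁻¹ i) : T (swapSucc i * w) = Ts i * T w := by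
  rw [T_mul (by rw [h.len_swapSucc_mul, len_swapSucc h.lt, add_comm]), T_swapSucc]

theorem IsAscent.T_mul_swapSucc (h : IsAscent w i) : T (w * swapSucc i) = T w * Ts i := by
  rw [T_mul (by rw [h.len_mul_swapSucc, len_swapSucc h.lt]), T_swapSucc]

theorem IsDescent.T_eq_left (h : IsDescent w⁻¹ i) : T w = Ts i * T (swapSucc i * w) := by
  rw [← (isAscent_inv_swapSucc_mul.2 h).T_swapSucc_mul, swapSucc_mul_swapSucc_mul]

theorem IsDescent.T_eq (h : IsDescent w i) : T w = T (w * swapSucc i) * Ts i := by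
  rw [← (isAscent_mul_swapSucc.2 h).T_mul_swapSucc, mul_swapSucc_mul_swapSucc]

theorem IsDescent.Ts_mul_T (h : IsDescent w⁻¹ i) :
    Ts i * T w = T (swapSucc i * w) + (X : ℤ[X]) • T w := by
  rw [h.T_eq_left, ← mul_assoc, Ts_mul_self h.lt, add_mul, one_mul, smul_mul_assoc]

theorem IsDescent.T_mul_Ts (h : IsDescent w i) :
    T w * Ts i = T (w * swapSucc i) + (X : ℤ[X]) • T w := by
  rw [h.T_eq, mul_assoc, Ts_mul_self h.lt, mul_add, mul_one, mul_smul_comm]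

theorem mul_swapSucc_induction {P : Perm (Fin n) → Prop} (one : P 1)
    (mul_swapSucc : ∀ w i, IsAscent w i → P w → P (w * swapSucc i)) (w : Perm (Fin n)) : P w := by
  induction hk : len w generalizing w with
  | zero => exact eq_one_of_len_eq_zero hk ▸ one
  | succ k ih =>
    obtain ⟨i, hi⟩ := exists_isDescent (w := w) fun h => by simp [h, len_one] at hk
    have hlen := hi.len_eq
    have := mul_swapSucc _ i (isAscent_mul_swapSucc.2 hi) (ih _ (by omega))
    rwa [mul_swapSucc_mul_swapSucc] at this

/-! ### The ring structure -/

theorem hecke_neg_add_cancel (a : Hecke n) : -a + a = 0 :=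
  @neg_add_cancel (Hecke n) (RingQuot.instRing (HeckeRel n)).toAddCommGroup.toAddGroup a

theorem hecke_sub_eq_add_neg (a b : Hecke n) : a - b = a + -b :=
  @sub_eq_add_neg (Hecke n)
    (RingQuot.instRing (HeckeRel n)).toAddCommGroup.toAddGroup.toSubNegMonoid a b

/-- The ring structure of the Hecke algebra, on top of the semiring structure found by instance
search. -/
@[reducible] noncomputable def heckeRing (n : ℕ) : Ring (Hecke n) :=
  { (inferInstance : Semiring (Hecke n)) with
    neg := fun a => -a
    sub := fun a b => a - b
    sub_eq_add_neg := hecke_sub_eq_add_neg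
    neg_add_cancel := hecke_neg_add_cancel
    zsmul := zsmulRec
    intCast := Int.castDef }

attribute [local instance] heckeRing

/-! ### The regular representation and the standard basis -/

open Classical in
/-- The operator of left multiplication by `T_{s_i}` on the free module on the permutations. -/
noncomputable def regOp (i : ℕ) : Module.End ℤ[X] (Perm (Fin n) →₀ ℤ[X]) :=
  Finsupp.linearCombination ℤ[X] fun w => Finsupp.single (swapSucc i * w) 1 +
    if IsDescent w⁻¹ i then (X : ℤ[X]) • Finsupp.single w 1 else 0

open Classical in
theorem regOp_single (i : ℕ) (w : Perm (Fin n)) :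
    regOp i (Finsupp.single w 1) = Finsupp.single (swapSucc i * w) 1 +
      if IsDescent w⁻¹ i then (X : ℤ[X]) • Finsupp.single w 1 else 0 := by
  rw [regOp, Finsupp.linearCombination_single, one_smul]

theorem IsAscent.regOp_single (h : IsAscent w⁻¹ i) :
    regOp i (Finsupp.single w 1) = Finsupp.single (swapSucc i * w) 1 := by
  rw [HeckeNorm.regOp_single, if_neg h.not_isDescent, add_zero]

theorem IsDescent.regOp_single (h : IsDescent w⁻¹ i) :
    regOp i (Finsupp.single w 1) =
      Finsupp.single (swapSucc i * w) 1 + (X : ℤ[X]) • Finsupp.single w 1 := by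
  rw [HeckeNorm.regOp_single, if_pos h]

theorem regOp_mul_self (h : i + 1 < n) :
    (regOp i : Module.End ℤ[X] (Perm (Fin n) →₀ ℤ[X])) * regOp i = 1 + (X : ℤ[X]) • regOp i := by
  refine Finsupp.lhom_ext' fun w => LinearMap.ext_ring ?_
  simp only [LinearMap.comp_apply, Finsupp.lsingle_apply, Module.End.mul_apply,
    LinearMap.add_apply, LinearMap.smul_apply, Module.End.one_apply]
  rcases isAscent_or_isDescent w⁻¹ h with hw | hw
  · rw [hw.regOp_single, (isDescent_inv_swapSucc_mul.2 hw).regOp_single, swapSucc_mul_swapSucc_mul]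
  · rw [hw.regOp_single, map_add, map_smul, (isAscent_inv_swapSucc_mul.2 hw).regOp_single,
      swapSucc_mul_swapSucc_mul, hw.regOp_single]

theorem commute_regOp (hi : i + 1 < n) (hj : j + 1 < n) (h : i + 2 ≤ j ∨ j + 2 ≤ i) :
    Commute (regOp i : Module.End ℤ[X] (Perm (Fin n) →₀ ℤ[X])) (regOp j) := by
  refine Finsupp.lhom_ext' fun w => LinearMap.ext_ring ?_
  have hcomm : swapSucc i * (swapSucc j * w) = swapSucc j * (swapSucc i * w) :=
    (commute_swapSucc h).left_comm w
  simp only [LinearMap.comp_apply, Finsupp.lsingle_apply, Module.End.mul_apply]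
  by_cases hwi : IsDescent w⁻¹ i <;> by_cases hwj : IsDescent w⁻¹ j <;>
    simp only [regOp_single, map_add, map_smul, smul_add, isDescent_inv_swapSucc_mul_iff hi hj h,
      isDescent_inv_swapSucc_mul_iff hj hi h.symm, hcomm, hwi, hwj, if_true, if_false, add_zero]
  abel

theorem regOp_braid (h : i + 2 < n) :
    (regOp i : Module.End ℤ[X] (Perm (Fin n) →₀ ℤ[X])) * regOp (i + 1) * regOp i =
      regOp (i + 1) * regOp i * regOp (i + 1) := by
  refine Finsupp.lhom_ext' fun w => LinearMap.ext_ring ?_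
  have hi : i + 1 < n := by omega
  have hbraid : swapSucc (i + 1) * (swapSucc i * (swapSucc (i + 1) * w)) =
      swapSucc i * (swapSucc (i + 1) * (swapSucc i * w)) := by
    simp only [← mul_assoc, swapSucc_braid h]
  have hab : w⁻¹ ⟨i, by omega⟩ ≠ w⁻¹ ⟨i + 1, hi⟩ := w⁻¹.injective.ne (by simp)
  have hbc : w⁻¹ ⟨i + 1, hi⟩ ≠ w⁻¹ ⟨i + 1 + 1, h⟩ := w⁻¹.injective.ne (by simp)
  have hac : w⁻¹ ⟨i, by omega⟩ ≠ w⁻¹ ⟨i + 1 + 1, h⟩ := w⁻¹.injective.ne (by simp; omega)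
  simp only [LinearMap.comp_apply, Finsupp.lsingle_apply, Module.End.mul_apply]
  -- the six possible orders of the three values of `w⁻¹`, the other two being contradictory
  rcases hab.lt_or_gt with hab | hab <;> rcases hbc.lt_or_gt with hbc | hbc <;>
    rcases hac.lt_or_gt with hac | hac <;>
    first
    | exact absurd (hab.trans hbc) hac.not_gt
    | exact absurd (hbc.trans hab) hac.not_gt
    | (simp only [regOp_single, map_add, map_smul, smul_add, isDescent_iff hi, isDescent_iff h,
        mul_inv_rev, swapSucc_inv, Equiv.Perm.mul_apply, swapSucc_apply_left hi,
        swapSucc_apply_right hi, swapSucc_apply_left h, swapSucc_apply_right h,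
        swapSucc_apply_add_two h, swapSucc_succ_apply h, hab, hbc, hac, hab.not_gt, hbc.not_gt,
        hac.not_gt, if_true, if_false, add_zero, hbraid, swapSucc_mul_swapSucc_mul]
       try abel)

theorem isBraided_regOp (n : ℕ) : IsBraided fun i : Fin (n - 1) => regOp (n := n) i where
  commute i j h := commute_regOp (by omega) (by omega) (.inl h)
  braid i j h := by simpa only [h] using regOp_braid (n := n) (i := i) (by omega)

/-- The left regular representation of the Hecke algebra, in the coordinates of the `T_w`. -/
noncomputable def regRep (n : ℕ) :
    Hecke n →ₐ[ℤ[X]] Module.End ℤ[X] (Perm (Fin n) →₀ ℤ[X]) :=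
  heckeLift (fun i => regOp i) (isBraided_regOp n) fun i => regOp_mul_self (by omega)

theorem regRep_T (w : Perm (Fin n)) : regRep n (T w) (Finsupp.single 1 1) = Finsupp.single w 1 := by
  induction hk : len w generalizing w with
  | zero => rw [eq_one_of_len_eq_zero hk, T_one, map_one, Module.End.one_apply]
  | succ k ih =>
    obtain ⟨i, hi⟩ := exists_isDescent (w := w⁻¹) fun h => by
      simp [inv_eq_one.1 h, len_one] at hk
    have hlen := hi.len_eq_left
    rw [hi.T_eq_left, map_mul, Module.End.mul_apply, ih _ (by omega), regRep,
      heckeLift_Ts _ _ hi.lt, (isAscent_inv_swapSucc_mul.2 hi).regOp_single,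
      swapSucc_mul_swapSucc_mul]

theorem linearIndependent_T (n : ℕ) : LinearIndependent ℤ[X] (T (n := n)) := by
  refine LinearIndependent.of_comp
    ((LinearMap.applyₗ (Finsupp.single 1 1)).comp (regRep n).toLinearMap) ?_
  convert Finsupp.linearIndependent_single_one ℤ[X] (Perm (Fin n)) with w
  exact regRep_T w

theorem Ts_mul_T_mem_span (i : ℕ) (w : Perm (Fin n)) :
    Ts i * T w ∈ Submodule.span ℤ[X] {T w, T (swapSucc i * w)} := by
  by_cases hi : i + 1 < n
  · rcases isAscent_or_isDescent w⁻¹ hi with h | h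
    · rw [← h.T_swapSucc_mul]
      exact Submodule.subset_span (by simp)
    · rw [h.Ts_mul_T]
      exact add_mem (Submodule.subset_span (by simp))
        (Submodule.smul_mem _ _ (Submodule.subset_span (by simp)))
  · rw [Ts_of_le (by omega), one_mul]
    exact Submodule.subset_span (by simp)

theorem T_mul_Ts_mem_span (i : ℕ) (w : Perm (Fin n)) :
    T w * Ts i ∈ Submodule.span ℤ[X] {T w, T (w * swapSucc i)} := by
  by_cases hi : i + 1 < n
  · rcases isAscent_or_isDescent w hi with h | h
    · rw [← h.T_mul_swapSucc]
      exact Submodule.subset_span (by simp)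
    · rw [h.T_mul_Ts]
      exact add_mem (Submodule.subset_span (by simp))
        (Submodule.smul_mem _ _ (Submodule.subset_span (by simp)))
  · rw [Ts_of_le (by omega), mul_one]
    exact Submodule.subset_span (by simp)

theorem gen_mul_mem_span (i : Fin (n - 1)) {x : Hecke n}
    (hx : x ∈ Submodule.span ℤ[X] (Set.range (T (n := n)))) :
    gen i * x ∈ Submodule.span ℤ[X] (Set.range (T (n := n))) := by
  induction hx using Submodule.span_induction with
  | mem x hx =>
    obtain ⟨w, rfl⟩ := hx
    rw [gen_eq_Ts]
    refine Submodule.span_mono ?_ (Ts_mul_T_mem_span i w)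
    rintro _ (rfl | rfl) <;> exact ⟨_, rfl⟩
  | zero => rw [mul_zero]; exact zero_mem _
  | add x y _ _ hx hy => rw [mul_add]; exact add_mem hx hy
  | smul r x _ hx => rw [mul_smul_comm]; exact Submodule.smul_mem _ _ hx

theorem span_range_T (n : ℕ) : Submodule.span ℤ[X] (Set.range (T (n := n))) = ⊤ := by
  rw [eq_top_iff]
  rintro a -
  suffices h : ∀ x ∈ Submodule.span ℤ[X] (Set.range (T (n := n))),
      a * x ∈ Submodule.span ℤ[X] (Set.range (T (n := n))) by
    simpa using h 1 (Submodule.subset_span ⟨1, T_one⟩)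
  have ha : a ∈ Algebra.adjoin ℤ[X] (Set.range (gen (n := n))) := by
    rw [adjoin_range_gen]; exact Algebra.mem_top
  induction ha using Algebra.adjoin_induction with
  | mem a ha =>
    obtain ⟨i, rfl⟩ := ha
    exact fun x hx => gen_mul_mem_span i hx
  | algebraMap r =>
    exact fun x hx => by rw [← Algebra.smul_def]; exact Submodule.smul_mem _ _ hx
  | mul a b _ _ ha hb => exact fun x hx => by rw [mul_assoc]; exact ha _ (hb _ hx)
  | add a b _ _ ha hb => exact fun x hx => by rw [add_mul]; exact add_mem (ha _ hx) (hb _ hx)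

/-- The basis of the Hecke algebra formed by the `T_w`. -/
noncomputable def stdBasis (n : ℕ) : Module.Basis (Perm (Fin n)) ℤ[X] (Hecke n) :=
  Module.Basis.mk (linearIndependent_T n) (span_range_T n).ge

@[simp] theorem stdBasis_apply (w : Perm (Fin n)) : stdBasis n w = T w :=
  Module.Basis.mk_apply _ _ _

/-- The coefficient of `T_w`. -/
noncomputable def coeffT (w : Perm (Fin n)) : Hecke n →ₗ[ℤ[X]] ℤ[X] := (stdBasis n).coord w

theorem sum_coeffT (a : Hecke n) : ∑ w, coeffT w a • T w = a := by
  simpa [coeffT] using (stdBasis n).sum_repr a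

theorem coeffT_T (v w : Perm (Fin n)) : coeffT v (T w) = if w = v then 1 else 0 := by
  classical
  rw [coeffT, ← stdBasis_apply, Module.Basis.coord_apply, Module.Basis.repr_self,
    Finsupp.single_apply]

theorem coeffT_sum (f : Perm (Fin n) → ℤ[X]) (v : Perm (Fin n)) :
    coeffT v (∑ w, f w • T w) = f v := by
  simp [map_sum, coeffT_T]

theorem ext_coeffT {b : Hecke n} (h : ∀ w, coeffT w a = coeffT w b) : a = b := by
  rw [← sum_coeffT a, ← sum_coeffT b]
  simp only [h]

theorem linearMap_ext_T {M : Type*} [AddCommGroup M] [Module ℤ[X] M] {f f' : Hecke n →ₗ[ℤ[X]] M}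
    (h : ∀ w, f (T w) = f' (T w)) : f = f' :=
  (stdBasis n).ext fun w => by simpa using h w

/-! ### The symmetrizing trace -/

theorem coeffT_one_T_mul_T (u v : Perm (Fin n)) :
    coeffT 1 (T u * T v) = if u * v = 1 then 1 else 0 := by
  induction u using mul_swapSucc_induction generalizing v with
  | one => simp [T_one, coeffT_T]
  | mul_swapSucc u i hi ih =>
    rw [hi.T_mul_swapSucc, mul_assoc, mul_assoc]
    rcases isAscent_or_isDescent v⁻¹ hi.lt with h | h
    · rw [← h.T_swapSucc_mul, ih]
    · rw [h.Ts_mul_T, mul_add, mul_smul_comm, map_add, map_smul, ih, ih]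
      have : u * v ≠ 1 := by
        intro e
        rw [← eq_inv_iff_mul_eq_one] at e
        exact hi.not_isDescent (e ▸ h)
      simp [this]

theorem coeffT_one_mul_comm (a b : Hecke n) : coeffT 1 (a * b) = coeffT 1 (b * a) := by
  have key : ∀ u v : Perm (Fin n), coeffT 1 (T u * T v) = coeffT 1 (T v * T u) := by
    intro u v
    rw [coeffT_one_T_mul_T, coeffT_one_T_mul_T]
    simp only [mul_eq_one_iff_eq_inv, eq_comm (a := u), inv_eq_iff_eq_inv]
  have e : (LinearMap.mul ℤ[X] (Hecke n)).compr₂ (coeffT 1) =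
      (LinearMap.mul ℤ[X] (Hecke n)).flip.compr₂ (coeffT 1) :=
    linearMap_ext_T fun u => linearMap_ext_T fun v => by simpa using key u v
  simpa using LinearMap.congr_fun (LinearMap.congr_fun e a) b

theorem coeffT_eq_coeffT_one (w : Perm (Fin n)) (a : Hecke n) :
    coeffT w a = coeffT 1 (a * T w⁻¹) := by
  rw [← sum_coeffT a]
  simp [Finset.sum_mul, map_sum, coeffT_one_T_mul_T, coeffT_T, mul_inv_eq_one]

/-! ### Positivity -/

/-- The subsemiring `ℕ[ξ]` of `ℤ[ξ]`. -/
def polyNonneg : Subsemiring ℤ[X] where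
  carrier := {p | PolyPos p}
  zero_mem' _ := by simp
  one_mem' i := by rw [coeff_one]; split_ifs <;> simp
  add_mem' hp hq i := by rw [coeff_add]; exact add_nonneg (hp i) (hq i)
  mul_mem' hp hq i := by
    rw [coeff_mul]
    exact Finset.sum_nonneg fun x _ => mul_nonneg (hp _) (hq _)

theorem X_mem_polyNonneg : (X : ℤ[X]) ∈ polyNonneg := fun i => by
  rw [coeff_X]; split_ifs <;> simp

theorem coeffT_T_mul_T_mem_polyNonneg (u v w : Perm (Fin n)) :
    coeffT w (T u * T v) ∈ polyNonneg := by
  induction u using mul_swapSucc_induction generalizing v with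
  | one =>
    rw [T_one, one_mul, coeffT_T]
    split_ifs
    exacts [one_mem _, zero_mem _]
  | mul_swapSucc u i hi ih =>
    rw [hi.T_mul_swapSucc, mul_assoc]
    rcases isAscent_or_isDescent v⁻¹ hi.lt with h | h
    · rw [← h.T_swapSucc_mul]
      exact ih _
    · rw [h.Ts_mul_T, mul_add, mul_smul_comm, map_add, map_smul]
      exact add_mem (ih _) (mul_mem X_mem_polyNonneg (ih _))

/-- The positive cone `H⁺` as a subsemiring, described by the coefficients of its elements. -/
noncomputable def posSubsemiring (n : ℕ) : Subsemiring (Hecke n) where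
  carrier := {h | ∀ w, coeffT w h ∈ polyNonneg}
  zero_mem' w := by rw [map_zero]; exact zero_mem _
  one_mem' w := by
    rw [← T_one, coeffT_T]
    split_ifs
    exacts [one_mem _, zero_mem _]
  add_mem' ha hb w := by rw [map_add]; exact add_mem (ha w) (hb w)
  mul_mem' {a b} ha hb w := by
    rw [← sum_coeffT a, ← sum_coeffT b]
    simp only [Finset.sum_mul, Finset.mul_sum, map_sum, smul_mul_assoc, mul_smul_comm, map_smul]
    exact sum_mem fun u _ => mul_mem (hb _) (sum_mem fun v _ =>
      mul_mem (ha _) (coeffT_T_mul_T_mem_polyNonneg _ _ _))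

theorem mem_posCone_iff {h : Hecke n} : h ∈ posCone n ↔ h ∈ posSubsemiring n := by
  constructor
  · rintro ⟨f, hf, rfl⟩ w
    rw [coeffT_sum]
    exact hf w
  · intro hh
    exact ⟨fun w => coeffT w h, hh, (sum_coeffT h).symm⟩

theorem smul_mem_posSubsemiring {p : ℤ[X]} (hp : p ∈ polyNonneg)
    (ha : a ∈ posSubsemiring n) : p • a ∈ posSubsemiring n := fun w => by
  rw [map_smul]
  exact mul_mem hp (ha w)

theorem T_mem_posSubsemiring (w : Perm (Fin n)) : T w ∈ posSubsemiring n := fun v => by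
  rw [coeffT_T]
  split_ifs
  exacts [one_mem _, zero_mem _]

theorem Ts_mem_posSubsemiring (i : ℕ) : (Ts i : Hecke n) ∈ posSubsemiring n := by
  by_cases h : i + 1 < n
  · rw [← T_swapSucc _]
    exact T_mem_posSubsemiring _
  · rw [Ts, dif_neg h]
    exact one_mem _

/-! ### Specialization at `ξ = 0` -/

theorem eval_coeffT_T_mul_T (u v w : Perm (Fin n)) :
    (coeffT w (T u * T v)).eval 0 = if u * v = w then 1 else 0 := by
  induction u using mul_swapSucc_induction generalizing v with
  | one => rw [T_one, one_mul, one_mul, coeffT_T]; split_ifs <;> simp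
  | mul_swapSucc u i hi ih =>
    rw [hi.T_mul_swapSucc, mul_assoc, mul_assoc]
    rcases isAscent_or_isDescent v⁻¹ hi.lt with h | h
    · rw [← h.T_swapSucc_mul, ih]
    · rw [h.Ts_mul_T, mul_add, mul_smul_comm, map_add, map_smul, eval_add, smul_eq_mul,
        eval_mul, eval_X, zero_mul, add_zero, ih]

theorem eval_coeffT_mul_T (u : Perm (Fin n)) (a : Hecke n) (w : Perm (Fin n)) :
    (coeffT w (a * T u)).eval 0 = (coeffT (w * u⁻¹) a).eval 0 := by
  conv_lhs => rw [← sum_coeffT a]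
  simp [Finset.sum_mul, eval_finsetSum, eval_coeffT_T_mul_T, ← eq_mul_inv_iff_mul_eq]

theorem eval_coeffT_T_mul (u : Perm (Fin n)) (a : Hecke n) (w : Perm (Fin n)) :
    (coeffT w (T u * a)).eval 0 = (coeffT (u⁻¹ * w) a).eval 0 := by
  conv_lhs => rw [← sum_coeffT a]
  simp [Finset.mul_sum, eval_finsetSum, eval_coeffT_T_mul_T, ← eq_inv_mul_iff_mul_eq]

/-! ### Parabolic subgroups -/

/-- The parabolic subgroup `W_J` generated by the `s_i` with `i ∈ J`. Indices `i` with
`n ≤ i + 1` are allowed in `J` and contribute nothing. -/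
def stdParabolic (J : Set ℕ) : Subgroup (Perm (Fin n)) :=
  Subgroup.closure {s | ∃ i ∈ J, s = swapSucc i}

theorem swapSucc_mem_stdParabolic (h : i ∈ J) : (swapSucc i : Perm (Fin n)) ∈ stdParabolic J :=
  Subgroup.subset_closure ⟨i, h, rfl⟩

theorem stdParabolic_mono (h : J ⊆ K) :
    (stdParabolic J : Subgroup (Perm (Fin n))) ≤ stdParabolic K :=
  Subgroup.closure_mono fun _ ⟨i, hi, e⟩ => ⟨i, h hi, e⟩

theorem stdParabolic_empty : (stdParabolic ∅ : Subgroup (Perm (Fin n))) = ⊥ := by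
  simp [stdParabolic]

theorem swapSucc_le_iff (h : m ≠ i) (x : Fin n) : ((swapSucc i x : Fin n) : ℕ) ≤ m ↔
    (x : ℕ) ≤ m := by
  by_cases hi : i + 1 < n
  · rw [swapSucc_apply_val hi]
    split_ifs <;> omega
  · simp [swapSucc, hi]

theorem le_iff_of_mem_stdParabolic (hw : w ∈ stdParabolic J)
    (hm : m ∉ J) (x : Fin n) : ((w x : Fin n) : ℕ) ≤ m ↔ (x : ℕ) ≤ m := by
  induction hw using Subgroup.closure_induction generalizing x with
  | mem w hw =>
    obtain ⟨i, hi, rfl⟩ := hw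
    exact swapSucc_le_iff (fun e => hm (by rwa [e])) x
  | one => rfl
  | mul u v _ _ hu hv => rw [Equiv.Perm.mul_apply, hu, hv]
  | inv u _ hu => rw [← hu, ← Equiv.Perm.mul_apply, mul_inv_cancel, Equiv.Perm.one_apply]

theorem mem_of_isDescent (hw : w ∈ stdParabolic J)
    (hi : IsDescent w i) : i ∈ J := by
  by_contra h
  have h1 := (le_iff_of_mem_stdParabolic hw h ⟨i, by have := hi.lt; omega⟩).2 le_rfl
  have h2 := mt (le_iff_of_mem_stdParabolic hw h ⟨i + 1, hi.lt⟩).1 (by simp)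
  have := hi.2
  rw [Fin.lt_def] at this
  omega

theorem apply_eq_of_mem_stdParabolic (hw : w ∈ stdParabolic J) {x : Fin n} (hx : (x : ℕ) ∉ J)
    (hpred : ∀ j ∈ J, j + 1 ≠ x) : w x = x := by
  have hle := le_iff_of_mem_stdParabolic hw hx x
  apply Fin.ext
  rcases hx0 : (x : ℕ) with _ | y
  · omega
  · have := le_iff_of_mem_stdParabolic hw (fun hy => hpred y hy hx0.symm) x
    omega

theorem mem_stdParabolic_of_le_iff
    (h : ∀ m, m ∉ J → ∀ x : Fin n, ((w x : Fin n) : ℕ) ≤ m ↔ (x : ℕ) ≤ m) : w ∈ stdParabolic J := by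
  induction w using mul_swapSucc_induction with
  | one => exact one_mem _
  | mul_swapSucc w i hi ih =>
    have hiJ : i ∈ J := by
      by_contra hJ
      have hd : IsDescent (w * swapSucc i) i := isDescent_mul_swapSucc.2 hi
      have h1 := (h i hJ ⟨i, by have := hd.lt; omega⟩).2 le_rfl
      have h2 := mt (h i hJ ⟨i + 1, hd.lt⟩).1 (by simp)
      have := hd.2
      rw [Fin.lt_def] at this
      omega
    refine mul_mem (ih fun m hm x => ?_) (swapSucc_mem_stdParabolic hiJ)
    have hne : m ≠ i := fun e => hm (e ▸ hiJ)
    have := h m hm (swapSucc i x)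
    rwa [Equiv.Perm.mul_apply, swapSucc_apply_swapSucc, swapSucc_le_iff hne] at this

theorem stdParabolic_univ : (stdParabolic Set.univ : Subgroup (Perm (Fin n))) = ⊤ :=
  eq_top_iff.2 fun _ _ => mem_stdParabolic_of_le_iff fun _ hm => absurd (Set.mem_univ _) hm

theorem stdParabolic_induction_right
    {P : ∀ w : Perm (Fin n), w ∈ stdParabolic J → Prop} (one : P 1 (one_mem _))
    (mul_swapSucc : ∀ w i (hw : w ∈ stdParabolic J) (hi : i ∈ J), IsAscent w i → P w hw →
      P (w * swapSucc i) (mul_mem hw (swapSucc_mem_stdParabolic hi)))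
    (hw : w ∈ stdParabolic J) : P w hw := by
  induction w using mul_swapSucc_induction with
  | one => exact one
  | mul_swapSucc w i hi ih =>
    have hiJ := mem_of_isDescent hw (isDescent_mul_swapSucc.2 hi)
    have hwJ : w ∈ stdParabolic J := by simpa using mul_mem hw (swapSucc_mem_stdParabolic hiJ)
    exact mul_swapSucc w i hwJ hiJ hi (ih hwJ)

theorem stdParabolic_induction_left
    {P : ∀ w : Perm (Fin n), w ∈ stdParabolic J → Prop} (one : P 1 (one_mem _))
    (swapSucc_mul : ∀ w i (hw : w ∈ stdParabolic J) (hi : i ∈ J), IsAscent w⁻¹ i → P w hw →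
      P (swapSucc i * w) (mul_mem (swapSucc_mem_stdParabolic hi) hw))
    (hw : w ∈ stdParabolic J) : P w hw := by
  suffices ∀ v (hv : v ∈ stdParabolic J), P v⁻¹ (inv_mem hv) by simpa using this _ (inv_mem hw)
  intro v hv
  induction hv using stdParabolic_induction_right with
  | one => simpa using one
  | mul_swapSucc v i hv hi ha ih =>
    simpa using swapSucc_mul v⁻¹ i (inv_mem hv) hi (by simpa using ha) ih

/-! ### Distinguished coset representatives -/

theorem apply_lt_of_not_isDescent (h : ∀ j ∈ J, ¬ IsDescent v j)
    {x y : Fin n} (hxy : x < y) (hJ : ∀ k, (x : ℕ) ≤ k → k < y → k ∈ J) : v x < v y := by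
  obtain ⟨x, hx⟩ := x
  obtain ⟨y, hy⟩ := y
  obtain ⟨k, rfl⟩ := Nat.exists_eq_add_of_lt (show x < y from hxy)
  clear hxy
  have hasc : ∀ c, x ≤ c → c < x + k + 1 → IsAscent v c := fun c h1 h2 =>
    (isAscent_or_isDescent v (by omega)).resolve_right (h c (hJ c h1 h2))
  clear hJ
  induction k with
  | zero => exact (hasc x le_rfl (by omega)).2
  | succ k ih =>
    exact (ih (by omega) fun c h1 h2 => hasc c h1 (by omega)).trans
      (hasc (x + k + 1) (by omega) (by omega)).2

/-- The element `d` has no left descent in `J`; equivalently (`isDistinguished_iff`) it has minimal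
length in its coset `W_J d`. -/
def IsLeftMinimal (J : Set ℕ) (d : Perm (Fin n)) : Prop :=
  ∀ j ∈ J, ¬ IsDescent d⁻¹ j

theorem IsLeftMinimal.isAscent_inv_mul (hd : IsLeftMinimal J d) (hu : u ∈ stdParabolic J)
    (hj : j ∈ J) (h : IsAscent u⁻¹ j) : IsAscent (u * d)⁻¹ j := by
  refine ⟨h.lt, ?_⟩
  rw [mul_inv_rev, Equiv.Perm.mul_apply, Equiv.Perm.mul_apply]
  refine apply_lt_of_not_isDescent hd h.2 fun k h1 h2 => ?_
  by_contra hk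
  have e1 := le_iff_of_mem_stdParabolic (inv_mem hu) hk ⟨j, by have := h.lt; omega⟩
  have e2 := le_iff_of_mem_stdParabolic (inv_mem hu) hk ⟨j + 1, h.lt⟩
  have : k ≠ j := fun e => hk (e ▸ hj)
  simp only at e1 e2
  omega

theorem IsLeftMinimal.isDescent_inv_mul_iff (hd : IsLeftMinimal J d) (hu : u ∈ stdParabolic J)
    (hj : j ∈ J) : IsDescent (u * d)⁻¹ j ↔ IsDescent u⁻¹ j := by
  constructor <;> intro h
  · by_contra hn
    exact (hd.isAscent_inv_mul hu hj
      ((isAscent_or_isDescent _ h.lt).resolve_right hn)).not_isDescent h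
  · have := hd.isAscent_inv_mul (mul_mem (swapSucc_mem_stdParabolic hj) hu) hj
      (isAscent_inv_swapSucc_mul.2 h)
    rwa [mul_assoc, isAscent_inv_swapSucc_mul] at this

theorem IsLeftMinimal.len_mul (hd : IsLeftMinimal J d) (hu : u ∈ stdParabolic J) :
    len (u * d) = len u + len d := by
  induction hu using stdParabolic_induction_left with
  | one => rw [one_mul, len_one, zero_add]
  | swapSucc_mul u i hu hi ha ih =>
    rw [mul_assoc, (hd.isAscent_inv_mul hu hi ha).len_swapSucc_mul, ha.len_swapSucc_mul, ih]
    omega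

theorem isDistinguished_iff :
    IsDistinguished (stdParabolic K) (stdParabolic J) d ↔
      d ∈ stdParabolic K ∧ IsLeftMinimal J d := by
  refine and_congr_right fun _ => ⟨fun h j hj hd => ?_, fun h u hu => ?_⟩
  · have := h (swapSucc j) (swapSucc_mem_stdParabolic hj)
    have := hd.len_eq_left
    omega
  · rw [h.len_mul hu]
    omega

theorem exists_eq_mul_isLeftMinimal (J : Set ℕ) (w : Perm (Fin n)) :
    ∃ u ∈ stdParabolic J, ∃ d, IsLeftMinimal J d ∧ w = u * d := by
  induction hk : len w using Nat.strong_induction_on generalizing w with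
  | _ k ih =>
    by_cases h : ∃ j ∈ J, IsDescent w⁻¹ j
    · obtain ⟨j, hj, hjw⟩ := h
      obtain ⟨u, hu, d, hd, e⟩ :=
        ih _ (by have := hjw.len_eq_left; omega) (swapSucc j * w) rfl
      exact ⟨swapSucc j * u, mul_mem (swapSucc_mem_stdParabolic hj) hu, d, hd,
        by rw [mul_assoc, ← e, swapSucc_mul_swapSucc_mul]⟩
    · push Not at h
      exact ⟨1, one_mem _, w, h, (one_mul w).symm⟩

theorem IsLeftMinimal.eq_and_eq {u' d' : Perm (Fin n)} (hd : IsLeftMinimal J d)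
    (hd' : IsLeftMinimal J d') (hu : u ∈ stdParabolic J) (hu' : u' ∈ stdParabolic J)
    (h : u * d = u' * d') : u = u' ∧ d = d' := by
  have e : (u'⁻¹ * u) * d = d' := by rw [mul_assoc, h, inv_mul_cancel_left]
  have e' : (u⁻¹ * u') * d' = d := by rw [mul_assoc, ← h, inv_mul_cancel_left]
  have hlen := hd.len_mul (mul_mem (inv_mem hu') hu)
  have hlen' := hd'.len_mul (mul_mem (inv_mem hu) hu')
  rw [e] at hlen
  rw [e'] at hlen'
  have hone := eq_one_of_len_eq_zero (w := u⁻¹ * u') (by omega)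
  rw [hone, one_mul] at e'
  exact ⟨inv_mul_eq_one.1 hone, e'.symm⟩

theorem IsLeftMinimal.T_mul (hd : IsLeftMinimal J d) (hu : u ∈ stdParabolic J) :
    T (u * d) = T u * T d :=
  HeckeNorm.T_mul (hd.len_mul hu)

theorem IsLeftMinimal.T_inv_mul (hd : IsLeftMinimal J d) (hu : u ∈ stdParabolic J) :
    T (u * d)⁻¹ = T d⁻¹ * T u⁻¹ := by
  rw [mul_inv_rev, HeckeNorm.T_mul]
  rw [← mul_inv_rev, len_inv, len_inv, len_inv, hd.len_mul hu, add_comm]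
/-! ### Relative norms -/

theorem relNorm_sub (K U : Subgroup (Perm (Fin n))) (a b : Hecke n) :
    relNorm K U (a - b) = relNorm K U a - relNorm K U b := by
  simp [relNorm, mul_sub, sub_mul, Finset.sum_sub_distrib]

theorem relNorm_smul (K U : Subgroup (Perm (Fin n))) (p : ℤ[X]) (a : Hecke n) :
    relNorm K U (p • a) = p • relNorm K U a := by
  simp [relNorm, Finset.smul_sum]

theorem relNorm_mem_posSubsemiring (K U : Subgroup (Perm (Fin n)))
    (ha : a ∈ posSubsemiring n) : relNorm K U a ∈ posSubsemiring n :=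
  sum_mem fun _ _ => mul_mem (mul_mem (T_mem_posSubsemiring _) ha) (T_mem_posSubsemiring _)

theorem relNorm_mul_right {K : Subgroup (Perm (Fin n))} (U : Subgroup (Perm (Fin n)))
    (a : Hecke n) (hz : ∀ d ∈ K, Commute z (T d)) :
    relNorm K U (a * z) = relNorm K U a * z := by
  classical
  rw [relNorm, relNorm, Finset.sum_mul]
  refine Finset.sum_congr rfl fun d hd => ?_
  have := (hz d (Finset.mem_filter.1 hd).2.1).eq
  simp only [mul_assoc, this]

theorem relNorm_mul_left {K : Subgroup (Perm (Fin n))} (U : Subgroup (Perm (Fin n)))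
    (a : Hecke n) (hz : ∀ d ∈ K, Commute z (T d)) :
    relNorm K U (z * a) = z * relNorm K U a := by
  classical
  rw [relNorm, relNorm, Finset.mul_sum]
  refine Finset.sum_congr rfl fun d hd => ?_
  have := (hz d⁻¹ (inv_mem (Finset.mem_filter.1 hd).2.1)).eq
  simp only [← mul_assoc, this]

theorem relNorm_relNorm {L : Set ℕ} (hJK : J ⊆ K) (hKL : K ⊆ L) (a : Hecke n) :
    relNorm (stdParabolic L) (stdParabolic K) (relNorm (stdParabolic K) (stdParabolic J) a) =
      relNorm (stdParabolic L) (stdParabolic J) a := by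
  classical
  simp only [relNorm, isDistinguished_iff, Finset.mul_sum, Finset.sum_mul]
  rw [Finset.sum_sigma']
  refine Finset.sum_bij (fun p _ => p.2 * p.1) ?_ ?_ ?_ ?_
  · rintro ⟨d, e⟩ h
    simp only [Finset.mem_sigma, Finset.mem_filter, Finset.mem_univ, true_and] at h ⊢
    obtain ⟨⟨hd, hdK⟩, he, heJ⟩ := h
    refine ⟨mul_mem (stdParabolic_mono hKL he) hd, fun j hj => ?_⟩
    rw [hdK.isDescent_inv_mul_iff he (hJK hj)]
    exact heJ j hj
  · rintro ⟨d, e⟩ h ⟨d', e'⟩ h' heq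
    simp only [Finset.mem_sigma, Finset.mem_filter, Finset.mem_univ, true_and] at h h'
    obtain ⟨rfl, rfl⟩ := h.1.2.eq_and_eq h'.1.2 h.2.1 h'.2.1 heq
    rfl
  · intro w hw
    simp only [Finset.mem_filter, Finset.mem_univ, true_and] at hw
    obtain ⟨e, he, d, hd, rfl⟩ := exists_eq_mul_isLeftMinimal K w
    refine ⟨⟨d, e⟩, ?_, rfl⟩
    simp only [Finset.mem_sigma, Finset.mem_filter, Finset.mem_univ, true_and]
    refine ⟨⟨?_, hd⟩, he, fun j hj => ?_⟩
    · simpa using mul_mem (inv_mem (stdParabolic_mono hKL he)) hw.1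
    · rw [← hd.isDescent_inv_mul_iff he (hJK hj)]
      exact hw.2 j hj
  · rintro ⟨d, e⟩ h
    simp only [Finset.mem_sigma, Finset.mem_filter, Finset.mem_univ, true_and] at h
    rw [h.1.2.T_mul h.2.1, h.1.2.T_inv_mul h.2.1]
    simp only [mul_assoc]

theorem IsAscent.commute_Ts_add (hd : IsAscent d k) (z : Hecke n) :
    Commute (Ts k) (T d⁻¹ * z * T d + T (d * swapSucc k)⁻¹ * z * T (d * swapSucc k)) := by
  have hinv : T (d * swapSucc k)⁻¹ = Ts k * T d⁻¹ := by
    have : IsAscent d⁻¹⁻¹ k := by rwa [inv_inv]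
    rw [mul_inv_rev, swapSucc_inv, this.T_swapSucc_mul]
  have hquad (a : Hecke n) : Ts k * (Ts k * a) = a + (X : ℤ[X]) • (Ts k * a) := by
    rw [← mul_assoc, Ts_mul_self hd.lt, add_mul, one_mul, smul_mul_assoc]
  rw [commute_iff_eq, hd.T_mul_swapSucc, hinv]
  simp only [mul_add, add_mul, mul_assoc, hquad, Ts_mul_self hd.lt, mul_one, mul_smul_comm]
  abel

theorem IsLeftMinimal.exists_mul_swapSucc_eq (hd : IsLeftMinimal J d)
    (h : ¬ IsLeftMinimal J (d * swapSucc k)) :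
    ∃ j ∈ J, IsAscent d k ∧ IsAscent d⁻¹ j ∧ d * swapSucc k = swapSucc j * d := by
  have hkn : k + 1 < n := by
    by_contra hkn
    exact h (by rwa [swapSucc_of_le (by omega), mul_one])
  simp only [IsLeftMinimal, not_forall, not_not] at h
  obtain ⟨j, hj, hdj⟩ := h
  have hjn := hdj.lt
  have ha : IsAscent d⁻¹ j := (isAscent_or_isDescent _ hjn).resolve_right (hd j hj)
  have hlt := hdj.2
  rw [mul_inv_rev, swapSucc_inv, Equiv.Perm.mul_apply, Equiv.Perm.mul_apply] at hlt
  -- right multiplication by `s_k` can only exchange the values `k` and `k + 1` of `d⁻¹`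
  obtain ⟨hk, hk'⟩ : ((d⁻¹ ⟨j, by omega⟩ : Fin n) : ℕ) = k ∧
      ((d⁻¹ ⟨j + 1, hjn⟩ : Fin n) : ℕ) = k + 1 := by
    by_contra hne
    have hlt' := ha.2
    refine lt_asymm hlt ((swapSucc_lt_swapSucc hkn hne fun h => ?_).2 hlt')
    rw [Fin.lt_def] at hlt'
    omega
  have hlo : d ⟨k, by omega⟩ = ⟨j, by omega⟩ := by
    rw [← Equiv.Perm.eq_inv_iff_eq]
    exact Fin.ext hk.symm
  have hhi : d ⟨k + 1, hkn⟩ = ⟨j + 1, hjn⟩ := by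
    rw [← Equiv.Perm.eq_inv_iff_eq]
    exact Fin.ext hk'.symm
  refine ⟨j, hj, ⟨hkn, by rw [hlo, hhi]; simp [Fin.lt_def]⟩, ha, ?_⟩
  have : d * swapSucc k * d⁻¹ = swapSucc j := by
    rw [swapSucc, dif_pos hkn, swapSucc, dif_pos hjn, ← Equiv.swap_apply_apply, hlo, hhi]
  rw [← this, inv_mul_cancel_right]

theorem IsLeftMinimal.commute_Ts_of_not (hd : IsLeftMinimal J d)
    (h : ¬ IsLeftMinimal J (d * swapSucc k)) (hz : ∀ j ∈ J, Commute (Ts j) z) :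
    Commute (Ts k) (T d⁻¹ * z * T d) := by
  obtain ⟨j, hj, hk, hj', e⟩ := hd.exists_mul_swapSucc_eq h
  have hright : T d * Ts k = Ts j * T d := by rw [← hk.T_mul_swapSucc, e, hj'.T_swapSucc_mul]
  have hleft : Ts k * T d⁻¹ = T d⁻¹ * Ts j := by
    have hk' : IsAscent d⁻¹⁻¹ k := by rwa [inv_inv]
    have e' : swapSucc k * d⁻¹ = d⁻¹ * swapSucc j := by simpa using congrArg (·⁻¹) e
    rw [← hk'.T_swapSucc_mul, e', hj'.T_mul_swapSucc]
  calc Ts k * (T d⁻¹ * z * T d) = T d⁻¹ * (Ts j * z) * T d := by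
        rw [← mul_assoc, ← mul_assoc, hleft]; simp only [mul_assoc]
    _ = T d⁻¹ * z * T d * Ts k := by
        rw [(hz j hj).eq, mul_assoc (T d⁻¹ * z), hright]; simp only [mul_assoc]

/-- Right multiplication by `s_k` pairs off the distinguished representatives `d`, except those
with `d s_k = s_j d` for some `j ∈ J`, whose terms commute with `T_{s_k}` individually. -/
theorem commute_Ts_relNorm (hz : ∀ j ∈ J, Commute (Ts j) z) (hk : k ∈ K) :
    Commute (Ts k) (relNorm (stdParabolic K) (stdParabolic J) z) := by
  classical
  by_cases hkn : k + 1 < n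
  swap
  · rw [Ts_of_le (by omega)]
    exact Commute.one_left _
  have hmem (d : Perm (Fin n)) : d * swapSucc k ∈ stdParabolic K ↔ d ∈ stdParabolic K :=
    Subgroup.mul_mem_cancel_right _ (swapSucc_mem_stdParabolic hk)
  rw [commute_iff_eq, ← sub_eq_zero, relNorm, Finset.mul_sum, Finset.sum_mul,
    ← Finset.sum_sub_distrib]
  simp only [isDistinguished_iff]
  refine Finset.sum_involution
    (fun d _ => if IsLeftMinimal J (d * swapSucc k) then d * swapSucc k else d) ?_ ?_ ?_ ?_ <;>
    simp only [Finset.mem_filter, Finset.mem_univ, true_and] <;> rintro d ⟨hdK, hd⟩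
  · split_ifs with h
    · rw [sub_add_sub_comm, ← mul_add, ← add_mul, sub_eq_zero]
      rcases isAscent_or_isDescent d hkn with hdk | hdk
      · exact hdk.commute_Ts_add z
      · have := (isAscent_mul_swapSucc.2 hdk).commute_Ts_add z
        rwa [mul_swapSucc_mul_swapSucc, add_comm] at this
    · rw [sub_eq_zero.2 (hd.commute_Ts_of_not h hz), add_zero]
  · split_ifs with h
    · exact fun _ e => swapSucc_ne_one hkn (mul_eq_left.1 e)
    · exact fun hne => absurd (sub_eq_zero.2 (hd.commute_Ts_of_not h hz)) hne
  · split_ifs with h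
    exacts [⟨(hmem d).2 hdK, h⟩, ⟨hdK, hd⟩]
  · by_cases h : IsLeftMinimal J (d * swapSucc k) <;> simp [h, hd]

/-! ### Parabolic subalgebras -/

theorem coeffT_T_mul_T_of_notMem (hu : u ∈ stdParabolic J)
    (hv : v ∈ stdParabolic J) (hw : w ∉ stdParabolic J) : coeffT w (T u * T v) = 0 := by
  induction hu using stdParabolic_induction_right generalizing v with
  | one =>
    rw [T_one, one_mul, coeffT_T, if_neg]
    rintro rfl
    exact hw hv
  | mul_swapSucc u i _ hi ha ih =>
    have hiv := mul_mem (swapSucc_mem_stdParabolic hi) hv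
    rw [ha.T_mul_swapSucc, mul_assoc]
    rcases isAscent_or_isDescent v⁻¹ ha.lt with h | h
    · rw [← h.T_swapSucc_mul]
      exact ih hiv
    · rw [h.Ts_mul_T, mul_add, mul_smul_comm, map_add, map_smul, ih hv, ih hiv, smul_zero,
        add_zero]

/-- The parabolic subalgebra spanned by the `T_w` with `w ∈ W_J`, described by the vanishing of the
other coefficients. -/
noncomputable def parabolicAlg (J : Set ℕ) : Subalgebra ℤ[X] (Hecke n) where
  carrier := {h | ∀ w, w ∉ stdParabolic J → coeffT w h = 0}
  algebraMap_mem' r w hw := by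
    rw [Algebra.algebraMap_eq_smul_one, map_smul, ← T_one, coeffT_T, if_neg, smul_zero]
    rintro rfl
    exact hw (one_mem _)
  add_mem' ha hb w hw := by rw [map_add, ha w hw, hb w hw, add_zero]
  mul_mem' {a b} ha hb w hw := by
    rw [← sum_coeffT a, ← sum_coeffT b]
    simp only [Finset.sum_mul, Finset.mul_sum, map_sum, smul_mul_assoc, mul_smul_comm, map_smul]
    refine Finset.sum_eq_zero fun u _ => ?_
    by_cases hu : u ∈ stdParabolic J
    · refine smul_eq_zero_of_right _ (Finset.sum_eq_zero fun v _ => ?_)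
      by_cases hv : v ∈ stdParabolic J
      · rw [coeffT_T_mul_T_of_notMem hv hu hw, smul_zero]
      · rw [ha v hv, zero_smul]
    · rw [hb u hu, zero_smul]

theorem T_mem_parabolicAlg (hw : w ∈ stdParabolic J) : T w ∈ parabolicAlg J := fun v hv => by
  rw [coeffT_T, if_neg]
  rintro rfl
  exact hv hw

theorem Ts_mem_parabolicAlg (hi : i ∈ J) : (Ts i : Hecke n) ∈ parabolicAlg J := by
  rw [← T_swapSucc]
  exact T_mem_parabolicAlg (swapSucc_mem_stdParabolic hi)

theorem parabolicAlg_mono (h : J ⊆ K) :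
    (parabolicAlg J : Subalgebra ℤ[X] (Hecke n)) ≤ parabolicAlg K :=
  fun _ ha w hw => ha w fun hJ => hw (stdParabolic_mono h hJ)

theorem relNorm_mem_parabolicAlg (ha : a ∈ parabolicAlg K) :
    relNorm (stdParabolic K) (stdParabolic J) a ∈ parabolicAlg K := by
  classical
  refine sum_mem fun d hd => ?_
  have := (Finset.mem_filter.1 hd).2.1
  exact mul_mem (mul_mem (T_mem_parabolicAlg (inv_mem this)) ha) (T_mem_parabolicAlg this)

theorem parabolicAlg_le_adjoin (J : Set ℕ) :
    (parabolicAlg J : Subalgebra ℤ[X] (Hecke n)) ≤ Algebra.adjoin ℤ[X] (Ts '' J) := by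
  intro a ha
  rw [← sum_coeffT a]
  refine sum_mem fun w hw => ?_
  clear hw
  by_cases hw : w ∈ stdParabolic J
  · refine Subalgebra.smul_mem _ ?_ _
    induction hw using stdParabolic_induction_right with
    | one => rw [T_one]; exact one_mem _
    | mul_swapSucc u i hu hi h ih =>
      rw [h.T_mul_swapSucc]
      exact mul_mem ih (Algebra.subset_adjoin ⟨i, hi, rfl⟩)
  · rw [ha w hw, zero_smul]
    exact zero_mem _

theorem commute_of_mem_parabolicAlg (hz : ∀ j ∈ J, Commute (Ts j) z)
    (ha : a ∈ parabolicAlg J) : Commute a z := by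
  replace ha := parabolicAlg_le_adjoin J ha
  induction ha using Algebra.adjoin_induction with
  | mem a ha =>
    obtain ⟨j, hj, rfl⟩ := ha
    exact hz j hj
  | algebraMap r => exact Algebra.commute_algebraMap_left r z
  | add a b _ _ ha hb => exact ha.add_left hb
  | mul a b _ _ ha hb => exact ha.mul_left hb

theorem commute_T_of_mem_stdParabolic (hz : ∀ j ∈ J, Commute (Ts j) z)
    (hw : w ∈ stdParabolic J) : Commute (T w) z :=
  commute_of_mem_parabolicAlg hz (T_mem_parabolicAlg hw)
/-! ### Coxeter elements -/

open Classical in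
/-- The increasing product of the `s_i` with `i ∈ J` and `i < m`. -/
noncomputable def coxeterProd (J : Set ℕ) : ℕ → Perm (Fin n)
  | 0 => 1
  | m + 1 => if m ∈ J then coxeterProd J m * swapSucc m else coxeterProd J m

theorem coxeterProd_succ_of_mem (h : m ∈ J) :
    (coxeterProd J (m + 1) : Perm (Fin n)) = coxeterProd J m * swapSucc m := by
  rw [coxeterProd, if_pos h]

theorem coxeterProd_succ_of_notMem (h : m ∉ J) :
    (coxeterProd J (m + 1) : Perm (Fin n)) = coxeterProd J m := by
  rw [coxeterProd, if_neg h]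

theorem coxeterProd_mem_stdParabolic (J : Set ℕ) (m : ℕ) :
    (coxeterProd J m : Perm (Fin n)) ∈ stdParabolic (J ∩ {i | i < m}) := by
  induction m with
  | zero => exact one_mem _
  | succ m ih =>
    have hmono : J ∩ {i | i < m} ⊆ J ∩ {i | i < m + 1} := fun i hi =>
      ⟨hi.1, Nat.lt_succ_of_lt hi.2⟩
    by_cases h : m ∈ J
    · rw [coxeterProd_succ_of_mem h]
      exact mul_mem (stdParabolic_mono hmono ih) (swapSucc_mem_stdParabolic ⟨h, Nat.lt_succ_self m⟩)
    · rw [coxeterProd_succ_of_notMem h]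
      exact stdParabolic_mono hmono ih

theorem isAscent_of_mem_stdParabolic (hw : w ∈ stdParabolic J)
    (hm : m ∉ J) (hmn : m + 1 < n) : IsAscent w m :=
  (isAscent_or_isDescent w hmn).resolve_right fun h => hm (mem_of_isDescent hw h)

theorem T_coxeterProd_succ (h : m ∈ J) :
    T (coxeterProd J (m + 1) : Perm (Fin n)) = T (coxeterProd J m) * Ts m := by
  rw [coxeterProd_succ_of_mem h]
  by_cases hm : m + 1 < n
  · exact (isAscent_of_mem_stdParabolic (coxeterProd_mem_stdParabolic J m)
      (fun h => lt_irrefl m h.2) hm).T_mul_swapSucc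
  · simp [Ts, swapSucc, hm]

/-! ### Jucys–Murphy elements of parabolic subalgebras -/

open Classical in
/-- The Jucys–Murphy element of `H_J` attached to `m ∈ J`: the sum of the `T_t`, where `t` runs
through the transpositions `(i, m + 1)` with `i ≤ m` that lie in `W_J`. -/
noncomputable def jucysMurphy (J : Set ℕ) : ℕ → Hecke n
  | 0 => Ts 0
  | m + 1 => if m ∈ J then Ts (m + 1) * jucysMurphy J m * Ts (m + 1) + Ts (m + 1) else Ts (m + 1)

theorem jucysMurphy_succ_of_mem (h : m ∈ J) :
    (jucysMurphy J (m + 1) : Hecke n) = Ts (m + 1) * jucysMurphy J m * Ts (m + 1) + Ts (m + 1) := by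
  rw [jucysMurphy, if_pos h]

theorem jucysMurphy_succ_of_notMem (h : m ∉ J) :
    (jucysMurphy J (m + 1) : Hecke n) = Ts (m + 1) := by
  rw [jucysMurphy, if_neg h]

theorem jucysMurphy_mem_parabolicAlg (h : m ∈ J) :
    (jucysMurphy J m : Hecke n) ∈ parabolicAlg (J ∩ {i | i < m + 1}) := by
  induction m with
  | zero => exact Ts_mem_parabolicAlg ⟨h, by simp⟩
  | succ m ih =>
    have hg : (Ts (m + 1) : Hecke n) ∈ parabolicAlg (J ∩ {i | i < m + 1 + 1}) :=
      Ts_mem_parabolicAlg ⟨h, by simp⟩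
    by_cases hm : m ∈ J
    · rw [jucysMurphy_succ_of_mem hm]
      have hmono : J ∩ {i | i < m + 1} ⊆ J ∩ {i | i < m + 1 + 1} := fun i hi =>
        ⟨hi.1, Nat.lt_succ_of_lt hi.2⟩
      exact add_mem (mul_mem (mul_mem hg (parabolicAlg_mono hmono (ih hm))) hg) hg
    · rwa [jucysMurphy_succ_of_notMem hm]

theorem commute_Ts_of_mem_parabolicAlg (hJ : ∀ j ∈ J, j + 2 ≤ m) (ha : a ∈ parabolicAlg J) :
    Commute (Ts m) a :=
  (commute_of_mem_parabolicAlg (fun j hj => commute_Ts (Or.inl (hJ j hj))) ha).symm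

section QuadraticBraid

variable {R A : Type*} [CommSemiring R] [Semiring A] [Algebra R A] {q : R} {s t L : A}

theorem commute_mul_mul_add_of_braid (hbraid : s * t * s = t * s * t)
    (hquad : s * s = 1 + q • s) : Commute s (t * s * t + t) := by
  rw [commute_iff_eq, ← hbraid, mul_add, add_mul, ← mul_assoc, ← mul_assoc, hquad,
    mul_assoc _ s s, hquad]
  simp only [add_mul, mul_add, one_mul, mul_one, smul_mul_assoc, mul_smul_comm]
  abel

theorem commute_mul_mul_mul_mul_of_braid (hbraid : s * t * s = t * s * t) (hL : Commute t L) :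
    Commute s (t * (s * L * s) * t) :=
  calc s * (t * (s * L * s) * t) = s * t * s * L * s * t := by simp only [mul_assoc]
    _ = t * s * (t * L) * s * t := by rw [hbraid]; simp only [mul_assoc]
    _ = t * s * L * (t * s * t) := by rw [hL.eq]; simp only [mul_assoc]
    _ = t * (s * L * s) * t * s := by rw [← hbraid]; simp only [mul_assoc]

theorem commute_mul_mul_mul_add_of_quadratic (hquad : s * s = 1 + q • s)
    (hL : Commute L (s * L * s + s)) : Commute s (L * (s * L * s + s)) := by
  have hleft : s * (s * L * s + s) = L * s + 1 + q • (s * L * s + s) := by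
    rw [mul_add, hquad, ← mul_assoc, ← mul_assoc, hquad]
    simp only [add_mul, one_mul, smul_mul_assoc, smul_add]
    abel
  have hright : (s * L * s + s) * s = s * L + 1 + q • (s * L * s + s) := by
    rw [add_mul, hquad, mul_assoc, hquad]
    simp only [mul_add, mul_one, mul_smul_comm, smul_add]
    abel
  generalize s * L * s + s = L' at *
  rw [commute_iff_eq, hL.eq, ← mul_assoc, hleft, ← hL.eq, mul_assoc, hright]
  simp only [mul_add, add_mul, mul_one, one_mul, mul_smul_comm, smul_mul_assoc, mul_assoc, hL.eq]

end QuadraticBraid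

theorem commute_Ts_jucysMurphy_succ (hm : m + 2 < n) (hmJ : m ∈ J) :
    Commute (Ts m) (jucysMurphy J (m + 1) : Hecke n) := by
  rw [jucysMurphy_succ_of_mem hmJ]
  have hbraid := Ts_braid hm
  have hTs := commute_mul_mul_add_of_braid hbraid (Ts_mul_self (by omega))
  rcases m with _ | m
  · exact hTs
  by_cases hm' : m ∈ J
  · have hL : Commute (Ts (m + 1 + 1)) (jucysMurphy J m : Hecke n) :=
      commute_Ts_of_mem_parabolicAlg (fun i hi => Nat.add_le_add_right hi.2 1)
        (jucysMurphy_mem_parabolicAlg hm')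
    rw [jucysMurphy_succ_of_mem hm', mul_add, add_mul, add_assoc]
    exact (commute_mul_mul_mul_mul_of_braid hbraid hL).add_right hTs
  · rwa [jucysMurphy_succ_of_notMem hm']

theorem commute_Ts_jucysMurphy (hm : m + 1 < n) (hj : j ∈ J) (hjm : j < m) :
    Commute (Ts j) (jucysMurphy J m : Hecke n) := by
  induction m with
  | zero => omega
  | succ m ih =>
    rcases Nat.lt_succ_iff_lt_or_eq.1 hjm with hlt | rfl
    · have hfar : Commute (Ts j : Hecke n) (Ts (m + 1)) := commute_Ts (Or.inl (by omega))
      by_cases hmJ : m ∈ J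
      · rw [jucysMurphy_succ_of_mem hmJ]
        exact ((hfar.mul_right (ih (by omega) hlt)).mul_right hfar).add_right hfar
      · rwa [jucysMurphy_succ_of_notMem hmJ]
    · exact commute_Ts_jucysMurphy_succ hm hj

open Classical in
/-- The product of the Jucys–Murphy elements of `H_J` attached to the `k ∈ J` with `k < m`. -/
noncomputable def jucysMurphyProd (J : Set ℕ) : ℕ → Hecke n
  | 0 => 1
  | m + 1 => if m ∈ J then jucysMurphyProd J m * jucysMurphy J m else jucysMurphyProd J m

theorem jucysMurphyProd_succ_of_mem (h : m ∈ J) :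
    (jucysMurphyProd J (m + 1) : Hecke n) = jucysMurphyProd J m * jucysMurphy J m := by
  rw [jucysMurphyProd, if_pos h]

theorem jucysMurphyProd_succ_of_notMem (h : m ∉ J) :
    (jucysMurphyProd J (m + 1) : Hecke n) = jucysMurphyProd J m := by
  rw [jucysMurphyProd, if_neg h]

theorem jucysMurphyProd_mem_parabolicAlg (J : Set ℕ) (m : ℕ) :
    (jucysMurphyProd J m : Hecke n) ∈ parabolicAlg (J ∩ {i | i < m}) := by
  induction m with
  | zero => exact one_mem _
  | succ m ih =>
    have hmono : J ∩ {i | i < m} ⊆ J ∩ {i | i < m + 1} := fun i hi =>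
      ⟨hi.1, Nat.lt_succ_of_lt hi.2⟩
    by_cases h : m ∈ J
    · rw [jucysMurphyProd_succ_of_mem h]
      exact mul_mem (parabolicAlg_mono hmono ih) (jucysMurphy_mem_parabolicAlg h)
    · rw [jucysMurphyProd_succ_of_notMem h]
      exact parabolicAlg_mono hmono ih

theorem commute_Ts_jucysMurphyProd_succ (hm : m + 1 < n) (hmJ : m ∈ J) :
    Commute (Ts m) (jucysMurphyProd J (m + 1) : Hecke n) := by
  rw [jucysMurphyProd_succ_of_mem hmJ]
  rcases m with _ | m
  · rw [jucysMurphyProd, one_mul]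
    exact Commute.refl _
  have hprod : Commute (Ts (m + 1)) (jucysMurphyProd J m : Hecke n) :=
    commute_Ts_of_mem_parabolicAlg (fun i hi => Nat.add_le_add_right hi.2 1)
      (jucysMurphyProd_mem_parabolicAlg J m)
  by_cases hm' : m ∈ J
  · have hLL : Commute (jucysMurphy J m : Hecke n) (jucysMurphy J (m + 1)) :=
      commute_of_mem_parabolicAlg (fun i hi => commute_Ts_jucysMurphy hm hi.1 hi.2)
        (jucysMurphy_mem_parabolicAlg hm')
    rw [jucysMurphy_succ_of_mem hm'] at hLL
    rw [jucysMurphyProd_succ_of_mem hm', mul_assoc, jucysMurphy_succ_of_mem hm']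
    exact hprod.mul_right (commute_mul_mul_mul_add_of_quadratic (Ts_mul_self hm) hLL)
  · rw [jucysMurphyProd_succ_of_notMem hm', jucysMurphy_succ_of_notMem hm']
    exact hprod.mul_right (Commute.refl _)

theorem commute_Ts_jucysMurphyProd (hJ : ∀ i ∈ J, i + 1 < n) (hj : j ∈ J) (hjm : j < m) :
    Commute (Ts j) (jucysMurphyProd J m : Hecke n) := by
  induction m with
  | zero => omega
  | succ m ih =>
    rcases Nat.lt_succ_iff_lt_or_eq.1 hjm with hlt | rfl
    · by_cases hmJ : m ∈ J
      · rw [jucysMurphyProd_succ_of_mem hmJ]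
        exact (ih hlt).mul_right (commute_Ts_jucysMurphy (hJ m hmJ) hj hlt)
      · rw [jucysMurphyProd_succ_of_notMem hmJ]
        exact ih hlt
    · exact commute_Ts_jucysMurphyProd_succ (hJ j hj) hj

/-! ### The norm of `T_{w_J}` as a product of Jucys–Murphy elements -/

theorem isLeftMinimal_one (J : Set ℕ) : IsLeftMinimal J (1 : Perm (Fin n)) := by
  rintro j - h
  have := h.2
  simp [Fin.lt_def] at this

theorem IsLeftMinimal.eq_one (hd : IsLeftMinimal J d) (hdJ : d ∈ stdParabolic J) : d = 1 :=
  (hd.eq_and_eq (isLeftMinimal_one J) (inv_mem hdJ) (one_mem _) (by simp)).2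

theorem val_apply_eq_of_isLeftMinimal (hU : ∀ i ∈ U, i < m) (hm : m + 1 < n)
    (hdU : d ∈ stdParabolic (insert m U)) (hd : IsLeftMinimal U d) (hdesc : IsDescent d⁻¹ m) :
    ((d ⟨m + 1, hm⟩ : Fin n) : ℕ) = m := by
  have hm1 : m + 1 ∉ insert m U := by
    rintro (h | h)
    · omega
    · have := hU _ h; omega
  have hle : ((d ⟨m + 1, hm⟩ : Fin n) : ℕ) ≤ m + 1 :=
    (le_iff_of_mem_stdParabolic hdU hm1 ⟨m + 1, hm⟩).2 le_rfl
  have hinv_le : ((d⁻¹ ⟨m, by omega⟩ : Fin n) : ℕ) ≤ m + 1 :=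
    (le_iff_of_mem_stdParabolic (inv_mem hdU) hm1 ⟨m, by omega⟩).2 (by simp)
  have hdesc' := hdesc.2
  rw [Fin.lt_def] at hdesc'
  by_contra hne
  rcases Nat.lt_or_ge (d ⟨m + 1, hm⟩ : Fin n) m with hlt | hge
  · have hinv : d⁻¹ (d ⟨m + 1, hm⟩) < d⁻¹ ⟨m, by omega⟩ :=
      apply_lt_of_not_isDescent hd hlt fun c h1 h2 => by
        by_contra hc
        have hcU : c ∉ insert m U := by
          rintro (h | h)
          · simp only at h2; omega
          · exact hc h
        have := (le_iff_of_mem_stdParabolic hdU hcU ⟨m + 1, hm⟩).1 h1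
        simp only at this h2
        omega
    rw [← Equiv.Perm.mul_apply, inv_mul_cancel, Equiv.Perm.one_apply, Fin.lt_def] at hinv
    simp only at hinv
    omega
  · have hfix : d ⟨m + 1, hm⟩ = ⟨m + 1, hm⟩ := Fin.ext (by simp only; omega)
    rw [Equiv.Perm.inv_eq_iff_eq.2 hfix.symm] at hdesc'
    simp only at hdesc'
    omega

theorem swapSucc_mul_mem_stdParabolic (hU : ∀ i ∈ U, i < m) (hm : m + 1 < n)
    (hdU : d ∈ stdParabolic (insert m U)) (hd : ((d ⟨m + 1, hm⟩ : Fin n) : ℕ) = m) :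
    swapSucc m * d ∈ stdParabolic U := by
  refine mem_stdParabolic_of_le_iff fun c hc x => ?_
  rw [Equiv.Perm.mul_apply]
  by_cases hcm : c = m
  · subst hcm
    have hle : ((d x : Fin n) : ℕ) ≤ c + 1 ↔ (x : ℕ) ≤ c + 1 :=
      le_iff_of_mem_stdParabolic hdU (by
        rintro (h | h)
        · omega
        · have := hU _ h; omega) x
    have hval : ((d x : Fin n) : ℕ) = c ↔ (x : ℕ) = c + 1 := by
      conv_lhs => rw [← hd, ← Fin.ext_iff, d.injective.eq_iff, Fin.ext_iff]
    rw [swapSucc_apply_val hm]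
    split_ifs <;> omega
  · rw [swapSucc_le_iff hcm]
    exact le_iff_of_mem_stdParabolic hdU (by rintro (h | h); exacts [hcm h, hc h]) x

theorem isLeftMinimal_swapSucc_mul (hU : ∀ i ∈ U, i < m) (hm : m + 1 < n)
    (hdU : d ∈ stdParabolic U) (hd : IsLeftMinimal {i | i ∈ U ∧ i + 1 < m} d) :
    IsLeftMinimal U (swapSucc m * d) := by
  intro j hj hdesc
  have hjm := hU j hj
  by_cases hlt : j + 1 < m
  · rw [isDescent_inv_swapSucc_mul_iff hdesc.lt hm (Or.inl hlt)] at hdesc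
    exact hd j ⟨hj, hlt⟩ hdesc
  · obtain rfl : m = j + 1 := by omega
    have hmU : j + 1 ∉ U := fun h => lt_irrefl _ (hU _ h)
    have hdesc' := hdesc.2
    rw [mul_inv_rev, swapSucc_inv, Equiv.Perm.mul_apply, Equiv.Perm.mul_apply,
      swapSucc_apply_left hm, swapSucc_apply_of_ne hm (by simp) (by simp; omega),
      Fin.lt_def] at hdesc'
    have hleft := le_iff_of_mem_stdParabolic (inv_mem hdU) hmU ⟨j, by omega⟩
    have hright := le_iff_of_mem_stdParabolic (inv_mem hdU) hmU ⟨j + 1 + 1, hm⟩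
    simp only at hleft hright
    omega

theorem isDistinguished_insert_iff (hU : ∀ i ∈ U, i < m) (hm : m + 1 < n) :
    IsDistinguished (stdParabolic (insert m U)) (stdParabolic U) d ↔ d = 1 ∨
      ∃ c, IsDistinguished (stdParabolic U) (stdParabolic {i | i ∈ U ∧ i + 1 < m}) c ∧
        d = swapSucc m * c := by
  simp only [isDistinguished_iff]
  constructor
  · rintro ⟨hdU, hd⟩
    by_cases hone : d = 1
    · exact Or.inl hone
    obtain ⟨k, hk⟩ := exists_isDescent (inv_ne_one.2 hone)
    obtain rfl : k = m :=
      (mem_of_isDescent (inv_mem hdU) hk).resolve_right fun hkU => hd k hkU hk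
    refine Or.inr ⟨swapSucc k * d, ⟨swapSucc_mul_mem_stdParabolic hU hm hdU
      (val_apply_eq_of_isLeftMinimal hU hm hdU hd hk), fun j hj => ?_⟩,
      (swapSucc_mul_swapSucc_mul d k).symm⟩
    rw [isDescent_inv_swapSucc_mul_iff (by have := hj.2; omega) hm (Or.inl hj.2)]
    exact hd j hj.1
  · rintro (rfl | ⟨c, ⟨hcU, hc⟩, rfl⟩)
    · exact ⟨one_mem _, isLeftMinimal_one U⟩
    · exact ⟨mul_mem (swapSucc_mem_stdParabolic (Set.mem_insert _ _))
        (stdParabolic_mono (Set.subset_insert _ _) hcU), isLeftMinimal_swapSucc_mul hU hm hcU hc⟩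

theorem isDistinguished_self : IsDistinguished (stdParabolic J) (stdParabolic J) d ↔ d = 1 := by
  rw [isDistinguished_iff]
  refine ⟨fun ⟨hdJ, hd⟩ => hd.eq_one hdJ, ?_⟩
  rintro rfl
  exact ⟨one_mem _, isLeftMinimal_one J⟩

theorem relNorm_self (J : Set ℕ) (a : Hecke n) :
    relNorm (stdParabolic J) (stdParabolic J) a = a := by
  classical
  simp only [relNorm, isDistinguished_self]
  rw [Finset.filter_eq' Finset.univ 1, if_pos (Finset.mem_univ _), Finset.sum_singleton]
  simp [T_one]

theorem relNorm_insert (hU : ∀ i ∈ U, i < m) (hm : m + 1 < n) (a : Hecke n) :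
    relNorm (stdParabolic (insert m U)) (stdParabolic U) a =
      a + relNorm (stdParabolic U) (stdParabolic {i | i ∈ U ∧ i + 1 < m}) (Ts m * a * Ts m) := by
  classical
  have hasc : ∀ c : Perm (Fin n), c ∈ stdParabolic U → IsAscent c⁻¹ m := fun c hc =>
    isAscent_of_mem_stdParabolic (inv_mem hc) (fun h => lt_irrefl m (hU m h)) hm
  have hset : (Finset.univ.filter (IsDistinguished (stdParabolic (insert m U)) (stdParabolic U)) :
      Finset (Perm (Fin n))) = insert 1 ((Finset.univ.filter (IsDistinguished (stdParabolic U)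
        (stdParabolic {i | i ∈ U ∧ i + 1 < m}))).image (swapSucc m * ·)) := by
    ext d
    simp only [Finset.mem_filter, Finset.mem_univ, true_and, Finset.mem_insert, Finset.mem_image,
      isDistinguished_insert_iff hU hm, eq_comm]
  rw [relNorm, hset, Finset.sum_insert, Finset.sum_image]
  · rw [inv_one, T_one, one_mul, mul_one, relNorm]
    congr 1
    refine Finset.sum_congr rfl fun c hc => ?_
    have hc' := hasc c (Finset.mem_filter.1 hc).2.1
    rw [hc'.T_swapSucc_mul, mul_inv_rev, swapSucc_inv, hc'.T_mul_swapSucc]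
    simp only [mul_assoc]
  · exact fun c _ c' _ e => mul_left_cancel e
  · intro h
    obtain ⟨c, hc, e⟩ := Finset.mem_image.1 h
    have := (hasc c (Finset.mem_filter.1 hc).2.1).len_swapSucc_mul
    rw [e, len_one] at this
    omega

/-- The `i ∈ J` with `i + 1 ∈ J` and `i + 1 < m`; for large `m` this describes the
composition `λ - 1`. -/
def shrink (J : Set ℕ) (m : ℕ) : Set ℕ := {i | i ∈ J ∧ i + 1 ∈ J ∧ i + 1 < m}

theorem shrink_succ_of_mem (h : m ∈ J) (h' : m + 1 ∈ J) :
    shrink J (m + 2) = insert m (shrink J (m + 1)) := by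
  ext i
  simp only [shrink, Set.mem_ofPred_eq, Set.mem_insert_iff]
  constructor
  · rintro ⟨h1, h2, h3⟩
    by_cases e : i = m
    · exact Or.inl e
    · exact Or.inr ⟨h1, h2, by omega⟩
  · rintro (rfl | ⟨h1, h2, h3⟩)
    · exact ⟨h, h', by omega⟩
    · exact ⟨h1, h2, by omega⟩

theorem shrink_succ_of_notMem (h : m ∉ J ∨ m + 1 ∉ J) :
    shrink J (m + 2) = shrink J (m + 1) := by
  ext i
  simp only [shrink, Set.mem_ofPred_eq]
  constructor
  · rintro ⟨h1, h2, h3⟩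
    refine ⟨h1, h2, ?_⟩
    have : i ≠ m := by rintro rfl; tauto
    omega
  · rintro ⟨h1, h2, h3⟩
    exact ⟨h1, h2, by omega⟩

theorem shrink_le_one (J : Set ℕ) (h : m ≤ 1) : shrink J m = ∅ := by
  ext i
  simp only [shrink, Set.mem_ofPred_eq, Set.mem_empty_iff_false, iff_false]
  omega

theorem relNorm_Ts_eq_jucysMurphy (hm : m + 1 < n) (hmJ : m ∈ J) :
    relNorm (stdParabolic (shrink J (m + 1))) (stdParabolic (shrink J m)) (Ts m) =
      (jucysMurphy J m : Hecke n) := by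
  induction m with
  | zero => rw [shrink_le_one J (by omega), shrink_le_one J (by omega), relNorm_self]; rfl
  | succ m ih =>
    by_cases h : m ∈ J
    · have hlt : ∀ i ∈ shrink J (m + 1), i < m := fun i hi => Nat.lt_of_succ_lt_succ hi.2.2
      have hshrink : {i | i ∈ shrink J (m + 1) ∧ i + 1 < m} = shrink J m := by
        ext i
        simp only [shrink, Set.mem_ofPred_eq]
        exact ⟨fun ⟨⟨h1, h2, _⟩, h3⟩ => ⟨h1, h2, h3⟩, fun ⟨h1, h2, h3⟩ => ⟨⟨h1, h2, by omega⟩, h3⟩⟩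
      have hcomm : ∀ d ∈ (stdParabolic (shrink J (m + 1)) : Subgroup (Perm (Fin n))),
          Commute (Ts (m + 1)) (T d) := fun d hd => (commute_T_of_mem_stdParabolic
        (fun j hj => commute_Ts (Or.inl (Nat.add_le_add_right (hlt j hj) 1))) hd).symm
      rw [shrink_succ_of_mem h hmJ, relNorm_insert hlt (by omega), hshrink, Ts_braid hm,
        relNorm_mul_right _ _ hcomm, relNorm_mul_left _ _ hcomm, ih (by omega) h,
        jucysMurphy_succ_of_mem h, add_comm]
    · rw [shrink_succ_of_notMem (Or.inl h), relNorm_self, jucysMurphy_succ_of_notMem h]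

theorem relNorm_T_coxeterProd (hJ : ∀ i ∈ J, i + 1 < n) (m : ℕ) :
    relNorm (stdParabolic (shrink J m)) (stdParabolic ∅) (T (coxeterProd J m)) =
      (jucysMurphyProd J m : Hecke n) := by
  induction m with
  | zero =>
    rw [shrink_le_one J (by omega), relNorm_self]
    exact T_one
  | succ m ih =>
    by_cases h : m ∈ J
    · have hsub : shrink J m ⊆ shrink J (m + 1) := fun i hi =>
        ⟨hi.1, hi.2.1, Nat.lt_succ_of_lt hi.2.2⟩
      rw [T_coxeterProd_succ h, ← relNorm_relNorm (Set.empty_subset _) hsub,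
        relNorm_mul_right, ih, relNorm_mul_left, relNorm_Ts_eq_jucysMurphy (hJ m h) h,
        jucysMurphyProd_succ_of_mem h]
      · exact fun d hd => (commute_T_of_mem_stdParabolic (fun j hj =>
          commute_Ts_jucysMurphyProd hJ hj.1 (Nat.lt_of_succ_lt_succ hj.2.2)) hd).symm
      · exact fun d hd => (commute_T_of_mem_stdParabolic (fun j hj =>
          commute_Ts (Or.inl hj.2.2)) hd).symm
    · rw [jucysMurphyProd_succ_of_notMem h, coxeterProd_succ_of_notMem h, ← ih]
      rcases m with _ | m
      · rw [shrink_le_one J (by omega), shrink_le_one J (by omega)]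
      · rw [shrink_succ_of_notMem (Or.inr h)]

/-! ### Coefficients of products of Jucys–Murphy elements -/

theorem coeffT_mul_Ts_of_mem_parabolicAlg (hm : m ∉ J) (hmn : m + 1 < n)
    (ha : a ∈ parabolicAlg J) (v : Perm (Fin n)) :
    coeffT v (a * Ts m) = coeffT (v * swapSucc m) a := by
  classical
  have hterm : ∀ w, coeffT w a • coeffT v (T w * Ts m) =
      if w = v * swapSucc m then coeffT w a else 0 := by
    intro w
    by_cases hw : w ∈ stdParabolic J
    · have hiff : w * swapSucc m = v ↔ w = v * swapSucc m := by
        rw [← eq_mul_inv_iff_mul_eq, swapSucc_inv]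
      rw [← (isAscent_of_mem_stdParabolic hw hm hmn).T_mul_swapSucc, coeffT_T]
      simp [hiff]
    · simp [ha w hw]
  conv_lhs => rw [← sum_coeffT a, Finset.sum_mul, map_sum]
  simp only [smul_mul_assoc, map_smul, hterm]
  simp

/-- The span of the `T_w` for which the letter `m + 1` is the image of a letter below `m`. -/
noncomputable def lowSpan (n m : ℕ) : Submodule ℤ[X] (Hecke n) :=
  Submodule.span ℤ[X]
    {a | ∃ w : Perm (Fin n), (∃ x : Fin n, (x : ℕ) < m ∧ ((w x : Fin n) : ℕ) = m + 1) ∧ a = T w}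

theorem T_mem_lowSpan {x : Fin n} (hx : (x : ℕ) < m)
    (hw : ((w x : Fin n) : ℕ) = m + 1) : T w ∈ lowSpan n m :=
  Submodule.subset_span ⟨w, ⟨x, hx, hw⟩, rfl⟩

theorem coeffT_of_mem_lowSpan (ha : a ∈ lowSpan n m) {x : Fin n} (hx : m ≤ (x : ℕ))
    (hw : ((w x : Fin n) : ℕ) = m + 1) : coeffT w a = 0 := by
  induction ha using Submodule.span_induction with
  | mem a ha =>
    obtain ⟨v, ⟨y, hy, hv⟩, rfl⟩ := ha
    rw [coeffT_T, if_neg]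
    rintro rfl
    have hxy : x = y := v.injective (Fin.ext (hw.trans hv.symm))
    rw [hxy] at hx
    omega
  | zero => rw [map_zero]
  | add a b _ _ ha hb => rw [map_add, ha, hb, add_zero]
  | smul r a _ ha => rw [map_smul, ha, smul_zero]

theorem Ts_mul_mem_lowSpan (hj : j < m) (ha : a ∈ lowSpan n m) : Ts j * a ∈ lowSpan n m := by
  induction ha using Submodule.span_induction with
  | mem a ha =>
    obtain ⟨w, ⟨x, hx, hw⟩, rfl⟩ := ha
    refine Submodule.span_le.2 ?_ (Ts_mul_T_mem_span j w)
    rintro _ (rfl | rfl)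
    · exact T_mem_lowSpan hx hw
    · refine T_mem_lowSpan hx ?_
      rw [Equiv.Perm.mul_apply]
      by_cases hjn : j + 1 < n
      · rw [swapSucc_apply_val hjn]
        split_ifs <;> omega
      · simpa [swapSucc, hjn] using hw
  | zero => rw [mul_zero]; exact zero_mem _
  | add a b _ _ ha hb => rw [mul_add]; exact add_mem ha hb
  | smul r a _ ha => rw [mul_smul_comm]; exact Submodule.smul_mem _ _ ha

theorem mul_mem_lowSpan (hJ : ∀ j ∈ J, j < m) (hz : z ∈ parabolicAlg J) (ha : a ∈ lowSpan n m) :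
    z * a ∈ lowSpan n m := by
  replace hz := parabolicAlg_le_adjoin J hz
  induction hz using Algebra.adjoin_induction generalizing a with
  | mem z hz =>
    obtain ⟨j, hj, rfl⟩ := hz
    exact Ts_mul_mem_lowSpan (hJ j hj) ha
  | algebraMap r =>
    rw [← Algebra.smul_def]
    exact Submodule.smul_mem _ _ ha
  | add y z _ _ hy hz => rw [add_mul]; exact add_mem (hy ha) (hz ha)
  | mul y z _ _ hy hz => rw [mul_assoc]; exact hy (hz ha)

theorem Ts_mul_T_mul_Ts_mem_lowSpan (hm : m + 1 < n) (hJ : ∀ j ∈ J, j < m)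
    (hw : w ∈ stdParabolic J) {x : Fin n} (hxm : (x : ℕ) < m) (hx : ((w x : Fin n) : ℕ) = m) :
    Ts m * T w * Ts m ∈ lowSpan n m := by
  have hmJ : m ∉ J := fun h => lt_irrefl m (hJ m h)
  have hv : ((swapSucc m * w : Perm (Fin n)) x : ℕ) = m + 1 := by
    rw [Equiv.Perm.mul_apply, swapSucc_apply_val hm, if_pos hx]
  rw [← (isAscent_of_mem_stdParabolic (inv_mem hw) hmJ hm).T_swapSucc_mul]
  refine Submodule.span_le.2 ?_ (T_mul_Ts_mem_span m (swapSucc m * w))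
  rintro _ (rfl | rfl)
  · exact T_mem_lowSpan hxm hv
  · refine T_mem_lowSpan hxm ?_
    rwa [Equiv.Perm.mul_apply, swapSucc_apply_of_ne hm (by omega) (by omega)]

theorem exists_mem_lowSpan_jucysMurphy_eq (hm : m + 1 < n) :
    ∃ a ∈ lowSpan n m, jucysMurphy J m = Ts m + a := by
  induction m with
  | zero => exact ⟨0, zero_mem _, (add_zero _).symm⟩
  | succ m ih =>
    by_cases hmJ : m ∈ J
    swap
    · exact ⟨0, zero_mem _, by rw [jucysMurphy_succ_of_notMem hmJ, add_zero]⟩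
    refine ⟨Ts (m + 1) * jucysMurphy J m * Ts (m + 1), ?_,
      by rw [jucysMurphy_succ_of_mem hmJ, add_comm]⟩
    obtain ⟨a, ha, hL⟩ := ih (by omega)
    rw [← sum_coeffT (jucysMurphy J m), Finset.mul_sum, Finset.sum_mul]
    refine sum_mem fun w _ => ?_
    rw [mul_smul_comm, smul_mul_assoc]
    by_cases hcoeff : coeffT w (jucysMurphy J m) = 0
    · rw [hcoeff, zero_smul]
      exact zero_mem _
    have hw : w ∈ stdParabolic (J ∩ {i | i < m + 1}) :=
      not_not.1 fun h => hcoeff (jucysMurphy_mem_parabolicAlg hmJ w h)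
    obtain ⟨x, hx⟩ := w.surjective ⟨m + 1, by omega⟩
    have hwx : ((w x : Fin n) : ℕ) = m + 1 := by rw [hx]
    have hxm : (x : ℕ) ≤ m + 1 :=
      (le_iff_of_mem_stdParabolic hw (fun h => lt_irrefl (m + 1) h.2) x).1 hwx.le
    have hne : (x : ℕ) ≠ m + 1 := by
      intro hxm'
      refine hcoeff ?_
      rw [hL, map_add, coeffT_of_mem_lowSpan ha (by omega) hwx, ← T_swapSucc, coeffT_T, if_neg,
        add_zero]
      rintro rfl
      rw [swapSucc_apply_val (by omega)] at hwx
      split_ifs at hwx <;> omega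
    exact Submodule.smul_mem _ _
      (Ts_mul_T_mul_Ts_mem_lowSpan hm (fun j hj => hj.2) hw (by omega) hwx)

theorem coeffT_jucysMurphyProd_succ (hm : m ∈ J) (hmn : m + 1 < n) {x : Fin n}
    (hx : m ≤ (x : ℕ)) (hw : ((w x : Fin n) : ℕ) = m + 1) :
    coeffT w (jucysMurphyProd J (m + 1)) = coeffT (w * swapSucc m) (jucysMurphyProd J m) := by
  obtain ⟨a, ha, hL⟩ := exists_mem_lowSpan_jucysMurphy_eq (J := J) hmn
  have hP := jucysMurphyProd_mem_parabolicAlg (n := n) J m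
  rw [jucysMurphyProd_succ_of_mem hm, hL, mul_add, map_add,
    coeffT_mul_Ts_of_mem_parabolicAlg (fun h => lt_irrefl m h.2) hmn hP,
    coeffT_of_mem_lowSpan (mul_mem_lowSpan (fun j hj => hj.2) hP ha) hx hw, add_zero]

theorem coxeterProd_apply_of_lt {x : Fin n} (hx : m < (x : ℕ)) : coxeterProd J m x = x :=
  apply_eq_of_mem_stdParabolic (coxeterProd_mem_stdParabolic J m) (fun h => hx.not_gt h.2)
    fun j hj => by have : j < m := hj.2; omega

theorem coxeterProd_succ_apply_self (hm : m ∈ J) (hmn : m + 1 < n) :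
    (((coxeterProd J (m + 1) : Perm (Fin n)) ⟨m, by omega⟩ : Fin n) : ℕ) = m + 1 := by
  rw [coxeterProd_succ_of_mem hm, Equiv.Perm.mul_apply, swapSucc_apply_left hmn,
    coxeterProd_apply_of_lt (Nat.lt_succ_self m)]

theorem coeffT_coxeterProd_jucysMurphyProd_self (hJ : ∀ i ∈ J, i + 1 < n) (m : ℕ) :
    coeffT (coxeterProd J m) (jucysMurphyProd J m : Hecke n) = 1 := by
  induction m with
  | zero => rw [coxeterProd, jucysMurphyProd, ← T_one, coeffT_T, if_pos rfl]
  | succ m ih =>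
    by_cases hm : m ∈ J
    · rw [coeffT_jucysMurphyProd_succ hm (hJ m hm) le_rfl
      (coxeterProd_succ_apply_self hm (hJ m hm)),
        coxeterProd_succ_of_mem hm, mul_swapSucc_mul_swapSucc, ih]
    · rw [coxeterProd_succ_of_notMem hm, jucysMurphyProd_succ_of_notMem hm, ih]

theorem coeffT_coxeterProd_jucysMurphyProd_eq_zero (hJ : ∀ i ∈ J, i + 1 < n) (hKJ : K ⊆ J)
    (hkJ : k ∈ J) (hkK : k ∉ K) (hkm : k < m) :
    coeffT (coxeterProd K m) (jucysMurphyProd J m : Hecke n) = 0 := by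
  induction m with
  | zero => omega
  | succ m ih =>
    by_cases hmJ : m ∈ J
    · have hmn := hJ m hmJ
      by_cases hmK : m ∈ K
      · have hne : k ≠ m := fun e => hkK (e ▸ hmK)
        rw [coeffT_jucysMurphyProd_succ hmJ hmn le_rfl (coxeterProd_succ_apply_self hmK hmn),
          coxeterProd_succ_of_mem hmK, mul_swapSucc_mul_swapSucc, ih (by omega)]
      · have hfix : (coxeterProd K m : Perm (Fin n)) ⟨m + 1, hmn⟩ = ⟨m + 1, hmn⟩ :=
          coxeterProd_apply_of_lt (Nat.lt_succ_self m)
        rw [coxeterProd_succ_of_notMem hmK,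
          coeffT_jucysMurphyProd_succ hmJ hmn (Nat.le_succ m) (congrArg Fin.val hfix)]
        refine jucysMurphyProd_mem_parabolicAlg J m _ fun hmem => ?_
        have hle := (le_iff_of_mem_stdParabolic hmem (fun h => lt_irrefl m h.2)
          ⟨m, by omega⟩).2 le_rfl
        rw [Equiv.Perm.mul_apply, swapSucc_apply_left hmn, hfix] at hle
        exact Nat.not_succ_le_self m hle
    · have hne : k ≠ m := fun e => hmJ (e ▸ hkJ)
      rw [jucysMurphyProd_succ_of_notMem hmJ, coxeterProd_succ_of_notMem fun h => hmJ (hKJ h),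
        ih (by omega)]

/-! ### Reduction to Coxeter elements by cyclic shifts -/

theorem coxeterProd_eq_one (h : ∀ j ∈ J, m ≤ j) : (coxeterProd J m : Perm (Fin n)) = 1 := by
  induction m with
  | zero => rfl
  | succ m ih =>
    rw [coxeterProd_succ_of_notMem fun hm => absurd (h m hm) (by omega), ih fun j hj => by
      have := h j hj; omega]

theorem coxeterProd_insert {N : ℕ} (h : ∀ j ∈ J, k < j) (hk : k < N) :
    (coxeterProd (insert k J) N : Perm (Fin n)) = swapSucc k * coxeterProd J N := by
  induction N with
  | zero => omega
  | succ N ih =>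
    by_cases hkN : k = N
    · subst hkN
      have hk : k ∉ J := fun hk => lt_irrefl k (h k hk)
      rw [coxeterProd_succ_of_mem (Set.mem_insert k J), coxeterProd_succ_of_notMem hk,
        coxeterProd_eq_one (m := k), coxeterProd_eq_one, one_mul, mul_one]
      · exact fun j hj => (h j hj).le
      · rintro j (rfl | hj)
        exacts [le_rfl, (h j hj).le]
    · by_cases hN : N ∈ J
      · rw [coxeterProd_succ_of_mem (Set.mem_insert_of_mem k hN), coxeterProd_succ_of_mem hN,
          ih (by omega), mul_assoc]
      · rw [coxeterProd_succ_of_notMem hN, coxeterProd_succ_of_notMem (by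
          rintro (e | e); exacts [hkN e.symm, hN e]), ih (by omega)]

theorem commute_swapSucc_of_mem_stdParabolic (hJ : ∀ j ∈ J, i + 2 ≤ j) (hw : w ∈ stdParabolic J) :
    Commute (swapSucc i) w := by
  induction hw using stdParabolic_induction_right with
  | one => exact Commute.one_right _
  | mul_swapSucc w j _ hj _ ih => exact ih.mul_right (commute_swapSucc (Or.inl (hJ j hj)))

theorem mem_stdParabolic_of_apply_eq (hm : m + 1 < n) (hw : w ∈ stdParabolic (K ∩ {i | i < m + 1}))
    (hfix : w ⟨m + 1, hm⟩ = ⟨m + 1, hm⟩) : w ∈ stdParabolic (K ∩ {i | i < m}) := by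
  refine mem_stdParabolic_of_le_iff fun k hk x => ?_
  by_cases hkm : k = m
  · subst hkm
    have hle := le_iff_of_mem_stdParabolic hw (m := k + 1) (fun h => lt_irrefl (k + 1) h.2) x
    have heq : ((w x : Fin n) : ℕ) = k + 1 ↔ (x : ℕ) = k + 1 := by
      rw [show ((w x : Fin n) : ℕ) = k + 1 ↔ w x = w ⟨k + 1, hm⟩ by rw [hfix, Fin.ext_iff],
        w.injective.eq_iff, Fin.ext_iff]
    omega
  · refine le_iff_of_mem_stdParabolic hw (fun h => hk ⟨h.1, ?_⟩) x
    exact lt_of_le_of_ne (Nat.le_of_lt_succ h.2) hkm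

theorem mem_of_lt_apply (hw : w ∈ stdParabolic J) {x : Fin n} (hx : x < w x) : (x : ℕ) ∈ J := by
  by_contra h
  exact absurd ((le_iff_of_mem_stdParabolic hw h x).2 le_rfl) (not_le_of_gt hx)

theorem isDescent_of_apply_eq (hm : m < n) (hw : w ∈ stdParabolic J) (hmJ : m ∉ J) (him : i < m)
    (hwi : w ⟨i, by omega⟩ = ⟨m, hm⟩) : IsDescent w i := by
  refine ⟨by omega, ?_⟩
  have hle : ((w ⟨i + 1, by omega⟩ : Fin n) : ℕ) ≤ m :=
    (le_iff_of_mem_stdParabolic hw hmJ ⟨i + 1, by omega⟩).2 him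
  have hne : w ⟨i + 1, by omega⟩ ≠ ⟨m, hm⟩ := by
    rw [← hwi, w.injective.ne_iff]
    simp
  rw [hwi]
  exact lt_of_le_of_ne hle hne

theorem IsDescent.mul_of_mem_stdParabolic (h : IsDescent v i) (hJ : ∀ j ∈ J, i + 2 ≤ j)
    (hw : w ∈ stdParabolic J) : IsDescent (v * w) i := by
  have hfix : ∀ x : Fin n, (x : ℕ) ≤ i + 1 → w x = x := fun x hx =>
    apply_eq_of_mem_stdParabolic hw (fun h => absurd (hJ _ h) (by omega))
      fun j hj => by have := hJ j hj; omega
  refine ⟨h.lt, ?_⟩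
  rw [Equiv.Perm.mul_apply, Equiv.Perm.mul_apply, hfix _ le_rfl, hfix _ (Nat.le_succ i)]
  exact h.2

/-- `Q` passes from shorter elements, or elements of the same length, to the elements `w = v s_i`
obtained from them by a cyclic shift `w ↦ s_i w s_i` with `i ∈ K`. In the length-decreasing case
`Q` is required at both shorter elements `s_i w s_i` and `w s_i`, as in the relation between the
corresponding coefficients of a central element. -/
structure IsShiftClosed (K : Set ℕ) (Q : Perm (Fin n) → Prop) : Prop where
  of_isAscent : ∀ v i, i ∈ K → IsAscent v i → IsAscent v⁻¹ i → Q (swapSucc i * v) →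
    Q (v * swapSucc i)
  of_isDescent : ∀ v i, i ∈ K → IsAscent v i → IsDescent v⁻¹ i → Q (swapSucc i * v) → Q v →
    Q (v * swapSucc i)

section IsShiftClosed

variable {Q : Perm (Fin n) → Prop} {N : ℕ}

theorem IsShiftClosed.of_conj (hQ : IsShiftClosed K Q) (hw : w ∈ stdParabolic K)
    (hlt : ∀ v ∈ stdParabolic K, len v < len w → Q v) (hi : i ∈ K) (hd : IsDescent w i)
    (hconj : len (swapSucc i * w * swapSucc i) = len w → Q (swapSucc i * w * swapSucc i)) :
    Q w := by
  have hlen := hd.len_eq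
  have hasc : IsAscent (w * swapSucc i) i := isAscent_mul_swapSucc.2 hd
  have hs := swapSucc_mem_stdParabolic (n := n) hi
  rw [← mul_swapSucc_mul_swapSucc w i]
  rcases isAscent_or_isDescent (w * swapSucc i)⁻¹ hd.lt with hinv | hinv
  · refine hQ.of_isAscent _ i hi hasc hinv ?_
    rw [← mul_assoc]
    exact hconj (by rw [mul_assoc, hinv.len_swapSucc_mul, hlen])
  · have hlen' := hinv.len_eq_left
    exact hQ.of_isDescent _ i hi hasc hinv
      (hlt _ (mul_mem hs (mul_mem hw hs)) (by omega)) (hlt _ (mul_mem hw hs) (by omega))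

theorem IsShiftClosed.mul_coxeterProd_succ (hQ : IsShiftClosed K Q)
    (hlt : ∀ v ∈ stdParabolic K, len v < N → Q v) (hm : m + 1 < n)
    (ih : ∀ J ⊆ K, (∀ j ∈ J, m ≤ j ∧ j + 1 < n) → ∀ x ∈ stdParabolic (K ∩ {i | i < m}),
      len (x * coxeterProd J n) = N → Q (x * coxeterProd J n))
    (hJK : J ⊆ K) (hJ : ∀ j ∈ J, m + 1 ≤ j ∧ j + 1 < n)
    (hw : w ∈ stdParabolic (K ∩ {i | i < m + 1})) (hlen : len (w * coxeterProd J n) = N) :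
    Q (w * coxeterProd J n) := by
  have hmK : m + 1 ∉ K ∩ {i | i < m + 1} := fun h => lt_irrefl (m + 1) h.2
  obtain ⟨k, i, hk, him, hwi⟩ : ∃ k i, i + k = m + 1 ∧ ∃ h : i < n, w ⟨i, h⟩ = ⟨m + 1, hm⟩ := by
    have hle := (le_iff_of_mem_stdParabolic (inv_mem hw) hmK ⟨m + 1, hm⟩).2 le_rfl
    exact ⟨m + 1 - (w⁻¹ ⟨m + 1, hm⟩ : Fin n), (w⁻¹ ⟨m + 1, hm⟩ : Fin n), by omega, Fin.isLt _,
      by simp⟩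
  induction k generalizing w i with
  | zero =>
    obtain rfl : i = m + 1 := hk
    exact ih J hJK (fun j hj => ⟨(Nat.le_succ m).trans (hJ j hj).1, (hJ j hj).2⟩) w
      (mem_stdParabolic_of_apply_eq hm hw hwi) hlen
  | succ k ihk =>
    have hiK : i ∈ K ∩ {i | i < m + 1} :=
      mem_of_lt_apply hw (x := ⟨i, him⟩) (by rw [hwi, Fin.lt_def]; simp only; omega)
    have hs := swapSucc_mem_stdParabolic (n := n) hiK
    rcases Nat.eq_zero_or_pos k with rfl | hk0
    · obtain rfl : i = m := by omega
      have hins : w * coxeterProd J n = w * swapSucc i * coxeterProd (insert i J) n := by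
        rw [coxeterProd_insert (fun j hj => (hJ j hj).1) him, mul_assoc, swapSucc_mul_swapSucc_mul]
      rw [hins] at hlen ⊢
      refine ih (insert i J) (Set.insert_subset hiK.1 hJK) ?_ _ ?_ hlen
      · rintro j (rfl | hj)
        · exact ⟨le_rfl, hm⟩
        · exact ⟨(Nat.le_succ i).trans (hJ j hj).1, (hJ j hj).2⟩
      · refine mem_stdParabolic_of_apply_eq hm (mul_mem hw hs) ?_
        rw [Equiv.Perm.mul_apply, swapSucc_apply_right hm, hwi]
    · have hcJ : (coxeterProd J n : Perm (Fin n)) ∈ stdParabolic J :=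
        stdParabolic_mono Set.inter_subset_left (coxeterProd_mem_stdParabolic J n)
      have hJi : ∀ j ∈ J, i + 2 ≤ j := fun j hj => by have := (hJ j hj).1; omega
      have hdesc : IsDescent (w * coxeterProd J n) i :=
        (isDescent_of_apply_eq hm hw hmK (by omega) hwi).mul_of_mem_stdParabolic hJi hcJ
      refine hQ.of_conj (mul_mem (stdParabolic_mono Set.inter_subset_left hw)
        (stdParabolic_mono hJK hcJ)) (hlen ▸ hlt) hiK.1 hdesc fun hlen' => ?_
      have hconj : swapSucc i * (w * coxeterProd J n) * swapSucc i =
          swapSucc i * w * swapSucc i * coxeterProd J n := by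
        simp only [mul_assoc, (commute_swapSucc_of_mem_stdParabolic hJi hcJ).eq]
      rw [hconj] at hlen' ⊢
      refine ihk (mul_mem (mul_mem hs hw) hs) (hlen'.trans hlen) (i + 1) (by omega) hdesc.lt ?_
      rw [Equiv.Perm.mul_apply, Equiv.Perm.mul_apply, swapSucc_apply_right hdesc.lt, hwi,
        swapSucc_apply_of_ne hdesc.lt (by simp only; omega) (by simp only; omega)]

theorem IsShiftClosed.mul_coxeterProd (hQ : IsShiftClosed K Q)
    (hcox : ∀ J ⊆ K, (∀ j ∈ J, j + 1 < n) → Q (coxeterProd J n))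
    (hlt : ∀ v ∈ stdParabolic K, len v < N → Q v) (hm : m < n) (hJK : J ⊆ K)
    (hJ : ∀ j ∈ J, m ≤ j ∧ j + 1 < n) (hw : w ∈ stdParabolic (K ∩ {i | i < m}))
    (hlen : len (w * coxeterProd J n) = N) : Q (w * coxeterProd J n) := by
  induction m generalizing J w with
  | zero =>
    have hempty : K ∩ {i | i < 0} = ∅ := by ext; simp
    rw [hempty, stdParabolic_empty, Subgroup.mem_bot] at hw
    rw [hw, one_mul]
    exact hcox J hJK fun j hj => (hJ j hj).2
  | succ m ih =>
    exact hQ.mul_coxeterProd_succ hlt hm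
      (fun J hJK hJ x hx => ih (by omega) hJK hJ hx) hJK hJ hw hlen

/-- The theorem of Geck and Pfeiffer in type `A`. The largest letter moved by `w` is carried
upwards by cyclic shifts until the top simple reflection splits off into the Coxeter element. -/
theorem IsShiftClosed.of_mem_stdParabolic (hQ : IsShiftClosed K Q)
    (hcox : ∀ J ⊆ K, (∀ j ∈ J, j + 1 < n) → Q (coxeterProd J n)) (hw : w ∈ stdParabolic K) :
    Q w := by
  induction hN : len w using Nat.strong_induction_on generalizing w with
  | _ N ih =>
    rcases n with _ | n
    · rw [Subsingleton.elim w (coxeterProd ∅ 0)]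
      exact hcox ∅ (Set.empty_subset _) (by simp)
    · have hone : (coxeterProd ∅ (n + 1) : Perm (Fin (n + 1))) = 1 := coxeterProd_eq_one (by simp)
      have hw' : w ∈ stdParabolic (K ∩ {i | i < n}) := by
        refine mem_stdParabolic_of_le_iff fun k hk x => ?_
        by_cases hkK : k ∈ K
        · have : ¬ k < n := fun h => hk ⟨hkK, h⟩
          omega
        · exact le_iff_of_mem_stdParabolic hw hkK x
      have hQw := hQ.mul_coxeterProd hcox (fun v hv hvN => ih _ hvN hv rfl) (Nat.lt_succ_self n)
        (Set.empty_subset K) (by simp) hw' (by rwa [hone, mul_one])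
      rwa [hone, mul_one] at hQw

end IsShiftClosed

/-! ### Interchanging adjacent blocks -/

/-- The permutation moving the block of the `b` letters from `p` on up by `a` places, and the
block of the following `a` letters down by `b` places. -/
def blockSwap (p a b : ℕ) (h : p + a + b ≤ n) : Perm (Fin n) where
  toFun y := ⟨if (y : ℕ) < p then (y : ℕ) else if (y : ℕ) < p + b then y + a else
    if (y : ℕ) < p + a + b then y - b else y, by split_ifs <;> omega⟩
  invFun y := ⟨if (y : ℕ) < p then (y : ℕ) else if (y : ℕ) < p + a then y + b else
    if (y : ℕ) < p + a + b then y - a else y, by split_ifs <;> omega⟩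
  left_inv y := by
    ext
    dsimp only
    grind
  right_inv y := by
    ext
    dsimp only
    grind

/-- The simple reflection `s_j` is carried to `s_{j'}` by the interchange of blocks, that is,
`s_j * blockSwap p a b = blockSwap p a b * s_{j'}`. -/
def BlockShift (p a b j j' : ℕ) : Prop :=
  (p ≤ j ∧ j + 1 < p + a ∧ j' = j + b) ∨ (p + a ≤ j ∧ j + 1 < p + a + b ∧ j' + a = j) ∨
    ((j + 1 < p ∨ p + a + b ≤ j) ∧ j' = j)

section BlockSwap

variable {p a b j' : ℕ}

theorem BlockShift.lt (hjj : BlockShift p a b j j') (h : p + a + b ≤ n) (hj : j + 1 < n) :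
    j' + 1 < n := by
  rcases hjj with h | h | h <;> omega

variable (h : p + a + b ≤ n)

theorem blockSwap_apply_val (y : Fin n) :
    ((blockSwap p a b h y : Fin n) : ℕ) = if (y : ℕ) < p then (y : ℕ) else
      if (y : ℕ) < p + b then y + a else if (y : ℕ) < p + a + b then y - b else y := rfl

theorem swapSucc_mul_blockSwap (hj : j + 1 < n) (hjj : BlockShift p a b j j') :
    swapSucc j * blockSwap p a b h = blockSwap p a b h * swapSucc j' := by
  ext y
  rw [Equiv.Perm.mul_apply, Equiv.Perm.mul_apply, swapSucc_apply_val hj, blockSwap_apply_val,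
    blockSwap_apply_val, swapSucc_apply_val (hjj.lt h hj)]
  rcases hjj with h | h | h <;> grind

theorem isAscent_blockSwap (hj : j + 1 < n) (hjj : BlockShift p a b j j') :
    IsAscent (blockSwap p a b h) j' := by
  refine ⟨hjj.lt h hj, ?_⟩
  rw [Fin.lt_def, blockSwap_apply_val, blockSwap_apply_val]
  dsimp only
  rcases hjj with h | h | h <;> split_ifs <;> omega

theorem isAscent_inv_blockSwap (hj : j + 1 < n) (hjj : BlockShift p a b j j') :
    IsAscent (blockSwap p a b h)⁻¹ j := by
  rw [isAscent_inv_iff_len_lt hj, swapSucc_mul_blockSwap h hj hjj,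
    (isAscent_blockSwap h hj hjj).len_mul_swapSucc]
  omega

theorem Ts_mul_T_blockSwap (hj : j + 1 < n) (hjj : BlockShift p a b j j') :
    Ts j * T (blockSwap p a b h) = T (blockSwap p a b h) * Ts j' := by
  rw [← (isAscent_inv_blockSwap h hj hjj).T_swapSucc_mul, swapSucc_mul_blockSwap h hj hjj,
    (isAscent_blockSwap h hj hjj).T_mul_swapSucc]

theorem Ts_mul_T_blockSwap_inv (hj : j + 1 < n) (hjj : BlockShift p a b j j') :
    Ts j' * T (blockSwap p a b h)⁻¹ = T (blockSwap p a b h)⁻¹ * Ts j := by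
  have hconj : swapSucc j' * (blockSwap p a b h)⁻¹ = (blockSwap p a b h)⁻¹ * swapSucc j := by
    rw [mul_inv_eq_iff_eq_mul, mul_assoc, swapSucc_mul_blockSwap h hj hjj, inv_mul_cancel_left]
  have hasc : IsAscent (blockSwap p a b h)⁻¹⁻¹ j' := by
    rw [inv_inv]
    exact isAscent_blockSwap h hj hjj
  rw [← hasc.T_swapSucc_mul, hconj, (isAscent_inv_blockSwap h hj hjj).T_mul_swapSucc]

end BlockSwap

open Classical in
/-- The increasing product of the generators `T_{s_i}` with `i ∈ J` and `l ≤ i < l + k`. -/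
noncomputable def heckeCoxeterProd (J : Set ℕ) (l : ℕ) : ℕ → Hecke n
  | 0 => 1
  | k + 1 => if l + k ∈ J then heckeCoxeterProd J l k * Ts (l + k) else heckeCoxeterProd J l k

section HeckeCoxeterProd

variable {J' : Set ℕ} {l l' k' : ℕ}

theorem heckeCoxeterProd_succ_of_mem (h : l + k ∈ J) :
    (heckeCoxeterProd J l (k + 1) : Hecke n) = heckeCoxeterProd J l k * Ts (l + k) := by
  rw [heckeCoxeterProd, if_pos h]

theorem heckeCoxeterProd_succ_of_notMem (h : l + k ∉ J) :
    (heckeCoxeterProd J l (k + 1) : Hecke n) = heckeCoxeterProd J l k := by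
  rw [heckeCoxeterProd, if_neg h]

theorem T_coxeterProd (J : Set ℕ) (m : ℕ) :
    T (coxeterProd J m : Perm (Fin n)) = heckeCoxeterProd J 0 m := by
  induction m with
  | zero => exact T_one
  | succ m ih =>
    by_cases h : m ∈ J
    · rw [T_coxeterProd_succ h, heckeCoxeterProd_succ_of_mem (by rwa [zero_add]), ih, zero_add]
    · rw [coxeterProd_succ_of_notMem h, heckeCoxeterProd_succ_of_notMem (by rwa [zero_add]), ih]

theorem heckeCoxeterProd_add (J : Set ℕ) (l k k' : ℕ) :
    (heckeCoxeterProd J l (k + k') : Hecke n) =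
      heckeCoxeterProd J l k * heckeCoxeterProd J (l + k) k' := by
  induction k' with
  | zero => rw [add_zero, heckeCoxeterProd, mul_one]
  | succ k' ih =>
    by_cases h : l + k + k' ∈ J
    · rw [← add_assoc, heckeCoxeterProd_succ_of_mem (by rwa [← add_assoc]),
        heckeCoxeterProd_succ_of_mem h, ih, mul_assoc, add_assoc]
    · rw [← add_assoc, heckeCoxeterProd_succ_of_notMem (by rwa [← add_assoc]),
        heckeCoxeterProd_succ_of_notMem h, ih]

theorem heckeCoxeterProd_mul_of_intertwine (h : ∀ i < k, l + i ∈ J ↔ l' + i ∈ J')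
    (hz : ∀ i < k, l + i ∈ J → Ts (l + i) * z = z * Ts (l' + i)) :
    heckeCoxeterProd J l k * z = z * heckeCoxeterProd J' l' k := by
  induction k with
  | zero => rw [heckeCoxeterProd, heckeCoxeterProd, one_mul, mul_one]
  | succ k ih =>
    have ih' := ih (fun i hi => h i (by omega)) fun i hi => hz i (by omega)
    have hkJ' := h k (by omega)
    by_cases hk : l + k ∈ J
    · rw [heckeCoxeterProd_succ_of_mem hk, heckeCoxeterProd_succ_of_mem (hkJ'.1 hk), mul_assoc,
        hz k (by omega) hk, ← mul_assoc, ih', mul_assoc]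
    · rw [heckeCoxeterProd_succ_of_notMem hk, heckeCoxeterProd_succ_of_notMem (mt hkJ'.2 hk), ih']

theorem heckeCoxeterProd_congr (h : ∀ i < k, l + i ∈ J ↔ l + i ∈ J') :
    (heckeCoxeterProd J l k : Hecke n) = heckeCoxeterProd J' l k := by
  simpa only [mul_one, one_mul] using
    heckeCoxeterProd_mul_of_intertwine (z := (1 : Hecke n)) h fun i _ _ => by
      rw [mul_one, one_mul]

theorem heckeCoxeterProd_mem_posSubsemiring (J : Set ℕ) (l k : ℕ) :
    (heckeCoxeterProd J l k : Hecke n) ∈ posSubsemiring n := by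
  induction k with
  | zero => exact one_mem _
  | succ k ih =>
    by_cases hk : l + k ∈ J
    · rw [heckeCoxeterProd_succ_of_mem hk]
      exact mul_mem ih (Ts_mem_posSubsemiring _)
    · rwa [heckeCoxeterProd_succ_of_notMem hk]

theorem commute_heckeCoxeterProd
    (h : ∀ i < k, l + i ∈ J → ∀ i' < k', l' + i' ∈ J' → l + i + 2 ≤ l' + i') :
    Commute (heckeCoxeterProd J l k : Hecke n) (heckeCoxeterProd J' l' k') :=
  heckeCoxeterProd_mul_of_intertwine (fun _ _ => Iff.rfl) fun i hi hiJ =>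
    (heckeCoxeterProd_mul_of_intertwine (fun _ _ => Iff.rfl) fun i' hi' hiJ' =>
      (commute_Ts (Or.inl (h i hi hiJ i' hi' hiJ'))).symm).symm

theorem heckeCoxeterProd_eq_mul_Ts_mul (hk : k ∈ J) (m : ℕ) :
    (heckeCoxeterProd J 0 (k + 1 + m) : Hecke n) =
      heckeCoxeterProd (J \ {k}) 0 (k + 1) * Ts k * heckeCoxeterProd (J \ {k}) (k + 1) m := by
  have hlow : ∀ i < k, 0 + i ∈ J ↔ 0 + i ∈ J \ {k} := fun i hi => by
    simp only [Set.mem_sdiff, Set.mem_singleton_iff, iff_self_and]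
    omega
  have hhigh : ∀ i < m, k + 1 + i ∈ J ↔ k + 1 + i ∈ J \ {k} := fun i _ => by
    simp only [Set.mem_sdiff, Set.mem_singleton_iff, iff_self_and]
    omega
  rw [heckeCoxeterProd_add, heckeCoxeterProd_succ_of_mem (by rwa [zero_add]),
    heckeCoxeterProd_succ_of_notMem (J := J \ {k}) (by simp), heckeCoxeterProd_congr hlow, zero_add,
    zero_add, heckeCoxeterProd_congr hhigh]

end HeckeCoxeterProd

/-- The blocks of `J` starting at `p` of sizes `a` and `b` are unions of components of the set
`J ⊆ {i | i + 1 < n}` of simple reflections, and interchanging them turns `J` into `J'`. -/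
structure BlocksSwapped (J J' : Set ℕ) (n p a b : ℕ) : Prop where
  le : p + a + b ≤ n
  lt : ∀ i ∈ J, i + 1 < n
  low : ∀ i, i + 1 ≤ p → (i ∈ J ↔ i ∈ J')
  high : ∀ i, p + a + b ≤ i + 1 → (i ∈ J ↔ i ∈ J')
  left : ∀ i < a, p + i ∈ J ↔ p + b + i ∈ J'
  right : ∀ i < b, p + a + i ∈ J ↔ p + i ∈ J'
  notMem_low : ∀ i ∈ J, i + 1 ≠ p
  notMem_mid : ∀ i ∈ J, i + 1 ≠ p + a
  notMem_high : ∀ i ∈ J, i + 1 ≠ p + a + b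

namespace BlocksSwapped

variable {J' : Set ℕ} {p a b r : ℕ}

theorem blockShift_low (h : BlocksSwapped J J' n p a b) (hj : j ∈ J) (hjp : j < p) :
    BlockShift p a b j j := by
  have := h.notMem_low _ hj
  exact Or.inr (Or.inr ⟨by omega, rfl⟩)

theorem blockShift_left (h : BlocksSwapped J J' n p a b) (hi : i < a) (hiJ : p + i ∈ J) :
    BlockShift p a b (p + i) (p + b + i) := by
  have := h.notMem_mid _ hiJ
  exact Or.inl ⟨by omega, by omega, by omega⟩

theorem blockShift_right (h : BlocksSwapped J J' n p a b) (hi : i < b) (hiJ : p + a + i ∈ J) :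
    BlockShift p a b (p + a + i) (p + i) := by
  have := h.notMem_high _ hiJ
  exact Or.inr (Or.inl ⟨by omega, by omega, by omega⟩)

theorem low_mul (h : BlocksSwapped J J' n p a b) :
    heckeCoxeterProd J 0 p * T (blockSwap p a b h.le) =
      T (blockSwap p a b h.le) * heckeCoxeterProd J' 0 p :=
  heckeCoxeterProd_mul_of_intertwine (fun i hi => h.low _ (by omega)) fun i hi hiJ =>
    Ts_mul_T_blockSwap h.le (h.lt _ hiJ) (h.blockShift_low hiJ (by omega))

theorem left_mul (h : BlocksSwapped J J' n p a b) :
    heckeCoxeterProd J p a * T (blockSwap p a b h.le) =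
      T (blockSwap p a b h.le) * heckeCoxeterProd J' (p + b) a :=
  heckeCoxeterProd_mul_of_intertwine h.left fun _ hi hiJ =>
    Ts_mul_T_blockSwap h.le (h.lt _ hiJ) (h.blockShift_left hi hiJ)

theorem right_mul (h : BlocksSwapped J J' n p a b) :
    heckeCoxeterProd J (p + a) b * T (blockSwap p a b h.le) =
      T (blockSwap p a b h.le) * heckeCoxeterProd J' p b :=
  heckeCoxeterProd_mul_of_intertwine h.right fun _ hi hiJ =>
    Ts_mul_T_blockSwap h.le (h.lt _ hiJ) (h.blockShift_right hi hiJ)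

theorem high_mul (h : BlocksSwapped J J' n p a b) :
    heckeCoxeterProd J (p + a + b) r * T (blockSwap p a b h.le) =
      T (blockSwap p a b h.le) * heckeCoxeterProd J' (p + a + b) r :=
  heckeCoxeterProd_mul_of_intertwine (fun i _ => h.high _ (by omega)) fun _ _ hiJ =>
    Ts_mul_T_blockSwap h.le (h.lt _ hiJ) (Or.inr (Or.inr ⟨by omega, rfl⟩))

theorem low_mul_inv (h : BlocksSwapped J J' n p a b) :
    heckeCoxeterProd J' 0 p * T (blockSwap p a b h.le)⁻¹ =
      T (blockSwap p a b h.le)⁻¹ * heckeCoxeterProd J 0 p := by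
  refine heckeCoxeterProd_mul_of_intertwine (fun i hi => (h.low _ (by omega)).symm)
    fun i hi hiJ' => ?_
  have hiJ := (h.low _ (by omega)).2 hiJ'
  exact Ts_mul_T_blockSwap_inv h.le (h.lt _ hiJ) (h.blockShift_low hiJ (by omega))

theorem right_mul_inv (h : BlocksSwapped J J' n p a b) :
    heckeCoxeterProd J' p b * T (blockSwap p a b h.le)⁻¹ =
      T (blockSwap p a b h.le)⁻¹ * heckeCoxeterProd J (p + a) b := by
  refine heckeCoxeterProd_mul_of_intertwine (fun i hi => (h.right i hi).symm) fun i hi hiJ' => ?_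
  have hiJ := (h.right i hi).2 hiJ'
  exact Ts_mul_T_blockSwap_inv h.le (h.lt _ hiJ) (h.blockShift_right hi hiJ)

theorem commute_left_right (h : BlocksSwapped J J' n p a b) :
    Commute (heckeCoxeterProd J p a : Hecke n) (heckeCoxeterProd J (p + a) b) := by
  refine commute_heckeCoxeterProd fun i _ hiJ i' _ _ => ?_
  have := h.notMem_mid _ hiJ
  omega

theorem T_coxeterProd_mul_eq (h : BlocksSwapped J J' n p a b) (hr : n = p + b + (a + r)) :
    T (coxeterProd J n) * T (blockSwap p a b h.le) =
      heckeCoxeterProd J 0 p * heckeCoxeterProd J (p + a) b * T (blockSwap p a b h.le) *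
        heckeCoxeterProd J' (p + b) (a + r) := by
  have hn : n = p + a + b + r := by omega
  calc T (coxeterProd J n) * T (blockSwap p a b h.le)
    _ = heckeCoxeterProd J 0 p * (heckeCoxeterProd J p a * heckeCoxeterProd J (p + a) b) *
          (heckeCoxeterProd J (p + a + b) r * T (blockSwap p a b h.le)) := by
        rw [(T_coxeterProd J n).trans (congrArg _ hn), heckeCoxeterProd_add, heckeCoxeterProd_add,
          heckeCoxeterProd_add]
        simp only [zero_add, mul_assoc]
    _ = heckeCoxeterProd J 0 p * heckeCoxeterProd J (p + a) b *
          (heckeCoxeterProd J p a * T (blockSwap p a b h.le)) *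
          heckeCoxeterProd J' (p + a + b) r := by
        rw [h.high_mul, h.commute_left_right.eq]
        simp only [mul_assoc]
    _ = _ := by
        rw [h.left_mul, heckeCoxeterProd_add, add_right_comm p b a]
        simp only [mul_assoc]

theorem T_coxeterProd_mul (h : BlocksSwapped J J' n p a b) :
    T (coxeterProd J n) * T (blockSwap p a b h.le) =
      T (blockSwap p a b h.le) * T (coxeterProd J' n) := by
  obtain ⟨r, hr⟩ := Nat.exists_eq_add_of_le h.le
  have hn : n = p + b + (a + r) := by omega
  have hfactor : T (coxeterProd J' n : Perm (Fin n)) =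
      heckeCoxeterProd J' 0 p * heckeCoxeterProd J' p b * heckeCoxeterProd J' (p + b) (a + r) := by
    rw [(T_coxeterProd J' n).trans (congrArg _ hn), heckeCoxeterProd_add, heckeCoxeterProd_add,
      zero_add, zero_add]
  rw [h.T_coxeterProd_mul_eq hn, hfactor, mul_assoc (heckeCoxeterProd J 0 p), h.right_mul,
    ← mul_assoc, h.low_mul]
  simp only [mul_assoc]

theorem T_inv_mul_T_coxeterProd_mul (h : BlocksSwapped J J' n p a b) (hr : n = p + b + (a + r)) :
    T (blockSwap p a b h.le)⁻¹ * T (coxeterProd J n) * T (blockSwap p a b h.le) =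
      heckeCoxeterProd J' 0 (p + b) * (T (blockSwap p a b h.le)⁻¹ * T (blockSwap p a b h.le)) *
        heckeCoxeterProd J' (p + b) (a + r) := by
  have hleft : T (blockSwap p a b h.le)⁻¹ *
      (heckeCoxeterProd J 0 p * heckeCoxeterProd J (p + a) b) =
      heckeCoxeterProd J' 0 (p + b) * T (blockSwap p a b h.le)⁻¹ := by
    rw [heckeCoxeterProd_add, zero_add, ← mul_assoc, ← h.low_mul_inv, mul_assoc, ← h.right_mul_inv,
      mul_assoc]
  rw [mul_assoc, h.T_coxeterProd_mul_eq hr, ← mul_assoc, ← mul_assoc, hleft]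
  simp only [mul_assoc]

theorem isConj_coxeterProd (h : BlocksSwapped J J' n p a b) :
    IsConj (coxeterProd J n : Perm (Fin n)) (coxeterProd J' n) := by
  -- at `ξ = 0` the intertwining relation becomes one in the group
  have hspec := congrArg
    (fun x : Hecke n => (coeffT (coxeterProd J n * blockSwap p a b h.le) x).eval 0)
    h.T_coxeterProd_mul
  simp only [eval_coeffT_mul_T, mul_inv_cancel_right] at hspec
  rw [coeffT_T, coeffT_T, if_pos rfl] at hspec
  split_ifs at hspec with hconj
  · rw [isConj_comm, isConj_iff]
    exact ⟨blockSwap p a b h.le, mul_inv_eq_iff_eq_mul.2 (eq_mul_inv_iff_mul_eq.1 hconj)⟩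
  · simp at hspec

end BlocksSwapped

theorem T_inv_mul_T_sub_one_mem_posSubsemiring (w : Perm (Fin n)) :
    T w⁻¹ * T w - 1 ∈ posSubsemiring n := by
  intro v
  rw [map_sub]
  by_cases hv : v = 1
  · subst hv
    rw [coeffT_one_T_mul_T, inv_mul_cancel, if_pos rfl, ← T_one, coeffT_T, if_pos rfl, sub_self]
    exact zero_mem _
  · rw [← T_one, coeffT_T, if_neg (Ne.symm hv), sub_zero]
    exact coeffT_T_mul_T_mem_polyNonneg _ _ _

theorem IsDescent.T_inv_mul_T_sub_mem_posSubsemiring (hw : IsDescent w i) :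
    T w⁻¹ * T w - (X : ℤ[X]) • Ts i ∈ posSubsemiring n := by
  have hinv : T w⁻¹ = Ts i * T (w * swapSucc i)⁻¹ := by
    have hw' : IsDescent w⁻¹⁻¹ i := by rwa [inv_inv]
    rw [hw'.T_eq_left, mul_inv_rev, swapSucc_inv]
  have hprod : T w⁻¹ * T w = Ts i * (T (w * swapSucc i)⁻¹ * T (w * swapSucc i)) * Ts i := by
    rw [hinv, hw.T_eq]
    simp only [mul_assoc]
  have hdiff : T w⁻¹ * T w - (X : ℤ[X]) • Ts i =
      1 + Ts i * (T (w * swapSucc i)⁻¹ * T (w * swapSucc i) - 1) * Ts i := by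
    rw [hprod, mul_sub, sub_mul, mul_one, Ts_mul_self hw.lt]
    abel
  rw [hdiff]
  exact add_mem (one_mem _) (mul_mem (mul_mem (Ts_mem_posSubsemiring i)
    (T_inv_mul_T_sub_one_mem_posSubsemiring _)) (Ts_mem_posSubsemiring i))

/-! ### Removing one simple reflection from a parabolic subgroup -/

/-- The interval `{i | p ≤ i < e}` is a component of the set `K` of simple reflections. -/
structure IsRun (K : Set ℕ) (p e : ℕ) : Prop where
  mem : ∀ i, p ≤ i → i < e → i ∈ K
  succ_ne : ∀ i ∈ K, i + 1 ≠ p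
  notMem : e ∉ K

theorem exists_isRun (hK : ∀ i ∈ K, i < m) (hk : k ∈ K) :
    ∃ p e, p ≤ k ∧ k < e ∧ IsRun K p e := by
  classical
  have hlow : ∃ p, p ≤ k ∧ ∀ i, p ≤ i → i ≤ k → i ∈ K :=
    ⟨k, le_rfl, fun i h1 h2 => by rwa [le_antisymm h2 h1]⟩
  have hhigh : ∃ e, k < e ∧ e ∉ K :=
    ⟨m, hK k hk, fun h => (hK m h).false⟩
  obtain ⟨hpk, hpK⟩ := Nat.find_spec hlow
  obtain ⟨hke, heK⟩ := Nat.find_spec hhigh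
  refine ⟨Nat.find hlow, Nat.find hhigh, hpk, hke, fun i hpi hie => ?_, fun i hi hip => ?_, heK⟩
  · rcases le_or_gt i k with hik | hki
    · exact hpK i hpi hik
    · by_contra hi
      exact Nat.find_min hhigh hie ⟨hki, hi⟩
  · refine Nat.find_min hlow (m := i) (by omega) ⟨by omega, fun i' h1 h2 => ?_⟩
    rcases Nat.eq_or_lt_of_le h1 with rfl | h3
    · exact hi
    · exact hpK i' (by omega) h2

namespace IsRun

variable {p a b : ℕ}

/- Removing `p + a` from the run leaves components with `a` and `b` elements, which act on blocks
of `a + 1` and `b + 1` letters. -/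
theorem blocksSwapped (h : IsRun K p (p + a + b + 1)) (hK : ∀ i ∈ K, i + 1 < n) :
    BlocksSwapped (K \ {p + a}) (K \ {p + b}) n p (a + 1) (b + 1) where
  le := by
    have := hK (p + a + b) (h.mem _ (by omega) (by omega))
    omega
  lt i hi := hK i hi.1
  low i hi := by
    simp only [Set.mem_sdiff, Set.mem_singleton_iff]
    exact and_congr_right fun _ => by omega
  high i hi := by
    simp only [Set.mem_sdiff, Set.mem_singleton_iff]
    exact and_congr_right fun _ => by omega
  left i hi := by
    simp only [Set.mem_sdiff, Set.mem_singleton_iff]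
    rcases Nat.lt_succ_iff_lt_or_eq.1 hi with hia | rfl
    · simp only [h.mem (p + i) (by omega) (by omega),
        h.mem (p + (b + 1) + i) (by omega) (by omega), true_and]
      omega
    · have hend : p + (b + 1) + i = p + i + b + 1 := by omega
      simp [hend, h.notMem]
  right i hi := by
    simp only [Set.mem_sdiff, Set.mem_singleton_iff]
    rcases Nat.lt_succ_iff_lt_or_eq.1 hi with hib | rfl
    · simp only [h.mem (p + (a + 1) + i) (by omega) (by omega),
        h.mem (p + i) (by omega) (by omega), true_and]
      omega
    · have hend : p + (a + 1) + i = p + a + i + 1 := by omega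
      simp [hend, h.notMem]
  notMem_low i hi := h.succ_ne i hi.1
  notMem_mid i hi hi' := hi.2 (by rw [Set.mem_singleton_iff]; omega)
  notMem_high i hi hi' := h.notMem (by rw [show p + a + b + 1 = i by omega]; exact hi.1)

theorem isDistinguished_blockSwap (h : IsRun K p (p + a + b + 1)) (hK : ∀ i ∈ K, i + 1 < n)
    (hle : p + (a + 1) + (b + 1) ≤ n) :
    IsDistinguished (stdParabolic K) (stdParabolic (K \ {p + a}))
      (blockSwap p (a + 1) (b + 1) hle) := by
  refine isDistinguished_iff.2 ⟨mem_stdParabolic_of_le_iff fun m hm y => ?_, fun j hj => ?_⟩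
  · have hm' : m < p ∨ p + a + b + 1 ≤ m := by
      by_contra hcon
      exact hm (h.mem m (by omega) (by omega))
    rw [blockSwap_apply_val]
    split_ifs <;> omega
  · have hja : j ≠ p + a := hj.2
    have hje : j ≠ p + a + b + 1 := fun hcon => h.notMem (hcon ▸ hj.1)
    have hjp := h.succ_ne j hj.1
    refine (isAscent_inv_blockSwap (j' := if p ≤ j ∧ j < p + a then j + (b + 1) else
      if p + a < j ∧ j < p + a + b + 1 then j - (a + 1) else j) hle (hK j hj.1) ?_).not_isDescent
    unfold BlockShift
    split_ifs <;> omega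

end IsRun

theorem isDescent_blockSwap {p a b : ℕ} (h : p + (a + 1) + (b + 1) ≤ n) :
    IsDescent (blockSwap p (a + 1) (b + 1) h) (p + b) := by
  refine ⟨by omega, ?_⟩
  rw [Fin.lt_def, blockSwap_apply_val, blockSwap_apply_val]
  dsimp only
  split_ifs <;> omega

theorem exists_isDistinguished_sub_mem_posSubsemiring (hK : ∀ i ∈ K, i + 1 < n) (hk : k ∈ K) :
    ∃ c : Perm (Fin n), IsDistinguished (stdParabolic K) (stdParabolic (K \ {k})) c ∧
      T c⁻¹ * T (coxeterProd (K \ {k}) n) * T c - (X : ℤ[X]) • T (coxeterProd K n) ∈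
        posSubsemiring n := by
  obtain ⟨p, e, hpk, hke, hrun⟩ := exists_isRun (m := n) (fun i hi => by have := hK i hi; omega) hk
  obtain ⟨a, rfl⟩ := Nat.exists_eq_add_of_le hpk
  obtain ⟨b, rfl⟩ := Nat.exists_eq_add_of_lt hke
  have hswap := hrun.blocksSwapped hK
  have hpb : p + b ∈ K := hrun.mem _ (by omega) (by omega)
  obtain ⟨r, hr⟩ := Nat.exists_eq_add_of_le hswap.le
  have hn : n = p + (b + 1) + (a + 1 + r) := by omega
  have hcox : T (coxeterProd K n : Perm (Fin n)) =
      heckeCoxeterProd (K \ {p + b}) 0 (p + (b + 1)) * Ts (p + b) *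
        heckeCoxeterProd (K \ {p + b}) (p + (b + 1)) (a + 1 + r) :=
    ((T_coxeterProd K n).trans (congrArg _ hn)).trans (heckeCoxeterProd_eq_mul_Ts_mul hpb _)
  refine ⟨_, hrun.isDistinguished_blockSwap hK hswap.le, ?_⟩
  rw [hswap.T_inv_mul_T_coxeterProd_mul hn, hcox, ← smul_mul_assoc, ← mul_smul_comm, ← sub_mul,
    ← mul_sub]
  exact mul_mem (mul_mem (heckeCoxeterProd_mem_posSubsemiring _ _ _)
    (isDescent_blockSwap hswap.le).T_inv_mul_T_sub_mem_posSubsemiring)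
    (heckeCoxeterProd_mem_posSubsemiring _ _ _)

/-! ### Cyclic shifts of coefficients -/

theorem coeffT_mul_swapSucc_of_commute (hz : Commute (Ts i) z) (hv : IsAscent v i)
    (hv' : IsAscent v⁻¹ i) : coeffT (v * swapSucc i) z = coeffT (swapSucc i * v) z := by
  have hv'' : IsAscent v⁻¹⁻¹ i := by rwa [inv_inv]
  rw [coeffT_eq_coeffT_one, coeffT_eq_coeffT_one (swapSucc i * v), mul_inv_rev, mul_inv_rev,
    swapSucc_inv, hv''.T_swapSucc_mul, hv'.T_mul_swapSucc, ← mul_assoc, ← mul_assoc, ← hz.eq,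
    mul_assoc, coeffT_one_mul_comm]

theorem coeffT_mul_swapSucc_of_commute_of_isDescent (hz : Commute (Ts i) z) (hv : IsAscent v i)
    (hv' : IsDescent v⁻¹ i) :
    coeffT (v * swapSucc i) z = coeffT (swapSucc i * v) z + X * coeffT v z := by
  have hv'' : IsAscent v⁻¹⁻¹ i := by rwa [inv_inv]
  calc coeffT (v * swapSucc i) z = coeffT 1 (z * (Ts i * T v⁻¹)) := by
        rw [coeffT_eq_coeffT_one, mul_inv_rev, swapSucc_inv, hv''.T_swapSucc_mul]
    _ = coeffT 1 (z * (T v⁻¹ * Ts i)) := by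
        rw [← mul_assoc, ← mul_assoc, ← hz.eq, mul_assoc, coeffT_one_mul_comm]
    _ = _ := by
        rw [hv'.T_mul_Ts, coeffT_eq_coeffT_one (swapSucc i * v), coeffT_eq_coeffT_one v,
          mul_inv_rev, swapSucc_inv, mul_add, mul_smul_comm, map_add, map_smul, smul_eq_mul]

theorem mem_posSubsemiring_of_commute (hz : ∀ k ∈ K, Commute (Ts k) z) (hzK : z ∈ parabolicAlg K)
    (hcox : ∀ J ⊆ K, (∀ j ∈ J, j + 1 < n) → coeffT (coxeterProd J n) z ∈ polyNonneg) :
    z ∈ posSubsemiring n := by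
  have hshift : IsShiftClosed K fun w : Perm (Fin n) => coeffT w z ∈ polyNonneg :=
    { of_isAscent := fun v i hi h1 h2 hv => by
        rwa [coeffT_mul_swapSucc_of_commute (hz i hi) h1 h2]
      of_isDescent := fun v i hi h1 h2 hsv hv => by
        rw [coeffT_mul_swapSucc_of_commute_of_isDescent (hz i hi) h1 h2]
        exact add_mem hsv (mul_mem X_mem_polyNonneg hv) }
  intro w
  by_cases hw : w ∈ stdParabolic K
  · exact hshift.of_mem_stdParabolic hcox hw
  · rw [hzK w hw]
    exact zero_mem _
/-! ### The comparison of norms -/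

theorem isDistinguished_one (K U : Subgroup (Perm (Fin n))) : IsDistinguished K U 1 :=
  ⟨one_mem _, fun u _ => by rw [len_one]; exact Nat.zero_le _⟩

theorem IsDistinguished.relNorm_sub_mem_posSubsemiring {K U : Subgroup (Perm (Fin n))}
    (hd : IsDistinguished K U d) (ha : a ∈ posSubsemiring n) :
    relNorm K U a - T d⁻¹ * a * T d ∈ posSubsemiring n := by
  classical
  rw [relNorm, ← Finset.add_sum_erase _ _ (Finset.mem_filter.2 ⟨Finset.mem_univ d, hd⟩),
    add_sub_cancel_left]
  exact sum_mem fun _ _ => mul_mem (mul_mem (T_mem_posSubsemiring _) ha) (T_mem_posSubsemiring _)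

theorem relNorm_sub_self_mem_posSubsemiring (K U : Subgroup (Perm (Fin n)))
    (ha : a ∈ posSubsemiring n) : relNorm K U a - a ∈ posSubsemiring n := by
  simpa only [inv_one, T_one, one_mul, mul_one] using
    (isDistinguished_one K U).relNorm_sub_mem_posSubsemiring ha

theorem jucysMurphyProd_sub_mem_posSubsemiring (hJ : ∀ i ∈ J, i + 1 < n) :
    (jucysMurphyProd J n : Hecke n) - T (coxeterProd J n) ∈ posSubsemiring n := by
  rw [← relNorm_T_coxeterProd hJ]
  exact relNorm_sub_self_mem_posSubsemiring _ _ (T_mem_posSubsemiring _)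

theorem jucysMurphyProd_mem_posSubsemiring (hJ : ∀ i ∈ J, i + 1 < n) :
    (jucysMurphyProd J n : Hecke n) ∈ posSubsemiring n := by
  rw [← relNorm_T_coxeterProd hJ]
  exact relNorm_mem_posSubsemiring _ _ (T_mem_posSubsemiring _)

theorem jucysMurphyProd_mem_parabolicAlg_self (J : Set ℕ) :
    (jucysMurphyProd J n : Hecke n) ∈ parabolicAlg J :=
  parabolicAlg_mono Set.inter_subset_left (jucysMurphyProd_mem_parabolicAlg J n)

theorem commute_Ts_jucysMurphyProd_self (hJ : ∀ i ∈ J, i + 1 < n) (hj : j ∈ J) :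
    Commute (Ts j) (jucysMurphyProd J n : Hecke n) :=
  commute_Ts_jucysMurphyProd hJ hj (by have := hJ j hj; omega)

/- Both elements commute with the generators of `W_K`, so it suffices to compare coefficients at
Coxeter elements of parabolic subgroups of `W_K`. That of `jucysMurphyProd K n` vanishes at all of
them but the largest. -/
theorem relNorm_jucysMurphyProd_sub_mem_posSubsemiring (hK : ∀ i ∈ K, i + 1 < n) (hk : k ∈ K) :
    relNorm (stdParabolic K) (stdParabolic (K \ {k})) (jucysMurphyProd (K \ {k}) n) -
      (X : ℤ[X]) • (jucysMurphyProd K n : Hecke n) ∈ posSubsemiring n := by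
  have hJ : ∀ i ∈ K \ {k}, i + 1 < n := fun i hi => hK i hi.1
  have hpos := jucysMurphyProd_mem_posSubsemiring hJ
  refine mem_posSubsemiring_of_commute (K := K) (fun j hj => ?_) ?_ fun J' hJ' _ => ?_
  · exact (commute_Ts_relNorm (fun i hi => commute_Ts_jucysMurphyProd_self hJ hi) hj).sub_right
      ((commute_Ts_jucysMurphyProd_self hK hj).smul_right _)
  · exact sub_mem (relNorm_mem_parabolicAlg (parabolicAlg_mono Set.sdiff_subset
      (jucysMurphyProd_mem_parabolicAlg_self _)))
      (Subalgebra.smul_mem _ (jucysMurphyProd_mem_parabolicAlg_self K) _)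
  by_cases hKJ' : K ⊆ J'
  · obtain rfl := hJ'.antisymm hKJ'
    obtain ⟨c, hc, hcox⟩ := exists_isDistinguished_sub_mem_posSubsemiring hK hk
    have hconj := mul_mem (mul_mem (T_mem_posSubsemiring c⁻¹)
      (jucysMurphyProd_sub_mem_posSubsemiring hJ)) (T_mem_posSubsemiring c)
    have hsum := add_mem (add_mem (hc.relNorm_sub_mem_posSubsemiring hpos) hconj) hcox
    rw [mul_sub, sub_mul, sub_add_sub_cancel, sub_add_sub_cancel] at hsum
    have hcoeff := hsum (coxeterProd J' n)
    rw [map_sub, map_smul, coeffT_T, if_pos rfl] at hcoeff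
    rwa [map_sub, map_smul, coeffT_coxeterProd_jucysMurphyProd_self hK]
  · obtain ⟨i, hi, hiJ'⟩ := Set.not_subset.1 hKJ'
    rw [map_sub, map_smul, coeffT_coxeterProd_jucysMurphyProd_eq_zero hK hJ' hi hiJ'
      (by have := hK i hi; omega), smul_zero, sub_zero]
    exact relNorm_mem_posSubsemiring _ _ hpos _

/-- The norm from `W_J` to the whole group of the product of the Jucys–Murphy elements. -/
noncomputable def normJucysMurphy (n : ℕ) (J : Set ℕ) : Hecke n :=
  relNorm (stdParabolic Set.univ) (stdParabolic J) (jucysMurphyProd J n)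

theorem normJucysMurphy_mem_posSubsemiring (hJ : ∀ i ∈ J, i + 1 < n) :
    normJucysMurphy n J ∈ posSubsemiring n :=
  relNorm_mem_posSubsemiring _ _ (jucysMurphyProd_mem_posSubsemiring hJ)

theorem commute_Ts_normJucysMurphy (hJ : ∀ i ∈ J, i + 1 < n) (k : ℕ) :
    Commute (Ts k) (normJucysMurphy n J) :=
  commute_Ts_relNorm (fun _ hj => commute_Ts_jucysMurphyProd_self hJ hj) (Set.mem_univ k)

theorem normJucysMurphy_sdiff_singleton_sub_mem_posSubsemiring (hK : ∀ i ∈ K, i + 1 < n)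
    (hk : k ∈ K) :
    normJucysMurphy n (K \ {k}) - (X : ℤ[X]) • normJucysMurphy n K ∈ posSubsemiring n := by
  have h := relNorm_mem_posSubsemiring (stdParabolic Set.univ) (stdParabolic K)
    (relNorm_jucysMurphyProd_sub_mem_posSubsemiring hK hk)
  rwa [relNorm_sub, relNorm_smul, relNorm_relNorm Set.sdiff_subset (Set.subset_univ K)] at h

theorem normJucysMurphy_sub_mem_posSubsemiring (hK : ∀ i ∈ K, i + 1 < n) (hJK : J ⊆ K) :
    normJucysMurphy n J - (X : ℤ[X]) ^ (K \ J).ncard • normJucysMurphy n K ∈ posSubsemiring n := by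
  have hfin : (K \ J).Finite := (Set.finite_lt_nat n).subset fun i hi => by
    have := hK i hi.1
    simp only [Set.mem_ofPred_eq]
    omega
  induction hN : (K \ J).ncard generalizing K with
  | zero =>
    have hKJ : K \ J = ∅ := (Set.ncard_eq_zero hfin).1 hN
    obtain rfl : J = K := hJK.antisymm (Set.sdiff_eq_empty.1 hKJ)
    rw [pow_zero, one_smul, sub_self]
    exact zero_mem _
  | succ N ih =>
    obtain ⟨k, hkK, hkJ⟩ : (K \ J).Nonempty := by
      rw [← Set.ncard_pos hfin]
      omega
    have hkKJ : k ∈ K \ J := ⟨hkK, hkJ⟩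
    have hset : (K \ {k}) \ J = (K \ J) \ {k} := sdiff_right_comm _ _ _
    have hcard : ((K \ {k}) \ J).ncard = N := by
      rw [hset, Set.ncard_sdiff_singleton_of_mem hkKJ, hN, Nat.add_sub_cancel]
    have hJk := ih (fun i hi => hK i hi.1) (Set.subset_sdiff_singleton hJK hkJ)
      (hset ▸ hfin.subset Set.sdiff_subset) hcard
    have hk := smul_mem_posSubsemiring (pow_mem X_mem_polyNonneg N)
      (normJucysMurphy_sdiff_singleton_sub_mem_posSubsemiring hK hkK)
    rw [smul_sub, smul_smul, ← pow_succ] at hk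
    rw [← sub_add_sub_cancel]
    exact add_mem hJk hk

/-! ### Norms at `ξ = 0` -/

theorem eval_nonneg_of_mem_polyNonneg {p : ℤ[X]} (hp : p ∈ polyNonneg) : 0 ≤ p.eval 0 := by
  rw [← coeff_zero_eq_eval_zero]
  exact hp 0

theorem eval_coeffT_normJucysMurphy_pos (hJ : ∀ i ∈ J, i + 1 < n) :
    0 < (coeffT (coxeterProd J n) (normJucysMurphy n J)).eval 0 := by
  have hpos := add_mem (relNorm_sub_self_mem_posSubsemiring (stdParabolic Set.univ) (stdParabolic J)
    (jucysMurphyProd_mem_posSubsemiring hJ)) (jucysMurphyProd_sub_mem_posSubsemiring hJ)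
  rw [sub_add_sub_cancel] at hpos
  have heval := eval_nonneg_of_mem_polyNonneg (hpos (coxeterProd J n))
  rw [map_sub, coeffT_T, if_pos rfl, eval_sub, eval_one] at heval
  rw [normJucysMurphy]
  omega

theorem eval_coeffT_relNorm_eq_zero (K U : Subgroup (Perm (Fin n)))
    (ha : ∀ w, IsConj w v → (coeffT w a).eval 0 = 0) :
    (coeffT v (relNorm K U a)).eval 0 = 0 := by
  classical
  rw [relNorm, map_sum, eval_finsetSum]
  refine Finset.sum_eq_zero fun d _ => ?_
  rw [eval_coeffT_mul_T, eval_coeffT_T_mul, inv_inv]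
  exact ha _ (isConj_iff.2 ⟨d⁻¹, by group⟩)

theorem eval_coeffT_normJucysMurphy_eq_zero (hJ : ∀ i ∈ J, i + 1 < n)
    (hv : ¬ IsConj v (coxeterProd J n)) : (coeffT v (normJucysMurphy n J)).eval 0 = 0 := by
  refine eval_coeffT_relNorm_eq_zero _ _ fun w hw => ?_
  rw [← relNorm_T_coxeterProd hJ]
  refine eval_coeffT_relNorm_eq_zero _ _ fun u hu => ?_
  rw [coeffT_T, if_neg, eval_zero]
  rintro rfl
  exact hv (hu.trans hw).symm
/-! ### Compositions and sets of simple reflections -/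

/-- The sums of the initial segments of `l`, the empty one and `l` itself included: the places where
the composition `l` is cut. -/
def partialSums (l : List ℕ) : Set ℕ := {s | ∃ k, (l.take k).sum = s}

theorem zero_mem_partialSums (l : List ℕ) : 0 ∈ partialSums l := ⟨0, by simp⟩

theorem sum_mem_partialSums (l : List ℕ) : l.sum ∈ partialSums l := ⟨l.length, by simp⟩

theorem le_sum_of_mem_partialSums {l : List ℕ} {s : ℕ} (h : s ∈ partialSums l) : s ≤ l.sum := by
  obtain ⟨k, rfl⟩ := h
  conv_rhs => rw [← List.take_append_drop k l, List.sum_append]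
  omega

theorem mem_partialSums_append {l l' : List ℕ} {s : ℕ} :
    s ∈ partialSums (l ++ l') ↔ s ∈ partialSums l ∨ ∃ t ∈ partialSums l', s = l.sum + t := by
  constructor
  · rintro ⟨k, rfl⟩
    rw [List.take_append, List.sum_append]
    rcases le_total k l.length with h | h
    · left
      exact ⟨k, by rw [Nat.sub_eq_zero_of_le h]; simp⟩
    · right
      exact ⟨_, ⟨k - l.length, rfl⟩, by rw [List.take_of_length_le h]⟩
  · rintro (⟨k, rfl⟩ | ⟨_, ⟨k, rfl⟩, rfl⟩)
    · refine ⟨min k l.length, ?_⟩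
      rw [List.take_append_of_le_length (min_le_right _ _), ← List.take_take, List.take_length]
    · exact ⟨l.length + k, by rw [List.take_length_add_append, List.sum_append]⟩

theorem mem_partialSums_nil {s : ℕ} : s ∈ partialSums [] ↔ s = 0 := by
  simp [partialSums, eq_comm]

theorem mem_partialSums_singleton {a s : ℕ} : s ∈ partialSums [a] ↔ s = 0 ∨ s = a := by
  constructor
  · rintro ⟨_ | k, rfl⟩ <;> simp
  · rintro (rfl | rfl)
    · exact zero_mem_partialSums _
    · simpa using sum_mem_partialSums [s]

theorem mem_partialSums_cons {a : ℕ} {l : List ℕ} {s : ℕ} :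
    s ∈ partialSums (a :: l) ↔ s = 0 ∨ ∃ t ∈ partialSums l, s = a + t := by
  rw [← List.singleton_append, mem_partialSums_append, mem_partialSums_singleton,
    List.sum_singleton]
  constructor
  · rintro ((h | h) | h)
    · exact Or.inl h
    · exact Or.inr ⟨0, zero_mem_partialSums l, h⟩
    · exact Or.inr h
  · rintro (h | h)
    · exact Or.inl (Or.inl h)
    · exact Or.inr h

theorem add_mem_partialSums_cons {a s : ℕ} {l : List ℕ} (ha : 0 < a) :
    a + s ∈ partialSums (a :: l) ↔ s ∈ partialSums l := by
  rw [mem_partialSums_cons]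
  constructor
  · rintro (h | ⟨t, ht, h⟩)
    · omega
    · rwa [Nat.add_left_cancel h]
  · exact fun h => Or.inr ⟨s, h, rfl⟩

theorem mem_partialSums_cons_self (a : ℕ) (l : List ℕ) : a ∈ partialSums (a :: l) :=
  mem_partialSums_cons.2 (Or.inr ⟨0, zero_mem_partialSums l, rfl⟩)

theorem eq_zero_or_le_of_mem_partialSums_cons {a s : ℕ} {l : List ℕ}
    (hs : s ∈ partialSums (a :: l)) : s = 0 ∨ a ≤ s := by
  rcases mem_partialSums_cons.1 hs with rfl | ⟨t, -, rfl⟩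
  · exact Or.inl rfl
  · exact Or.inr (Nat.le_add_right a t)

/-- The indices of the simple reflections in the parabolic subgroup of the composition `l`. As
positions count from `0`, the index `i` stands for the reflection straddling the place `i + 1`. -/
def innerIdx (l : List ℕ) : Set ℕ := {i | i + 1 < l.sum ∧ i + 1 ∉ partialSums l}

theorem lt_of_mem_innerIdx (ν : Composition n) : ∀ i ∈ innerIdx ν.blocks, i + 1 < n :=
    fun i hi => by
  have := hi.1
  rwa [ν.blocks_sum] at this

theorem isInner_iff (ν : Composition n) (i : Fin (n - 1)) :
    IsInner ν i ↔ (i : ℕ) ∈ innerIdx ν.blocks := by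
  constructor
  · rintro ⟨k, h1, h2⟩
    refine ⟨by rw [ν.blocks_sum]; omega, ?_⟩
    rintro ⟨m, hm⟩
    change ν.sizeUpTo m = _ at hm
    rcases Nat.lt_or_ge k m with h | h
    · have := ν.monotone_sizeUpTo (show k + 1 ≤ m from h)
      omega
    · have := ν.monotone_sizeUpTo h
      omega
  · rintro ⟨-, h⟩
    let j : Fin n := ⟨i + 1, by omega⟩
    refine ⟨ν.index j, lt_of_le_of_ne (ν.sizeUpTo_index_le j) fun e => h ⟨_, e⟩,
      ν.lt_sizeUpTo_index_succ j⟩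

theorem parabolic_eq_stdParabolic (ν : Composition n) :
    parabolic ν = stdParabolic (innerIdx ν.blocks) := by
  unfold parabolic stdParabolic
  congr 1
  ext s
  constructor
  · rintro ⟨i, hi, rfl⟩
    exact ⟨i, (isInner_iff ν i).1 hi, simpleRefl_eq_swapSucc i⟩
  · rintro ⟨i, hi, rfl⟩
    have := lt_of_mem_innerIdx ν i hi
    exact ⟨⟨i, by omega⟩, (isInner_iff ν _).2 hi, (simpleRefl_eq_swapSucc (n := n)
      ⟨i, by omega⟩).symm⟩

theorem mem_or_succ_mem_partialSums_cons {a s : ℕ} {l : List ℕ} :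
    s ∈ partialSums (a :: l) ∨ s + 1 ∈ partialSums (a :: l) ↔
      s = 0 ∨ s + 1 = a ∨ ∃ t, (t ∈ partialSums l ∨ t + 1 ∈ partialSums l) ∧ s = a + t := by
  rw [mem_partialSums_cons, mem_partialSums_cons]
  constructor
  · rintro ((h | ⟨t, ht, h⟩) | (h | ⟨t, ht, h⟩))
    · exact Or.inl h
    · exact Or.inr (Or.inr ⟨t, Or.inl ht, h⟩)
    · omega
    · rcases t with _ | t
      · exact Or.inr (Or.inl h)
      · exact Or.inr (Or.inr ⟨t, Or.inr ht, by omega⟩)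
  · rintro (h | h | ⟨t, ht | ht, h⟩)
    · exact Or.inl (Or.inl h)
    · exact Or.inr (Or.inr ⟨0, zero_mem_partialSums l, h⟩)
    · exact Or.inl (Or.inr ⟨t, ht, h⟩)
    · exact Or.inr (Or.inr ⟨t + 1, ht, by omega⟩)

theorem mem_partialSums_ite_sub_one {a s : ℕ} (ha : 0 < a) :
    s ∈ partialSums (if 1 < a then [a - 1, 1] else [a]) ↔ s = 0 ∨ s + 1 = a ∨ s = a := by
  split_ifs with h
  · simp only [mem_partialSums_cons, mem_partialSums_nil, exists_eq_left, exists_eq_or_imp]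
    omega
  · rw [mem_partialSums_singleton]
    omega

theorem mem_partialSums_subOne {l : List ℕ} (hl : ∀ x ∈ l, 0 < x) {s : ℕ} :
    s ∈ partialSums (l.flatMap fun k => if 1 < k then [k - 1, 1] else [k]) ↔
      s ∈ partialSums l ∨ s + 1 ∈ partialSums l := by
  induction l generalizing s with
  | nil => simp [mem_partialSums_nil]
  | cons a l ih =>
    have ha : 0 < a := hl a List.mem_cons_self
    have hsum : (if 1 < a then [a - 1, 1] else [a]).sum = a := by
      split_ifs <;> simp
      omega
    rw [List.flatMap_cons, mem_partialSums_append, mem_partialSums_ite_sub_one ha, hsum,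
      mem_or_succ_mem_partialSums_cons]
    simp only [ih fun x hx => hl x (List.mem_cons_of_mem a hx)]
    constructor
    · rintro ((h | h | h) | h)
      exacts [Or.inl h, Or.inr (Or.inl h),
        Or.inr (Or.inr ⟨0, Or.inl (zero_mem_partialSums l), h⟩), Or.inr (Or.inr h)]
    · rintro (h | h | h)
      exacts [Or.inl (Or.inl h), Or.inl (Or.inr (Or.inl h)), Or.inr h]

theorem innerIdx_subOne (ν : Composition n) :
    innerIdx (subOne ν).blocks = shrink (innerIdx ν.blocks) n := by
  have hn : n ∈ partialSums ν.blocks := by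
    simpa only [ν.blocks_sum] using sum_mem_partialSums ν.blocks
  ext i
  have hmem : i + 1 ∈ partialSums (subOne ν).blocks ↔ _ :=
    mem_partialSums_subOne fun x hx => ν.blocks_pos hx
  simp only [innerIdx, shrink, Set.mem_ofPred_eq, Composition.blocks_sum, hmem, not_or]
  constructor
  · rintro ⟨hi, hi₁, hi₂⟩
    have : i + 1 + 1 ≠ n := fun e => hi₂ (e ▸ hn)
    exact ⟨⟨hi, hi₁⟩, ⟨by omega, hi₂⟩, hi⟩
  · rintro ⟨⟨hi, hi₁⟩, ⟨-, hi₂⟩, -⟩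
    exact ⟨hi, hi₁, hi₂⟩

open Classical in
theorem coxeterProd_eq_prod (J : Set ℕ) (m : ℕ) :
    (coxeterProd J m : Perm (Fin n)) = (((List.range m).filter (· ∈ J)).map swapSucc).prod := by
  induction m with
  | zero => rfl
  | succ m ih =>
    rw [List.range_succ, List.filter_append, List.map_append, List.prod_append, ← ih]
    by_cases h : m ∈ J
    · rw [coxeterProd_succ_of_mem h]
      simp [h]
    · rw [coxeterProd_succ_of_notMem h]
      simp [h]

theorem coxeterProd_pred (hJ : ∀ i ∈ J, i + 1 < n) :
    (coxeterProd J (n - 1) : Perm (Fin n)) = coxeterProd J n := by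
  rcases n with _ | n
  · rfl
  · exact (coxeterProd_succ_of_notMem fun h => (hJ n h).ne rfl).symm

theorem coxeterElt_eq (ν : Composition n) : coxeterElt ν = coxeterProd (innerIdx ν.blocks) n := by
  classical
  have hrefl : (simpleRefl : Fin (n - 1) → Perm (Fin n)) = swapSucc ∘ Fin.val :=
    funext simpleRefl_eq_swapSucc
  rw [← coxeterProd_pred (lt_of_mem_innerIdx ν), coxeterProd_eq_prod,
    ← List.map_coe_finRange_eq_range, List.filter_map, List.map_map, coxeterElt, wordProd, hrefl]
  congr 2
  exact List.filter_congr fun i _ => by simp [isInner_iff]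

theorem normElt_eq (ν : Composition n) : normElt ν = normJucysMurphy n (innerIdx ν.blocks) := by
  rw [normElt, eta, parabolic_eq_stdParabolic, parabolic_eq_stdParabolic, innerIdx_subOne,
    coxeterElt_eq, normJucysMurphy,
    stdParabolic_univ, ← relNorm_T_coxeterProd (lt_of_mem_innerIdx ν), stdParabolic_empty]

open Classical in
theorem len_coxeterProd (hJ : ∀ i ∈ J, i + 1 < n) (m : ℕ) :
    len (coxeterProd J m : Perm (Fin n)) = ((Finset.range m).filter (· ∈ J)).card := by
  induction m with
  | zero => exact len_one
  | succ m ih =>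
    rw [Finset.range_add_one, Finset.filter_insert]
    split_ifs with h
    · have hm : IsAscent (coxeterProd J m : Perm (Fin n)) m :=
        isAscent_of_mem_stdParabolic (coxeterProd_mem_stdParabolic J m)
          (fun hm => lt_irrefl m hm.2) (hJ m h)
      rw [coxeterProd_succ_of_mem h, hm.len_mul_swapSucc, ih,
        Finset.card_insert_of_notMem (by simp)]
    · rw [coxeterProd_succ_of_notMem h, ih]

theorem finite_innerIdx (ν : Composition n) : (innerIdx ν.blocks).Finite :=
  (Set.finite_lt_nat n).subset fun i hi => by
    have := lt_of_mem_innerIdx ν i hi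
    simp only [Set.mem_ofPred_eq]
    omega

theorem minLen_eq (ν : Composition n) : minLen ν = (innerIdx ν.blocks).ncard := by
  classical
  rw [minLen, coxeterElt_eq, len_coxeterProd (lt_of_mem_innerIdx ν), ← Set.ncard_coe_finset]
  congr 1
  ext i
  have := lt_of_mem_innerIdx ν i
  simp only [Finset.coe_filter, Finset.mem_range, Set.mem_ofPred_eq]
  exact ⟨fun h => h.2, fun h => ⟨by have := this h; omega, h⟩⟩

theorem partialSums_map_sum_subset (L : List (List ℕ)) :
    partialSums (L.map List.sum) ⊆ partialSums L.flatten := by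
  induction L with
  | nil => exact le_rfl
  | cons a L ih =>
    intro s hs
    rw [List.map_cons, mem_partialSums_cons] at hs
    rw [List.flatten_cons, mem_partialSums_append]
    rcases hs with rfl | ⟨t, ht, rfl⟩
    · exact Or.inl (zero_mem_partialSums a)
    · exact Or.inr ⟨t, ih ht, rfl⟩

theorem Refines.innerIdx_subset {μ ν : Composition n} (h : Refines μ ν) :
    innerIdx μ.blocks ⊆ innerIdx ν.blocks := by
  obtain ⟨L, hflatten, hsums⟩ := h
  rintro i ⟨hi, hcut⟩
  refine ⟨by rwa [ν.blocks_sum, ← μ.blocks_sum], fun h => hcut ?_⟩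
  rw [← hsums] at h
  rw [← hflatten]
  exact partialSums_map_sum_subset L h

theorem partialSums_cons_ne_nil {a : ℕ} (ha : 0 < a) (l : List ℕ) :
    partialSums (a :: l) ≠ partialSums [] := fun h =>
  ha.ne' (mem_partialSums_nil.1 (h ▸ mem_partialSums_cons_self a l))

theorem partialSums_injective {l l' : List ℕ} (hl : ∀ x ∈ l, 0 < x) (hl' : ∀ x ∈ l', 0 < x)
    (h : partialSums l = partialSums l') : l = l' := by
  induction l generalizing l' with
  | nil =>
    rcases l' with _ | ⟨b, l'⟩
    · rfl
    · exact absurd h.symm (partialSums_cons_ne_nil (hl' b List.mem_cons_self) l')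
  | cons a l ih =>
    have ha := hl a List.mem_cons_self
    rcases l' with _ | ⟨b, l'⟩
    · exact absurd h (partialSums_cons_ne_nil ha l)
    · have hb := hl' b List.mem_cons_self
      have hba := eq_zero_or_le_of_mem_partialSums_cons (h ▸ mem_partialSums_cons_self a l)
      have hab := eq_zero_or_le_of_mem_partialSums_cons (h.symm ▸ mem_partialSums_cons_self b l')
      obtain rfl : a = b := by omega
      congr 1
      refine ih (fun x hx => hl x (List.mem_cons_of_mem a hx))
        (fun x hx => hl' x (List.mem_cons_of_mem a hx)) (Set.ext fun s => ?_)
      rw [← add_mem_partialSums_cons ha, h, add_mem_partialSums_cons ha]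

theorem mem_partialSums_blocks_iff (ν : Composition n) {s : ℕ} :
    s ∈ partialSums ν.blocks ↔ s = 0 ∨ s = n ∨ s < n ∧ s - 1 ∉ innerIdx ν.blocks := by
  have hn := sum_mem_partialSums ν.blocks
  have hle := le_sum_of_mem_partialSums (l := ν.blocks) (s := s)
  simp only [innerIdx, Set.mem_ofPred_eq, Composition.blocks_sum, not_and, not_not] at hn hle ⊢
  constructor
  · intro hs
    rcases s with _ | s
    · exact Or.inl rfl
    · rcases (hle hs).eq_or_lt with h | h
      exacts [Or.inr (Or.inl h), Or.inr (Or.inr ⟨h, fun _ => hs⟩)]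
  · rintro (rfl | rfl | ⟨h, hs⟩)
    · exact zero_mem_partialSums _
    · exact hn
    · rcases s with _ | s
      exacts [zero_mem_partialSums _, hs h]

theorem innerIdx_injective {μ ν : Composition n} (h : innerIdx μ.blocks = innerIdx ν.blocks) :
    μ = ν :=
  Composition.ext <| partialSums_injective (fun _ hx => μ.blocks_pos hx)
    (fun _ hx => ν.blocks_pos hx) <| Set.ext fun s => by
      rw [mem_partialSums_blocks_iff, mem_partialSums_blocks_iff, h]

theorem exists_innerIdx_eq (hJ : ∀ i ∈ J, i + 1 < n) :
    ∃ ν : Composition n, innerIdx ν.blocks = J := by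
  have hext : ∀ {J J' : Set ℕ}, (∀ i ∈ J, i + 1 < n) → (∀ i ∈ J', i + 1 < n) →
      {i : Fin (n - 1) | (i : ℕ) ∈ J} = {i : Fin (n - 1) | (i : ℕ) ∈ J'} → J = J' := by
    intro J J' hJ hJ' h
    ext i
    constructor <;> intro hi
    · exact (Set.ext_iff.1 h ⟨i, by have := hJ i hi; omega⟩).1 hi
    · exact (Set.ext_iff.1 h ⟨i, by have := hJ' i hi; omega⟩).2 hi
  let f : Composition n → Set (Fin (n - 1)) := fun ν => {i | (i : ℕ) ∈ innerIdx ν.blocks}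
  have hf : Function.Injective f := fun μ ν h =>
    innerIdx_injective (hext (lt_of_mem_innerIdx μ) (lt_of_mem_innerIdx ν) h)
  have hf' : Function.Bijective f := by
    rw [Fintype.bijective_iff_injective_and_card]
    exact ⟨hf, by rw [composition_card, Fintype.card_set, Fintype.card_fin]⟩
  obtain ⟨ν, hν⟩ := hf'.2 {i | (i : ℕ) ∈ J}
  exact ⟨ν, hext (lt_of_mem_innerIdx ν) hJ hν⟩

/-! ### Rearranging the blocks of a composition -/

theorem mem_partialSums_append_cons_cons {l l' : List ℕ} {a b s : ℕ} :
    s ∈ partialSums (l ++ a :: b :: l') ↔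
      s ∈ partialSums l ∨ s = l.sum + a ∨ ∃ u ∈ partialSums l', s = l.sum + a + b + u := by
  simp only [mem_partialSums_append, mem_partialSums_cons]
  constructor
  · rintro (h | ⟨t, rfl | ⟨u, rfl | ⟨v, hv, rfl⟩, rfl⟩, rfl⟩)
    · exact Or.inl h
    · exact Or.inl (sum_mem_partialSums l)
    · exact Or.inr (Or.inl rfl)
    · exact Or.inr (Or.inr ⟨v, hv, by omega⟩)
  · rintro (h | rfl | ⟨u, hu, rfl⟩)
    · exact Or.inl h
    · exact Or.inr ⟨a, Or.inr ⟨0, Or.inl rfl, rfl⟩, rfl⟩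
    · exact Or.inr ⟨a + (b + u), Or.inr ⟨b + u, Or.inr ⟨u, hu, rfl⟩, rfl⟩, by omega⟩

theorem mem_innerIdx_append_cons_cons {l l' : List ℕ} {a b i : ℕ} :
    i ∈ innerIdx (l ++ a :: b :: l') ↔ i + 1 < l.sum + a + b + l'.sum ∧ i + 1 ∉ partialSums l ∧
      i + 1 ≠ l.sum + a ∧ ∀ u ∈ partialSums l', i + 1 ≠ l.sum + a + b + u := by
  simp only [innerIdx, Set.mem_ofPred_eq, mem_partialSums_append_cons_cons, not_or, not_exists,
    not_and, ne_eq, List.sum_append, List.sum_cons, add_assoc]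

theorem blocksSwapped_innerIdx (l l' : List ℕ) {a b : ℕ} (ha : 0 < a) (hb : 0 < b)
    (hn : l.sum + a + b + l'.sum = n) :
    BlocksSwapped (innerIdx (l ++ a :: b :: l')) (innerIdx (l ++ b :: a :: l')) n l.sum a b := by
  have hl : ∀ {s}, s ∈ partialSums l → s ≤ l.sum := le_sum_of_mem_partialSums
  have hsum := sum_mem_partialSums l
  have hzero := zero_mem_partialSums l'
  refine ⟨by omega, fun i hi => ?_, fun i hi => ?_, fun i hi => ?_, fun i hi => ?_,
    fun i hi => ?_, fun i hi e => ?_, fun i hi e => ?_, fun i hi e => ?_⟩ <;>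
    simp only [mem_innerIdx_append_cons_cons, add_right_comm l.sum b a, hn] at hi ⊢
  · exact hi.1
  · exact and_congr_right fun _ => and_congr_right fun _ =>
      and_congr_left fun _ => ⟨fun _ => by omega, fun _ => by omega⟩
  · exact and_congr_right fun _ => and_congr_right fun _ =>
      and_congr_left fun _ => ⟨fun _ => by omega, fun _ => by omega⟩
  · exact ⟨fun h => ⟨by omega, fun h' => by have := hl h'; omega, by omega, fun u _ => by omega⟩,
      fun h => have := h.2.2.2 0 hzero
        ⟨by omega, fun h' => by have := hl h'; omega, by omega, fun u _ => by omega⟩⟩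
  · exact ⟨fun h => have := h.2.2.2 0 hzero
        ⟨by omega, fun h' => by have := hl h'; omega, by omega, fun u _ => by omega⟩,
      fun h => ⟨by omega, fun h' => by have := hl h'; omega, by omega, fun u _ => by omega⟩⟩
  · exact hi.2.1 (e ▸ hsum)
  · exact hi.2.2.1 e
  · exact hi.2.2.2 0 hzero e

theorem rel_innerIdx_of_perm {R : Set ℕ → Set ℕ → Prop} (hrefl : ∀ J, R J J)
    (htrans : ∀ J J' J'', R J J' → R J' J'' → R J J'')
    (hswap : ∀ J J' p a b, BlocksSwapped J J' n p a b → R J J')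
    {l l' : List ℕ} (h : l.Perm l') (hpos : ∀ x ∈ l, 0 < x) (l₀ : List ℕ)
    (hn : (l₀ ++ l).sum = n) : R (innerIdx (l₀ ++ l)) (innerIdx (l₀ ++ l')) := by
  induction h generalizing l₀ with
  | nil => exact hrefl _
  | cons a _ ih =>
    have := ih (fun x hx => hpos x (by simp [hx])) (l₀ ++ [a]) (by simpa using hn)
    simpa using this
  | swap a b l =>
    refine hswap _ _ _ _ _ (blocksSwapped_innerIdx l₀ l (hpos b (by simp)) (hpos a (by simp)) ?_)
    simpa [add_assoc] using hn
  | trans h _ ih ih' =>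
    refine htrans _ _ _ (ih hpos l₀ hn) (ih' (fun x hx => hpos x (h.mem_iff.2 hx)) l₀ ?_)
    rw [← hn, List.sum_append, List.sum_append, h.sum_eq]

/-! ### The anti-automorphism fixing the generators -/

theorem isBraided_op_gen (n : ℕ) : IsBraided fun i : Fin (n - 1) => MulOpposite.op (gen i) where
  commute i j h := ((isBraided_gen n).commute i j h).op
  braid i j h := by
    simp only [← MulOpposite.op_mul, ← mul_assoc, (isBraided_gen n).braid i j h]

/-- The anti-automorphism of the Hecke algebra fixing the generators. -/
noncomputable def antiAut (n : ℕ) : Hecke n →ₐ[ℤ[X]] (Hecke n)ᵐᵒᵖ :=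
  heckeLift (fun i => MulOpposite.op (gen i)) (isBraided_op_gen n) fun i => by
    rw [← MulOpposite.op_mul, gen_eq_Ts, Ts_mul_self (by omega), MulOpposite.op_add,
      MulOpposite.op_one, MulOpposite.op_smul]

theorem antiAut_Ts (i : ℕ) : antiAut n (Ts i) = MulOpposite.op (Ts i) := by
  by_cases hi : i + 1 < n
  · rw [antiAut, heckeLift_Ts _ _ hi, gen_eq_Ts]
  · rw [Ts_of_le (by omega), map_one, MulOpposite.op_one]

theorem antiAut_T (w : Perm (Fin n)) : antiAut n (T w) = MulOpposite.op (T w⁻¹) := by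
  induction w using mul_swapSucc_induction with
  | one => rw [T_one, inv_one, T_one, map_one, MulOpposite.op_one]
  | mul_swapSucc w i hi ih =>
    have hi' : IsAscent w⁻¹⁻¹ i := by rwa [inv_inv]
    rw [hi.T_mul_swapSucc, map_mul, ih, antiAut_Ts, ← MulOpposite.op_mul, mul_inv_rev,
      swapSucc_inv, hi'.T_swapSucc_mul]

theorem T_inv_mul_T_inv_of_mul_eq (h : T u * T v = T w * T d) :
    T v⁻¹ * T u⁻¹ = T d⁻¹ * T w⁻¹ := by
  have := congrArg (antiAut n) h
  simpa only [map_mul, antiAut_T, ← MulOpposite.op_mul, MulOpposite.op_inj] using this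

theorem isUnit_Ts (i : ℕ) : IsUnit (Ts i : Hecke n) := by
  by_cases hi : i + 1 < n
  · refine isUnit_iff_exists.2 ⟨Ts i - (X : ℤ[X]) • 1, ?_, ?_⟩
    · rw [mul_sub, Ts_mul_self hi, mul_smul_comm, mul_one, add_sub_cancel_right]
    · rw [sub_mul, Ts_mul_self hi, smul_mul_assoc, one_mul, add_sub_cancel_right]
  · rw [Ts_of_le (by omega)]
    exact isUnit_one

theorem isUnit_T (w : Perm (Fin n)) : IsUnit (T w) := by
  induction w using mul_swapSucc_induction with
  | one => exact T_one (n := n) ▸ isUnit_one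
  | mul_swapSucc w i hi ih => exact hi.T_mul_swapSucc ▸ ih.mul (isUnit_Ts i)

/-! ### Central elements -/

theorem commute_of_mem_center (hz : z ∈ Subalgebra.center ℤ[X] (Hecke n)) (a : Hecke n) :
    Commute a z :=
  Subalgebra.mem_center_iff.1 hz a

theorem mem_center_iff_forall_commute_Ts :
    z ∈ Subalgebra.center ℤ[X] (Hecke n) ↔ ∀ k, Commute (Ts k) z := by
  refine ⟨fun hz k => commute_of_mem_center hz _, fun h => Subalgebra.mem_center_iff.2 fun a => ?_⟩
  have hT : ∀ w : Perm (Fin n), Commute (T w) z := fun w =>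
    commute_T_of_mem_stdParabolic (J := Set.univ) (fun k _ => h k)
      (by rw [stdParabolic_univ]; exact Subgroup.mem_top w)
  rw [← sum_coeffT a]
  exact Commute.sum_left _ _ _ fun w _ => (hT w).smul_left _

/-- The permutations `v` and `w` have the same coefficient in every central element. -/
def EqOnCenter (v w : Perm (Fin n)) : Prop :=
  ∀ z ∈ Subalgebra.center ℤ[X] (Hecke n), coeffT v z = coeffT w z

theorem eqOnCenter_of_T_mul_eq (h : T w * T u = T u * T v) : EqOnCenter w v := fun z hz => by
  obtain ⟨y, huy, hyu⟩ := isUnit_iff_exists.1 (isUnit_T u⁻¹)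
  have hinv : T u⁻¹ * T w⁻¹ = T v⁻¹ * T u⁻¹ := T_inv_mul_T_inv_of_mul_eq h
  calc coeffT w z = coeffT 1 (z * (y * (T u⁻¹ * T w⁻¹))) := by
        rw [coeffT_eq_coeffT_one, ← mul_assoc y, hyu, one_mul]
    _ = coeffT 1 (y * (z * (T v⁻¹ * T u⁻¹))) := by
        rw [hinv, ← mul_assoc, ← (commute_of_mem_center hz y).eq, mul_assoc]
    _ = coeffT 1 (z * T v⁻¹) := by
        rw [coeffT_one_mul_comm, mul_assoc, mul_assoc, huy, mul_one]
    _ = coeffT v z := (coeffT_eq_coeffT_one v z).symm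

theorem eval_coeffT_eq_of_isConj (hz : z ∈ Subalgebra.center ℤ[X] (Hecke n)) (h : IsConj w v) :
    (coeffT w z).eval 0 = (coeffT v z).eval 0 := by
  obtain ⟨u, rfl⟩ := isConj_iff.1 h
  have hu := congrArg (fun a => (coeffT (u * w) a).eval 0) (commute_of_mem_center hz (T u)).eq
  simpa only [eval_coeffT_T_mul, eval_coeffT_mul_T, inv_mul_cancel_left] using hu

/-! ### Conjugacy classes -/

/-- The cycle type of a permutation, as a partition of `n`. -/
def cycleClass (w : Perm (Fin n)) : n.Partition where
  parts := w.partition.parts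
  parts_pos := w.partition.parts_pos
  parts_sum := by rw [w.partition.parts_sum, Fintype.card_fin]

theorem inClass_iff {ν : n.Partition} : InClass ν w ↔ cycleClass w = ν := by
  rw [Nat.Partition.ext_iff]
  rfl

theorem cycleClass_eq_iff : cycleClass w = cycleClass v ↔ IsConj w v := by
  rw [Equiv.Perm.partition_eq_of_isConj, Nat.Partition.ext_iff, Nat.Partition.ext_iff]
  rfl

theorem filter_parts_eq_replicate (ν : n.Partition) :
    ν.parts.filter (¬ 2 ≤ ·) = Multiset.replicate (ν.parts.filter (¬ 2 ≤ ·)).card 1 := by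
  refine Multiset.eq_replicate_card.2 fun a ha => ?_
  obtain ⟨ha, ha₂⟩ := Multiset.mem_filter.1 ha
  have := ν.parts_pos ha
  omega

theorem cycleClass_surjective : Function.Surjective (cycleClass (n := n)) := by
  intro ν
  have hsum : (ν.parts.filter (2 ≤ ·)).sum + (ν.parts.filter (¬ 2 ≤ ·)).card = n := by
    have hones : (ν.parts.filter (¬ 2 ≤ ·)).sum = (ν.parts.filter (¬ 2 ≤ ·)).card := by
      conv_lhs => rw [filter_parts_eq_replicate]
      simp
    rw [← hones, ← Multiset.sum_add, Multiset.filter_add_not, ν.parts_sum]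
  obtain ⟨w, hw⟩ := (Equiv.Perm.exists_with_cycleType_iff (Fin n) (m := ν.parts.filter (2 ≤ ·))).2
    ⟨by rw [Fintype.card_fin]; omega, fun a ha => (Multiset.mem_filter.1 ha).2⟩
  have hfix : n - (ν.parts.filter (2 ≤ ·)).sum = (ν.parts.filter (¬ 2 ≤ ·)).card := by omega
  refine ⟨w, Nat.Partition.ext ?_⟩
  calc w.partition.parts
      = ν.parts.filter (2 ≤ ·) + Multiset.replicate (ν.parts.filter (¬ 2 ≤ ·)).card 1 := by
        rw [Equiv.Perm.parts_partition, ← Equiv.Perm.sum_cycleType, hw, Fintype.card_fin, hfix]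
    _ = ν.parts := by rw [← filter_parts_eq_replicate, Multiset.filter_add_not]

theorem isConj_mul_swapSucc (w : Perm (Fin n)) (i : ℕ) :
    IsConj (w * swapSucc i) (swapSucc i * w) :=
  isConj_iff.2 ⟨swapSucc i, by rw [swapSucc_inv, ← mul_assoc, mul_swapSucc_mul_swapSucc]⟩

theorem exists_isConj_coxeterProd (w : Perm (Fin n)) : ∃ c : Composition n,
    IsConj w (coxeterProd (innerIdx c.blocks) n) ∧
      (IsShortest w → EqOnCenter w (coxeterProd (innerIdx c.blocks) n)) := by
  refine IsShiftClosed.of_mem_stdParabolic (K := Set.univ)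
    (Q := fun w => ∃ c : Composition n, IsConj w (coxeterProd (innerIdx c.blocks) n) ∧
      (IsShortest w → EqOnCenter w (coxeterProd (innerIdx c.blocks) n)))
    ⟨fun v i _ hv hv' ⟨c, hc, hshort⟩ => ?_, fun v i _ hv hv' ⟨c, hc, _⟩ _ => ?_⟩
    (fun J _ hJ => ?_) (by rw [stdParabolic_univ]; exact Subgroup.mem_top w)
  · have hconj := isConj_mul_swapSucc v i
    refine ⟨c, hconj.trans hc, fun hs z hz => ?_⟩
    rw [coeffT_mul_swapSucc_of_commute (commute_of_mem_center hz _) hv hv']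
    refine hshort (fun x hx => ?_) z hz
    rw [hv'.len_swapSucc_mul, ← hv.len_mul_swapSucc]
    exact hs x (hx.trans hconj.symm)
  · have hconj := isConj_mul_swapSucc v i
    refine ⟨c, hconj.trans hc, fun hs => absurd (hs _ hconj.symm) ?_⟩
    rw [hv.len_mul_swapSucc, hv'.len_eq_left]
    omega
  · obtain ⟨c, rfl⟩ := exists_innerIdx_eq hJ
    exact ⟨c, IsConj.refl _, fun _ _ _ => rfl⟩

theorem isConj_coxeterProd_of_perm {c c' : Composition n} (h : c.blocks.Perm c'.blocks) :
    IsConj (coxeterProd (innerIdx c.blocks) n : Perm (Fin n))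
      (coxeterProd (innerIdx c'.blocks) n) :=
  rel_innerIdx_of_perm (R := fun J J' => IsConj (coxeterProd J n : Perm (Fin n)) (coxeterProd J' n))
    (fun _ => IsConj.refl _) (fun _ _ _ h h' => h.trans h')
    (fun _ _ _ _ _ h => h.isConj_coxeterProd) h (fun _ hx => c.blocks_pos hx) [] (by simp)

theorem eqOnCenter_coxeterProd_of_perm {c c' : Composition n} (h : c.blocks.Perm c'.blocks) :
    EqOnCenter (coxeterProd (innerIdx c.blocks) n : Perm (Fin n))
      (coxeterProd (innerIdx c'.blocks) n) :=
  rel_innerIdx_of_perm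
    (R := fun J J' => EqOnCenter (coxeterProd J n : Perm (Fin n)) (coxeterProd J' n))
    (fun _ _ _ => rfl) (fun _ _ _ h h' z hz => (h z hz).trans (h' z hz))
    (fun _ _ _ _ _ h => eqOnCenter_of_T_mul_eq h.T_coxeterProd_mul) h
    (fun _ hx => c.blocks_pos hx) [] (by simp)

/- Partitions of `n` index both the compositions up to rearrangement and the conjugacy classes,
and every class contains some `w_c`, so by counting distinct partitions give distinct classes. -/
theorem perm_of_isConj_coxeterProd {c c' : Composition n}
    (h : IsConj (coxeterProd (innerIdx c.blocks) n : Perm (Fin n))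
      (coxeterProd (innerIdx c'.blocks) n)) :
    c.blocks.Perm c'.blocks := by
  choose comp hcomp using Nat.Partition.ofComposition_surj (n := n)
  let φ : n.Partition → n.Partition := fun ν =>
    cycleClass (coxeterProd (innerIdx (comp ν).blocks) n)
  have hφ : ∀ c : Composition n, φ (Nat.Partition.ofComposition n c) =
      cycleClass (coxeterProd (innerIdx c.blocks) n) := fun c =>
    cycleClass_eq_iff.2 (isConj_coxeterProd_of_perm (Multiset.coe_eq_coe.1
      (congrArg Nat.Partition.parts (hcomp (Nat.Partition.ofComposition n c)))))
  have hsurj : Function.Surjective φ := by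
    intro ν
    obtain ⟨w, rfl⟩ := cycleClass_surjective ν
    obtain ⟨c, hc, -⟩ := exists_isConj_coxeterProd w
    exact ⟨Nat.Partition.ofComposition n c, (hφ c).trans (cycleClass_eq_iff.2 hc.symm)⟩
  refine Multiset.coe_eq_coe.1 (congrArg Nat.Partition.parts
    (Finite.injective_iff_surjective.2 hsurj (a₁ := Nat.Partition.ofComposition n c)
      (a₂ := Nat.Partition.ofComposition n c') ?_))
  rw [hφ, hφ, cycleClass_eq_iff.2 h]

theorem exists_cycleClass_coxeterProd (ν : n.Partition) :
    ∃ c : Composition n, cycleClass (coxeterProd (innerIdx c.blocks) n) = ν := by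
  obtain ⟨w, rfl⟩ := cycleClass_surjective ν
  obtain ⟨c, hc, -⟩ := exists_isConj_coxeterProd w
  exact ⟨c, cycleClass_eq_iff.2 hc.symm⟩

/-- A composition whose Coxeter element has cycle type `ν`. -/
noncomputable def classComp (ν : n.Partition) : Composition n :=
  (exists_cycleClass_coxeterProd ν).choose

/-- The Coxeter element of `classComp ν`, representing the class of `ν`. -/
noncomputable def classRep (ν : n.Partition) : Perm (Fin n) :=
  coxeterProd (innerIdx (classComp ν).blocks) n

@[simp]
theorem cycleClass_classRep (ν : n.Partition) : cycleClass (classRep ν) = ν :=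
  (exists_cycleClass_coxeterProd ν).choose_spec

theorem isConj_classRep (w : Perm (Fin n)) : IsConj w (classRep (cycleClass w)) :=
  cycleClass_eq_iff.1 (cycleClass_classRep _).symm

theorem eqOnCenter_coxeterProd_classRep (hJ : ∀ i ∈ J, i + 1 < n) :
    EqOnCenter (coxeterProd J n : Perm (Fin n)) (classRep (cycleClass (coxeterProd J n))) := by
  obtain ⟨c, rfl⟩ := exists_innerIdx_eq hJ
  exact eqOnCenter_coxeterProd_of_perm (perm_of_isConj_coxeterProd (isConj_classRep _))

theorem eqOnCenter_classRep_of_isShortest (hw : IsShortest w) :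
    EqOnCenter w (classRep (cycleClass w)) := fun z hz => by
  obtain ⟨c, hc, h⟩ := exists_isConj_coxeterProd w
  rw [h hw z hz, eqOnCenter_coxeterProd_classRep (lt_of_mem_innerIdx c) z hz,
    cycleClass_eq_iff.2 hc]

theorem exists_isShortest (ν : n.Partition) :
    ∃ w : Perm (Fin n), IsShortest w ∧ cycleClass w = ν := by
  obtain ⟨w, hw, hmin⟩ := Set.exists_min_image {w : Perm (Fin n) | cycleClass w = ν} len
    (Set.toFinite _) (cycleClass_surjective ν)
  have hwν : cycleClass w = ν := hw
  exact ⟨w, fun v hv => hmin v ((cycleClass_eq_iff.2 hv).trans hwν), hwν⟩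

/-! ### Class polynomials -/

theorem exists_coeffT_eq_sum (w : Perm (Fin n)) : ∃ p : n.Partition → ℤ[X],
    ∀ z ∈ Subalgebra.center ℤ[X] (Hecke n), coeffT w z = ∑ ν, p ν * coeffT (classRep ν) z := by
  refine IsShiftClosed.of_mem_stdParabolic (K := Set.univ)
    (Q := fun w => ∃ p : n.Partition → ℤ[X], ∀ z ∈ Subalgebra.center ℤ[X] (Hecke n),
      coeffT w z = ∑ ν, p ν * coeffT (classRep ν) z)
    ⟨fun v i _ hv hv' ⟨p, hp⟩ => ⟨p, fun z hz => ?_⟩,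
      fun v i _ hv hv' ⟨p, hp⟩ ⟨q, hq⟩ => ⟨p + (X : ℤ[X]) • q, fun z hz => ?_⟩⟩
    (fun J _ hJ => ⟨Pi.single (cycleClass (coxeterProd J n)) 1, fun z hz => ?_⟩)
    (by rw [stdParabolic_univ]; exact Subgroup.mem_top w)
  · rw [coeffT_mul_swapSucc_of_commute (commute_of_mem_center hz _) hv hv', hp z hz]
  · rw [coeffT_mul_swapSucc_of_commute_of_isDescent (commute_of_mem_center hz _) hv hv', hp z hz,
      hq z hz, Finset.mul_sum, ← Finset.sum_add_distrib]
    simp only [Pi.add_apply, Pi.smul_apply, smul_eq_mul, add_mul, mul_assoc]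
  · rw [eqOnCenter_coxeterProd_classRep hJ z hz]
    simp [Pi.single_apply]

/-- The class polynomials of Geck and Pfeiffer: the coefficients expressing the coefficient at `w`
of a central element through its coefficients at the class representatives. -/
noncomputable def classPolynomial (w : Perm (Fin n)) : n.Partition → ℤ[X] :=
  (exists_coeffT_eq_sum w).choose

theorem coeffT_eq_sum_classPolynomial (hz : z ∈ Subalgebra.center ℤ[X] (Hecke n))
    (w : Perm (Fin n)) : coeffT w z = ∑ ν, classPolynomial w ν * coeffT (classRep ν) z :=
  (exists_coeffT_eq_sum w).choose_spec z hz

theorem eq_of_coeffT_classRep {y : Hecke n} (hy : y ∈ Subalgebra.center ℤ[X] (Hecke n))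
    (hz : z ∈ Subalgebra.center ℤ[X] (Hecke n))
    (h : ∀ ν, coeffT (classRep ν) y = coeffT (classRep ν) z) : y = z :=
  ext_coeffT fun w => by
    rw [coeffT_eq_sum_classPolynomial hy, coeffT_eq_sum_classPolynomial hz]
    simp only [h]

/-! ### The norms `b_ν` -/

theorem normElt_mem_posSubsemiring (ν : Composition n) : normElt ν ∈ posSubsemiring n := by
  rw [normElt_eq]
  exact normJucysMurphy_mem_posSubsemiring (lt_of_mem_innerIdx ν)

theorem normElt_mem_center (ν : Composition n) :
    normElt ν ∈ Subalgebra.center ℤ[X] (Hecke n) := by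
  rw [normElt_eq]
  exact mem_center_iff_forall_commute_Ts.2 (commute_Ts_normJucysMurphy (lt_of_mem_innerIdx ν))

theorem eval_coeffT_coxeterProd_normElt_pos (ν : Composition n) :
    0 < (coeffT (coxeterProd (innerIdx ν.blocks) n) (normElt ν)).eval 0 := by
  rw [normElt_eq]
  exact eval_coeffT_normJucysMurphy_pos (lt_of_mem_innerIdx ν)

/-- The matrix of the coefficients of the norms `b_c`, for one composition `c` of each cycle type,
at the class representatives. -/
noncomputable def normMatrix (n : ℕ) : Matrix n.Partition n.Partition ℤ[X] := fun ν μ =>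
  coeffT (classRep ν) (normElt (classComp μ))

theorem eval_normMatrix (n : ℕ) : (evalRingHom (0 : ℤ)).mapMatrix (normMatrix n) =
    Matrix.diagonal fun ν => (normMatrix n ν ν).eval 0 := by
  ext ν μ
  rcases eq_or_ne ν μ with rfl | h
  · simp
  · rw [Matrix.diagonal_apply_ne _ h, RingHom.mapMatrix_apply, Matrix.map_apply, normMatrix,
      normElt_eq]
    refine eval_coeffT_normJucysMurphy_eq_zero (lt_of_mem_innerIdx _) fun hconj => h ?_
    rw [← cycleClass_classRep ν, ← cycleClass_classRep μ]
    exact cycleClass_eq_iff.2 hconj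

theorem det_normMatrix_ne_zero (n : ℕ) : (normMatrix n).det ≠ 0 := by
  intro hdet
  have h := congrArg (evalRingHom (0 : ℤ)) hdet
  rw [RingHom.map_det, eval_normMatrix, Matrix.det_diagonal, map_zero,
    Finset.prod_eq_zero_iff] at h
  obtain ⟨ν, -, hν⟩ := h
  exact (eval_coeffT_coxeterProd_normElt_pos (classComp ν)).ne' hν

theorem eq_zero_of_sum_mul_coeffT_normElt {x : n.Partition → ℤ[X]}
    (hx : ∀ μ, ∑ ν, x ν * coeffT (classRep ν) (normElt (classComp μ)) = 0) : x = 0 :=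
  Matrix.eq_zero_of_vecMul_eq_zero (det_normMatrix_ne_zero n) (funext hx)

/-! ### The class elements -/

theorem classPolynomial_classRep (μ : n.Partition) :
    classPolynomial (classRep μ) = Pi.single μ 1 := by
  refine sub_eq_zero.1 (eq_zero_of_sum_mul_coeffT_normElt fun lam => ?_)
  simp only [Pi.sub_apply, sub_mul, Finset.sum_sub_distrib]
  rw [← coeffT_eq_sum_classPolynomial (normElt_mem_center _)]
  simp [Pi.single_apply]

/-- The class element `Γ_ν`, the central element whose coefficients are the class polynomials. -/
noncomputable def classElement (ν : n.Partition) : Hecke n :=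
  ∑ w, classPolynomial w ν • T w

theorem coeffT_classElement (w : Perm (Fin n)) (ν : n.Partition) :
    coeffT w (classElement ν) = classPolynomial w ν :=
  coeffT_sum _ w

theorem sum_coeffT_smul_classElement (hz : z ∈ Subalgebra.center ℤ[X] (Hecke n)) :
    ∑ ν, coeffT (classRep ν) z • classElement ν = z := by
  refine ext_coeffT fun w => ?_
  rw [coeffT_eq_sum_classPolynomial hz w, map_sum]
  simp only [map_smul, smul_eq_mul, coeffT_classElement, mul_comm]

/- The commutators of `T_{s_k}` with the `Γ_ν` satisfy the linear relations that hold because the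
central elements `b_c` are combinations of the `Γ_ν`; these relations have nonzero determinant. -/
theorem commute_Ts_classElement (k : ℕ) (ν : n.Partition) :
    Commute (Ts k) (classElement ν) := by
  refine ext_coeffT fun w => sub_eq_zero.1 ?_
  rw [← map_sub]
  refine congrFun (eq_zero_of_sum_mul_coeffT_normElt
    (x := fun ν => coeffT w (Ts k * classElement ν - classElement ν * Ts k)) fun μ => ?_) ν
  have hb := (commute_of_mem_center (normElt_mem_center (classComp μ)) (Ts k)).eq
  rw [← sum_coeffT_smul_classElement (normElt_mem_center (classComp μ))] at hb
  simpa [Finset.mul_sum, Finset.sum_mul, mul_sub, mul_comm, sub_eq_zero] using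
    congrArg (coeffT w) hb

theorem classElement_mem_center (ν : n.Partition) :
    classElement ν ∈ Subalgebra.center ℤ[X] (Hecke n) :=
  mem_center_iff_forall_commute_Ts.2 fun k => commute_Ts_classElement k ν

section

variable {Γ : n.Partition → Hecke n}

theorem IsClassElements.coeffT_classRep (h : IsClassElements Γ) (μ ν : n.Partition) :
    coeffT (classRep μ) (Γ ν) = if μ = ν then 1 else 0 := by
  obtain ⟨w, hw, rfl⟩ := exists_isShortest μ
  obtain ⟨hz, f, hf, -, -, hone, hzero⟩ := h ν
  rw [← eqOnCenter_classRep_of_isShortest hw _ hz, hf, coeffT_sum]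
  split_ifs with hν
  · exact hone w hw (inClass_iff.2 hν)
  · exact hzero w hw fun h => hν (inClass_iff.1 h)

theorem isClassElements_of_coeffT_classRep (hz : ∀ ν, Γ ν ∈ Subalgebra.center ℤ[X] (Hecke n))
    (h : ∀ μ ν, coeffT (classRep μ) (Γ ν) = if μ = ν then 1 else 0) : IsClassElements Γ := by
  intro ν
  have heval : ∀ w, (coeffT w (Γ ν)).eval 0 = if cycleClass w = ν then 1 else 0 := by
    intro w
    rw [eval_coeffT_eq_of_isConj (hz ν) (isConj_classRep w), h]
    split_ifs <;> simp
  have hshort : ∀ w, IsShortest w → coeffT w (Γ ν) = if cycleClass w = ν then 1 else 0 :=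
    fun w hw => (eqOnCenter_classRep_of_isShortest hw _ (hz ν)).trans (h _ ν)
  refine ⟨hz ν, fun w => coeffT w (Γ ν), (sum_coeffT _).symm, fun w hw => ?_, fun w hw => ?_,
    fun w hs hw => ?_, fun w hs hw => ?_⟩ <;> rw [inClass_iff] at hw
  · exact (heval w).trans (if_pos hw)
  · exact (heval w).trans (if_neg hw)
  · exact (hshort w hs).trans (if_pos hw)
  · exact (hshort w hs).trans (if_neg hw)

theorem isClassElements_classElement : IsClassElements (classElement (n := n)) :=
  isClassElements_of_coeffT_classRep classElement_mem_center fun μ ν => by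
    rw [coeffT_classElement, classPolynomial_classRep, Pi.single_apply]
    simp only [eq_comm]

theorem existsUnique_isClassElements : ∃! Γ : n.Partition → Hecke n, IsClassElements Γ := by
  refine ⟨classElement, isClassElements_classElement, fun Γ h => funext fun ν =>
    eq_of_coeffT_classRep (h ν).1 (classElement_mem_center ν) fun μ => ?_⟩
  rw [h.coeffT_classRep, isClassElements_classElement.coeffT_classRep]

theorem IsClassElements.eq_sum_smul_iff (h : IsClassElements Γ)
    (hz : z ∈ Subalgebra.center ℤ[X] (Hecke n)) (c : n.Partition → ℤ[X]) :
    z = ∑ ν, c ν • Γ ν ↔ c = fun ν => coeffT (classRep ν) z := by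
  have hcoeff : ∀ (c : n.Partition → ℤ[X]) μ, coeffT (classRep μ) (∑ ν, c ν • Γ ν) = c μ := by
    intro c μ
    simp [map_sum, h.coeffT_classRep]
  constructor
  · rintro rfl
    exact funext fun μ => (hcoeff c μ).symm
  · rintro rfl
    exact eq_of_coeffT_classRep hz
      (Subalgebra.sum_mem _ fun ν _ => Subalgebra.smul_mem _ (h ν).1 _) fun μ =>
        (hcoeff (fun ν => coeffT (classRep ν) z) μ).symm

end

/-! ### Comparison of norms -/

theorem Refines.normElt_sub_mem_posSubsemiring {lam mu : Composition n} (h : Refines lam mu) :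
    normElt lam - (X : ℤ[X]) ^ (minLen mu - minLen lam) • normElt mu ∈ posSubsemiring n := by
  rw [normElt_eq, normElt_eq, minLen_eq, minLen_eq,
    ← Set.ncard_sdiff h.innerIdx_subset (finite_innerIdx lam)]
  exact normJucysMurphy_sub_mem_posSubsemiring (lt_of_mem_innerIdx mu) h.innerIdx_subset

theorem X_pow_smul_normElt_mem_posSubsemiring (k : ℕ) (ν : Composition n) :
    (X : ℤ[X]) ^ k • normElt ν ∈ posSubsemiring n :=
  smul_mem_posSubsemiring (pow_mem X_mem_polyNonneg k) (normElt_mem_posSubsemiring ν)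

theorem StrictRefines.minLen_lt {lam mu : Composition n} (h : StrictRefines lam mu) :
    minLen lam < minLen mu := by
  rw [minLen_eq, minLen_eq]
  exact Set.ncard_lt_ncard (h.1.innerIdx_subset.ssubset_of_ne fun e => h.2 (innerIdx_injective e))
    (finite_innerIdx mu)

theorem StrictRefines.heckeLT {lam mu : Composition n} (h : StrictRefines lam mu) :
    HeckeLT ((X : ℤ[X]) ^ (minLen mu - minLen lam) • normElt mu) (normElt lam) := by
  refine ⟨mem_posCone_iff.2 (X_pow_smul_normElt_mem_posSubsemiring _ mu),
    mem_posCone_iff.2 (normElt_mem_posSubsemiring lam),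
    mem_posCone_iff.2 h.1.normElt_sub_mem_posSubsemiring, fun heq => ?_⟩
  -- at `ξ = 0` the left-hand side vanishes, while `b_lam` has a positive coefficient at `w_lam`
  have hpos := eval_coeffT_coxeterProd_normElt_pos lam
  have hexp : minLen mu - minLen lam ≠ 0 := Nat.sub_ne_zero_of_lt h.minLen_lt
  rw [sub_eq_zero.1 heq, map_smul, smul_eq_mul, eval_mul, eval_pow, eval_X, zero_pow hexp,
    zero_mul] at hpos
  exact lt_irrefl _ hpos

theorem Refines.polyLE_coeffT {lam mu : Composition n} (h : Refines lam mu) (w : Perm (Fin n)) :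
    PolyLE (X ^ (minLen mu - minLen lam) * coeffT w (normElt mu)) (coeffT w (normElt lam)) := by
  rw [← smul_eq_mul, ← map_smul]
  refine ⟨X_pow_smul_normElt_mem_posSubsemiring _ mu w, normElt_mem_posSubsemiring lam w, ?_⟩
  rw [← map_sub]
  exact h.normElt_sub_mem_posSubsemiring w
end HeckeNorm

theorem mainTheorem5 (n : ℕ) :
    (∀ lam mu : Composition n, HeckeNorm.StrictRefines lam mu →
      HeckeNorm.HeckeLT
        ((Polynomial.X : Polynomial ℤ) ^ (HeckeNorm.minLen mu - HeckeNorm.minLen lam) •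
          HeckeNorm.normElt mu)
        (HeckeNorm.normElt lam)) ∧
    (∃! Γ : n.Partition → HeckeNorm.Hecke n, HeckeNorm.IsClassElements Γ) ∧
    (∀ Γ : n.Partition → HeckeNorm.Hecke n, HeckeNorm.IsClassElements Γ →
      ∃ r : Composition n → n.Partition → Polynomial ℤ,
        (∀ (α : Composition n) (c : n.Partition → Polynomial ℤ),
          HeckeNorm.normElt α = ∑ ν, c ν • Γ ν ↔ c = r α) ∧
        (∀ α β : Composition n, HeckeNorm.StrictRefines α β → ∀ ν : n.Partition,
          HeckeNorm.PolyLE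
            (Polynomial.X ^ (HeckeNorm.minLen β - HeckeNorm.minLen α) * r β ν) (r α ν))) := by
  refine ⟨fun lam mu h => h.heckeLT, HeckeNorm.existsUnique_isClassElements, fun Γ hΓ =>
    ⟨fun α ν => HeckeNorm.coeffT (HeckeNorm.classRep ν) (HeckeNorm.normElt α), fun α c =>
      hΓ.eq_sum_smul_iff (HeckeNorm.normElt_mem_center α) c, fun α β h ν => h.1.polyLE_coeffT _⟩⟩
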